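/- **Setting (assumptions A′–ΣT′).** Let $1<U_0<\infty$, $1<V_0\le\infty$ and $\mathcal D=[1,U_0]\times[1,V_0)$ with coordinates $(u,v)$. Let $\Omega>0$ be a $C^1$ function, $r>0$ a $C^2$ function and $\phi$ a real-valued $C^1$ function on $\mathcal D$, let $e\in\mathbb R$, and equip $\mathcal D$ with the Lorentzian metric $\bar g=-\frac{\Omega^2}{2}(du\otimes dv+dv\otimes du)$. Define $$\nu=\partial_ur,\quad \lambda=\partial_vr,\quad \zeta=r\,\partial_u\phi,\quad \theta=r\,\partial_v\phi,\quad m=\tfrac r2\bigl(1-\bar g(\nabla r,\nabla r)\bigr),\quad \mu=\tfrac{2m}{r},\quad \varpi=m+\tfrac{e^2}{2r},\quad \kappa=-\tfrac14\Omega^2\nu^{-1}.$$ Fix $\omega$ with $1<\omega\le 3$ and assume: 1. $\sup_{v}r(u,v)=\infty$ for every $u\in[1,U_0)$, whereas $r_+:=\sup_{v}r(U_0,v)<\infty$; 2. $\nu<0$ and $\lambda\ge 0$ on $\mathcal D$, and $\lambda>0$ where $u<U_0$; 3. for some constant $C_0$, on the outgoing curve $\{u=1\}$, $\;r\left|\frac{\theta}{\lambda}\right|\le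 C_0$ and $r^{\omega}\left|\phi+\frac{\theta}{\lambda}\right|\le C_0$; 4. $0<\sup_{u=1}m<\infty$; 5. pointwise on $\mathcal D$ (including the existence of the derivatives on the left) $$\partial_u\varpi=\tfrac12(1-\mu)\left(\tfrac\zeta\nu\right)^2\nu,\qquad \partial_v\varpi=\tfrac12\kappa^{-1}\theta^2,\qquad \partial_u\kappa=\tfrac1r\left(\tfrac\zeta\nu\right)^2\nu\kappa,\qquad \partial_u\theta=-\tfrac{\zeta\lambda}{r},\qquad \partial_v\zeta=-\tfrac{\theta\nu}{r};$$ 6. $r_+\ne|e|$. Normalize the advanced time by setting $v_\star(v)=1+\int_1^v\kappa(1,s)\,ds$ (so that $v_\star=1$ at the point $(1,1)$, and $\kappa=1$ along $\{u=1\}$ when computed with $v_\star$), and let $$\lambda_\star=\frac{\partial r}{\partial v_\star}=\frac{\lambda(u,v)}{\kappa(1,v)},\qquad \theta_\star=r\,\frac{\partial\phi}{\partial v_\star}=\frac{\theta(u,v)}{\kappa(1,v)}.$$ **Theorem 9.3.** For every $\epsilon>0$ there exist constants $C>0$ and $\delta>0$ such that at every point of $\mathcal D$ (including the event horizon $\{u=U_0\}$)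 at which $r\le\delta v_\star$, $$|\phi|\le C\left(v_\star^{-(\omega-\epsilon)}r^{-1}+v_\star^{-\omega}\right),$$ $$|\theta_\star|\le C\left(v_\star^{-(\omega-\epsilon)}r^{-1}+v_\star^{-\omega}\right),$$ $$|\phi\lambda_\star+\theta_\star|\le C\left(v_\star^{-(\omega-\epsilon)}r^{-1}+v_\star^{-\omega}\right).$$ -/

import Mathlib

noncomputable section

namespace SphericalCollapse

/-- The data of a two-dimensional spacetime `𝒟` in a global null coordinate chart `(u, v)` with
range `[1, U₀] × [1, V₀)`: the conformal factor `Ω` of the metric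
`-(Ω² / 2) (du ⊗ dv + dv ⊗ du)`, the area radius `r`, the scalar field `φ` and the charge `e`.
The laws that these have to satisfy are collected in `SphericalCollapse.Assumptions`. -/
structure Data where
  U₀ : ℝ
  V₀ : EReal
  Ω : ℝ × ℝ → ℝ
  r : ℝ × ℝ → ℝ
  φ : ℝ × ℝ → ℝ
  e : ℝ

namespace Data

variable (S : Data)

/-- The range `[1, U₀]` of the coordinate `u`. -/
def uRange : Set ℝ := Set.Icc 1 S.U₀

/-- The range `[1, V₀)` of the coordinate `v`, where `V₀` may be infinite. -/
def vRange : Set ℝ := {v | 1 ≤ v ∧ (v : EReal) < S.V₀}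

/-- The domain `𝒟 = [1, U₀] × [1, V₀)`; points are pairs `(u, v)`. -/
def dom : Set (ℝ × ℝ) := S.uRange ×ˢ S.vRange

/-- The partial derivative `∂_u f` on `𝒟` (one-sided at the edges of `𝒟`). -/
def du (f : ℝ × ℝ → ℝ) (p : ℝ × ℝ) : ℝ :=
  derivWithin (fun u => f (u, p.2)) S.uRange p.1

/-- The partial derivative `∂_v f` on `𝒟` (one-sided at the edge of `𝒟`). -/
def dv (f : ℝ × ℝ → ℝ) (p : ℝ × ℝ) : ℝ :=
  derivWithin (fun v => f (p.1, v)) S.vRange p.2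

/-- `ν = ∂_u r`. -/
def nu (p : ℝ × ℝ) : ℝ := S.du S.r p

/-- `λ = ∂_v r`. -/
def lam (p : ℝ × ℝ) : ℝ := S.dv S.r p

/-- `ζ = r ∂_u φ`. -/
def zeta (p : ℝ × ℝ) : ℝ := S.r p * S.du S.φ p

/-- `θ = r ∂_v φ`. -/
def theta (p : ℝ × ℝ) : ℝ := S.r p * S.dv S.φ p

/-- The Lorentzian metric `-(Ω² / 2) (du ⊗ dv + dv ⊗ du)` as a matrix in the frame
`(∂_u, ∂_v)`. -/
def metric (p : ℝ × ℝ) : Matrix (Fin 2) (Fin 2) ℝ :=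
  !![0, -(S.Ω p ^ 2 / 2); -(S.Ω p ^ 2 / 2), 0]

/-- The components of the gradient `∇r` in the frame `(∂_u, ∂_v)`. -/
def gradR (p : ℝ × ℝ) : Fin 2 → ℝ :=
  (S.metric p)⁻¹.mulVec ![S.nu p, S.lam p]

/-- `g(∇r, ∇r)`. -/
def gradRSq (p : ℝ × ℝ) : ℝ :=
  dotProduct (S.gradR p) ((S.metric p).mulVec (S.gradR p))

/-- The Hawking mass `m = (r / 2) (1 - g(∇r, ∇r))`. -/
def mass (p : ℝ × ℝ) : ℝ := S.r p / 2 * (1 - S.gradRSq p)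

/-- The mass aspect function `μ = 2 m / r`. -/
def mu (p : ℝ × ℝ) : ℝ := 2 * S.mass p / S.r p

/-- The renormalized Hawking mass `ϖ = m + e² / (2 r)`. -/
def varpi (p : ℝ × ℝ) : ℝ := S.mass p + S.e ^ 2 / (2 * S.r p)

/-- `κ = -(1/4) Ω² ν⁻¹`. -/
def kappa (p : ℝ × ℝ) : ℝ := -(1 / 4) * S.Ω p ^ 2 * (S.nu p)⁻¹

/-- `r₊`, the supremum of `r` on the event horizon `ℋ⁺ = {U₀} × [1, V₀)`. -/
def rPlus : ℝ := sSup ((fun v => S.r (S.U₀, v)) '' S.vRange)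

/-- The normalized advanced time `v⋆` as a function of the given coordinate `v`: the
reparametrization with `v⋆ = 1` at `(1, 1)` for which `κ⋆ = 1` along the outgoing curve `u = 1`.
Since `κ⋆ = (dv / dv⋆) κ`, this means `dv⋆ / dv = κ(1, v)`. -/
def advTime (v : ℝ) : ℝ := 1 + ∫ s in (1 : ℝ)..v, S.kappa (1, s)

/-- `λ⋆ = ∂r / ∂v⋆ = (dv / dv⋆) λ`, the function `λ` with respect to the normalized advanced
time. -/
def lamStar (p : ℝ × ℝ) : ℝ := S.lam p / S.kappa (1, p.2)

/-- `θ⋆ = r ∂φ / ∂v⋆ = (dv / dv⋆) θ`, the function `θ` with respect to the normalized advanced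
time. -/
def thetaStar (p : ℝ × ℝ) : ℝ := S.theta p / S.kappa (1, p.2)

end Data

/-- The standing assumptions on the spacetime, with decay exponent `ω` of the data on the outgoing
curve `u = 1`. -/
structure Assumptions (S : Data) (ω : ℝ) : Prop where
  -- The chart, the metric and the area radius.
  one_lt_U₀ : 1 < S.U₀
  one_lt_V₀ : 1 < S.V₀
  contDiffOn_Ω : ContDiffOn ℝ 1 S.Ω S.dom
  Ω_pos : ∀ p ∈ S.dom, 0 < S.Ω p
  contDiffOn_r : ContDiffOn ℝ 2 S.r S.dom
  r_pos : ∀ p ∈ S.dom, 0 < S.r p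
  -- `r` is unbounded along each outgoing curve before the event horizon, and bounded on the latter.
  not_bddAbove_r : ∀ u ∈ Set.Ico 1 S.U₀, ¬ BddAbove ((fun v => S.r (u, v)) '' S.vRange)
  bddAbove_r : BddAbove ((fun v => S.r (S.U₀, v)) '' S.vRange)
  -- The scalar field.
  contDiffOn_φ : ContDiffOn ℝ 1 S.φ S.dom
  -- Signs of the derivatives of `r`.
  lam_nonneg : ∀ p ∈ S.dom, 0 ≤ S.lam p
  nu_neg : ∀ p ∈ S.dom, S.nu p < 0
  lam_pos : ∀ p ∈ S.dom, p.1 < S.U₀ → 0 < S.lam p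
  -- Decay of the data on the outgoing curve `u = 1`.
  one_lt_ω : 1 < ω
  ω_le_three : ω ≤ 3
  initial_decay : ∃ C : ℝ, ∀ v ∈ S.vRange,
    S.r (1, v) * |S.theta (1, v) / S.lam (1, v)| ≤ C ∧
    S.r (1, v) ^ ω * |S.φ (1, v) + S.theta (1, v) / S.lam (1, v)| ≤ C
  -- The Hawking mass on the outgoing curve `u = 1`.
  bddAbove_mass : BddAbove ((fun v => S.mass (1, v)) '' S.vRange)
  sSup_mass_pos : 0 < sSup ((fun v => S.mass (1, v)) '' S.vRange)
  -- The equations, pointwise on `𝒟`, including the existence of the derivatives.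
  du_varpi : ∀ p ∈ S.dom, HasDerivWithinAt (fun u => S.varpi (u, p.2))
    (1 / 2 * (1 - S.mu p) * (S.zeta p / S.nu p) ^ 2 * S.nu p) S.uRange p.1
  dv_varpi : ∀ p ∈ S.dom, HasDerivWithinAt (fun v => S.varpi (p.1, v))
    (1 / 2 * (S.kappa p)⁻¹ * S.theta p ^ 2) S.vRange p.2
  du_kappa : ∀ p ∈ S.dom, HasDerivWithinAt (fun u => S.kappa (u, p.2))
    (1 / S.r p * (S.zeta p / S.nu p) ^ 2 * S.nu p * S.kappa p) S.uRange p.1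
  du_theta : ∀ p ∈ S.dom, HasDerivWithinAt (fun u => S.theta (u, p.2))
    (-(S.zeta p * S.lam p) / S.r p) S.uRange p.1
  dv_zeta : ∀ p ∈ S.dom, HasDerivWithinAt (fun v => S.zeta (p.1, v))
    (-(S.theta p * S.nu p) / S.r p) S.vRange p.2
  -- The black hole is not extremal in the limit.
  rPlus_ne : S.rPlus ≠ |S.e|

end SphericalCollapse

end

noncomputable section

open Set Filter Topology MeasureTheory

/-! The renormalized mass `ϖ` decreases along ingoing rays and increases along outgoing ones, so its
differences measure the energy fluxes of `φ`. On ingoing rays this energy degenerates with `1 - μ`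
at the horizon. Since `r₊ ≠ |e|`, in fact `r₊ > |e|` (`abs_e_lt_rPlus`), and at late times `1 - e² /
r²` is bounded below. This lower bound drives one current identity (`currents_divergence_le`)
containing the red-shift and the Morawetz estimate together. It controls the non-degenerate energy
`∫ ζ² / (-ν) du` on a late ray, and its spacetime integral with weight `r⁻⁴`, by the energy on an
earlier ray and the flux of `ϖ` through the outer side (`exists_energy_estimate`). Boundedness of
the energy and a lower bound for `κ` follow.

Decay is bootstrapped. Let `t = 1 + r(1, v) - r(u, v)` be a retarded time and `s > 0` small. `Decay`
at exponent `a` says that `|r φ| ≲ t^(-a) + min(r, t) t^(-ω)` far out and that the energy in `r ≤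
v^(2s)` is `≲ v^(-2a)`. Exponent `0` comes from bounded energy. Given exponent `a`, the wave
equation `∂_u ∂_v (r φ) = φ ∂_u λ = O(|ν| |φ| r⁻²)`, integrated from `u = 1`, yields `|∂_v (r φ)| ≲
v^(-ω) + v^(-a) r^(-3/2)` (`exists_abs_chi_le`); here `ω ≤ 3` enters. Hence the fluxes of `ϖ`
through outgoing segments in `R ≤ r ≤ c v / 2` are small as well (`exists_flux_le`).

The gain is an averaging argument (`exists_energy_le_of_large`): over a window of length `v^(10s)`,
the integral with weight `r⁻⁴` forces some ray to carry, in `r ≤ v^(2s)`, an energy smaller by the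
factor `v^(8s) / v^(10s) = v^(-2s)`. So `a` improves to `a + s`, up to the ceiling `ω - 5s` set by
the flux `v^(-2ω) v^(10s)`. Cauchy–Schwarz on ingoing rays and integration along outgoing rays turn
the better energy into a better bound for `r φ` (`exists_decay`), and finitely many rounds reach `ω
- 5s ≥ ω - ε`. The field bound then gives the claim for `R ≤ r ≤ δ v`, and the energy carries it
from `r = R` to the horizon.

The argument takes place in normalized advanced time (`NormalizedSolution`); the last parts pass to
it from the given chart. -/

namespace SphericalCollapse

/-! ### Mean value inequalities and a divergence inequality on rectangles. -/

section Calculus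

/-- A mean value inequality comparing the increments of two functions. -/
theorem sub_le_sub_of_hasDerivAt_le {f g f' g' : ℝ → ℝ} {a b : ℝ} (hab : a ≤ b)
    (hf : ContinuousOn f (Icc a b)) (hg : ContinuousOn g (Icc a b))
    (hf' : ∀ x ∈ Ioo a b, HasDerivAt f (f' x) x) (hg' : ∀ x ∈ Ioo a b, HasDerivAt g (g' x) x)
    (h : ∀ x ∈ Ioo a b, f' x ≤ g' x) : f b - f a ≤ g b - g a := by
  have hm : MonotoneOn (fun x => g x - f x) (Icc a b) := by
    refine monotoneOn_of_deriv_nonneg (convex_Icc a b) (hg.sub hf) ?_ ?_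
    · rw [interior_Icc]
      exact fun x hx => ((hg' x hx).sub (hf' x hx)).differentiableAt.differentiableWithinAt
    · rw [interior_Icc]
      intro x hx
      have h1 : deriv (fun x => g x - f x) x = g' x - f' x := ((hg' x hx).sub (hf' x hx)).deriv
      rw [h1]
      linarith [h x hx]
  have := hm (left_mem_Icc.2 hab) (right_mem_Icc.2 hab) hab
  simp only at this
  linarith

theorem abs_sub_le_sub_of_hasDerivAt_le {f g f' g' : ℝ → ℝ} {a b : ℝ} (hab : a ≤ b)
    (hf : ContinuousOn f (Icc a b)) (hg : ContinuousOn g (Icc a b))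
    (hf' : ∀ x ∈ Ioo a b, HasDerivAt f (f' x) x) (hg' : ∀ x ∈ Ioo a b, HasDerivAt g (g' x) x)
    (h : ∀ x ∈ Ioo a b, |f' x| ≤ g' x) : |f b - f a| ≤ g b - g a := by
  have h1 := sub_le_sub_of_hasDerivAt_le hab hf hg hf' hg'
    (fun x hx => (le_abs_self _).trans (h x hx))
  have h2 := sub_le_sub_of_hasDerivAt_le hab hf.neg hg (fun x hx => (hf' x hx).neg) hg'
    (fun x hx => (neg_le_abs _).trans (h x hx))
  simp only [Pi.neg_apply] at h2
  rw [abs_le]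
  constructor <;> linarith

theorem monotoneOn_of_hasDerivAt_nonneg {f f' : ℝ → ℝ} {a b : ℝ} (hab : a ≤ b)
    (hf : ContinuousOn f (Icc a b)) (hf' : ∀ x ∈ Ioo a b, HasDerivAt f (f' x) x)
    (h : ∀ x ∈ Ioo a b, 0 ≤ f' x) : f a ≤ f b := by
  have := sub_le_sub_of_hasDerivAt_le (f := fun _ => (0 : ℝ)) (f' := fun _ => 0) hab
    continuousOn_const hf (fun x _ => hasDerivAt_const x _) hf' h
  linarith

theorem integral_le_integral_of_le {f g : ℝ → ℝ} {a b : ℝ} (hab : a ≤ b) (hf : Continuous f)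
    (hg : Continuous g) (h : ∀ x ∈ Ioo a b, f x ≤ g x) :
    ∫ x in a..b, f x ≤ ∫ x in a..b, g x :=
  intervalIntegral.integral_mono_on_of_le_Ioo hab (hf.intervalIntegrable _ _)
    (hg.intervalIntegrable _ _) h

/-- The mean value property: a continuous function is somewhere at most its average. -/
theorem exists_mul_le_integral {f : ℝ → ℝ} {a b : ℝ} (hab : a ≤ b) (hf : Continuous f) :
    ∃ x ∈ Icc a b, f x * (b - a) ≤ ∫ x in a..b, f x := by
  obtain ⟨x, hx, hmin⟩ := isCompact_Icc.exists_isMinOn (nonempty_Icc.2 hab) hf.continuousOn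
  refine ⟨x, hx, ?_⟩
  have := integral_le_integral_of_le hab (continuous_const (y := f x)) hf
    (fun y hy => hmin (Ioo_subset_Icc_self hy))
  simpa [mul_comm] using this

theorem integral_integral_swap_of_continuous {f : ℝ → ℝ → ℝ}
    (hf : Continuous fun p : ℝ × ℝ => f p.1 p.2) (a b c d : ℝ) :
    ∫ x in a..b, ∫ y in c..d, f x y = ∫ y in c..d, ∫ x in a..b, f x y := by
  apply intervalIntegral_intervalIntegral_swap
  have hc : IsCompact (uIcc a b ×ˢ uIcc c d) := isCompact_uIcc.prod isCompact_uIcc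
  exact (hf.continuousOn.integrableOn_compact hc).mono_set
    (prod_mono uIoc_subset_uIcc uIoc_subset_uIcc)

/-- Integration over a rectangle of a divergence inequality `s + ∂_v p ≤ ∂_u q`. -/
theorem integral_divergence_le {p q s p' q' : ℝ → ℝ → ℝ} {a b c d : ℝ} (hab : a ≤ b) (hcd : c ≤ d)
    (hp : Continuous fun z : ℝ × ℝ => p z.1 z.2) (hq : Continuous fun z : ℝ × ℝ => q z.1 z.2)
    (hs : Continuous fun z : ℝ × ℝ => s z.1 z.2)
    (hp' : Continuous fun z : ℝ × ℝ => p' z.1 z.2) (hq' : Continuous fun z : ℝ × ℝ => q' z.1 z.2)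
    (hpd : ∀ u ∈ Icc a b, ∀ v ∈ Ioo c d, HasDerivAt (fun v => p u v) (p' u v) v)
    (hqd : ∀ v ∈ Icc c d, ∀ u ∈ Ioo a b, HasDerivAt (fun u => q u v) (q' u v) u)
    (h : ∀ u ∈ Ioo a b, ∀ v ∈ Ioo c d, s u v + p' u v ≤ q' u v) :
    (∫ v in c..d, ∫ u in a..b, s u v) + ∫ u in a..b, p u d ≤
      (∫ u in a..b, p u c) + ((∫ v in c..d, q b v) - ∫ v in c..d, q a v) := by
  have cu : ∀ {f : ℝ → ℝ → ℝ}, (Continuous fun z : ℝ × ℝ => f z.1 z.2) → ∀ v,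
      Continuous fun u => f u v := fun hf v =>
    hf.comp (by fun_prop : Continuous fun u : ℝ => (u, v))
  have cv : ∀ {f : ℝ → ℝ → ℝ}, (Continuous fun z : ℝ × ℝ => f z.1 z.2) → ∀ u,
      Continuous fun v => f u v := fun hf u =>
    hf.comp (by fun_prop : Continuous fun v : ℝ => (u, v))
  have ci : ∀ {f : ℝ → ℝ → ℝ}, (Continuous fun z : ℝ × ℝ => f z.1 z.2) →
      Continuous fun v => ∫ u in a..b, f u v := by
    intro f hf
    apply intervalIntegral.continuous_parametric_intervalIntegral_of_continuous'
    exact hf.comp continuous_swap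
  have ep : ∫ v in c..d, ∫ u in a..b, p' u v = (∫ u in a..b, p u d) - ∫ u in a..b, p u c := by
    rw [← integral_integral_swap_of_continuous hp', ← intervalIntegral.integral_sub
      ((cu hp d).intervalIntegrable _ _) ((cu hp c).intervalIntegrable _ _)]
    refine intervalIntegral.integral_congr fun u hu => ?_
    rw [uIcc_of_le hab] at hu
    exact intervalIntegral.integral_eq_sub_of_hasDerivAt_of_le hcd (cv hp u).continuousOn
      (hpd u hu) ((cv hp' u).intervalIntegrable _ _)
  have eq : ∫ v in c..d, ∫ u in a..b, q' u v = (∫ v in c..d, q b v) - ∫ v in c..d, q a v := by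
    rw [← intervalIntegral.integral_sub
      ((cv hq b).intervalIntegrable _ _) ((cv hq a).intervalIntegrable _ _)]
    refine intervalIntegral.integral_congr fun v hv => ?_
    rw [uIcc_of_le hcd] at hv
    exact intervalIntegral.integral_eq_sub_of_hasDerivAt_of_le hab (cu hq v).continuousOn
      (hqd v hv) ((cu hq' v).intervalIntegrable _ _)
  have hle : ∫ v in c..d, ((∫ u in a..b, s u v) + ∫ u in a..b, p' u v) ≤
      ∫ v in c..d, ∫ u in a..b, q' u v := by
    refine integral_le_integral_of_le hcd ((ci hs).add (ci hp')) (ci hq') fun v hv => ?_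
    rw [← intervalIntegral.integral_add ((cu hs v).intervalIntegrable _ _)
      ((cu hp' v).intervalIntegrable _ _)]
    exact integral_le_integral_of_le hab ((cu hs v).add (cu hp' v)) (cu hq' v)
      fun u hu => h u hu v hv
  rw [intervalIntegral.integral_add ((ci hs).intervalIntegrable _ _)
    ((ci hp').intervalIntegrable _ _), ep, eq] at hle
  linarith

end Calculus

/-! ### The equations in normalized advanced time. -/

/-- A solution in the gauge `κ = 1` on `u = 1`, in which the advanced time ranges over `[1, ∞)`.
For convenience the functions are extended continuously to all of `ℝ²`; the equations are only
required on `[1, U] × [1, ∞)`. -/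
structure NormalizedSolution where
  U : ℝ
  e : ℝ
  M : ℝ
  C₀ : ℝ
  ω : ℝ
  rPlus : ℝ
  r : ℝ → ℝ → ℝ
  nu : ℝ → ℝ → ℝ
  lam : ℝ → ℝ → ℝ
  kappa : ℝ → ℝ → ℝ
  varpi : ℝ → ℝ → ℝ
  φ : ℝ → ℝ → ℝ
  theta : ℝ → ℝ → ℝ
  zeta : ℝ → ℝ → ℝ
  one_lt_U : 1 < U
  one_lt_ω : 1 < ω
  ω_le_three : ω ≤ 3
  continuous_r : Continuous fun p : ℝ × ℝ => r p.1 p.2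
  continuous_nu : Continuous fun p : ℝ × ℝ => nu p.1 p.2
  continuous_lam : Continuous fun p : ℝ × ℝ => lam p.1 p.2
  continuous_kappa : Continuous fun p : ℝ × ℝ => kappa p.1 p.2
  continuous_varpi : Continuous fun p : ℝ × ℝ => varpi p.1 p.2
  continuous_φ : Continuous fun p : ℝ × ℝ => φ p.1 p.2
  continuous_theta : Continuous fun p : ℝ × ℝ => theta p.1 p.2
  continuous_zeta : Continuous fun p : ℝ × ℝ => zeta p.1 p.2
  r_pos : ∀ u v, 0 < r u v
  nu_neg : ∀ u v, nu u v < 0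
  kappa_pos : ∀ u v, 0 < kappa u v
  lam_nonneg : ∀ u v, 0 ≤ lam u v
  lam_pos : ∀ u v, u < U → 0 < lam u v
  lam_eq : ∀ u v, lam u v = kappa u v * (1 - 2 * varpi u v / r u v + e ^ 2 / r u v ^ 2)
  kappa_one : ∀ v, kappa 1 v = 1
  varpi_one_le : ∀ v, varpi 1 v ≤ M
  decay_theta : ∀ v, r 1 v * |theta 1 v / lam 1 v| ≤ C₀
  decay_φ : ∀ v, r 1 v ^ ω * |φ 1 v + theta 1 v / lam 1 v| ≤ C₀
  du_r : ∀ u ∈ Ioo 1 U, ∀ v, HasDerivAt (fun u => r u v) (nu u v) u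
  dv_r : ∀ u, ∀ v > 1, HasDerivAt (fun v => r u v) (lam u v) v
  du_φ : ∀ u ∈ Ioo 1 U, ∀ v, HasDerivAt (fun u => φ u v) (zeta u v / r u v) u
  dv_φ : ∀ u, ∀ v > 1, HasDerivAt (fun v => φ u v) (theta u v / r u v) v
  dv_nu : ∀ u, ∀ v > 1, HasDerivAt (fun v => nu u v)
    (2 * nu u v * kappa u v / r u v ^ 2 * (varpi u v - e ^ 2 / r u v)) v
  du_lam : ∀ u ∈ Ioo 1 U, ∀ v, HasDerivAt (fun u => lam u v)
    (2 * nu u v * kappa u v / r u v ^ 2 * (varpi u v - e ^ 2 / r u v)) u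
  du_varpi : ∀ u ∈ Ioo 1 U, ∀ v, HasDerivAt (fun u => varpi u v)
    (1 / 2 * (1 - 2 * varpi u v / r u v + e ^ 2 / r u v ^ 2) * (zeta u v / nu u v) ^ 2 * nu u v) u
  dv_varpi : ∀ u, ∀ v > 1, HasDerivAt (fun v => varpi u v)
    (1 / 2 * (kappa u v)⁻¹ * theta u v ^ 2) v
  du_kappa : ∀ u ∈ Ioo 1 U, ∀ v, HasDerivAt (fun u => kappa u v)
    (1 / r u v * (zeta u v / nu u v) ^ 2 * nu u v * kappa u v) u
  du_theta : ∀ u ∈ Ioo 1 U, ∀ v, HasDerivAt (fun u => theta u v)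
    (-(zeta u v * lam u v) / r u v) u
  dv_zeta : ∀ u, ∀ v > 1, HasDerivAt (fun v => zeta u v)
    (-(theta u v * nu u v) / r u v) v
  unbounded_r : ∀ u ∈ Ico 1 U, ∀ B, ∃ v ≥ 1, B < r u v
  r_U_le : ∀ v, r U v ≤ rPlus
  exists_lt_r_U : ∀ x < rPlus, ∃ v ≥ 1, x < r U v
  rPlus_ne : rPlus ≠ |e|

namespace NormalizedSolution

variable (S : NormalizedSolution)

attribute [fun_prop] continuous_r continuous_nu continuous_lam continuous_kappa continuous_varpi
  continuous_φ continuous_theta continuous_zeta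

end NormalizedSolution

/-! ### Energy density, monotonicity, and the horizon radius. -/

namespace NormalizedSolution

variable (S : NormalizedSolution)

/-- `1 - μ`. -/
def oneSubMu (u v : ℝ) : ℝ := 1 - 2 * S.varpi u v / S.r u v + S.e ^ 2 / S.r u v ^ 2

/-- The non-degenerate energy of the scalar field on an ingoing null segment. -/
def ingoingEnergy (u₁ u₂ v : ℝ) : ℝ := ∫ u in u₁..u₂, S.zeta u v ^ 2 / (-S.nu u v)

/-- A retarded time: the amount by which `r` has decreased from `u = 1`. -/
def retTime (u v : ℝ) : ℝ := 1 + S.r 1 v - S.r u v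

/-- The outgoing derivative `∂_v (r φ)`. -/
def chi (u v : ℝ) : ℝ := S.φ u v * S.lam u v + S.theta u v

theorem r_ne (u v : ℝ) : S.r u v ≠ 0 := (S.r_pos u v).ne'
theorem nu_ne (u v : ℝ) : S.nu u v ≠ 0 := (S.nu_neg u v).ne
theorem kappa_ne (u v : ℝ) : S.kappa u v ≠ 0 := (S.kappa_pos u v).ne'
theorem neg_nu_pos (u v : ℝ) : 0 < -S.nu u v := neg_pos.2 (S.nu_neg u v)
theorem neg_nu_ne (u v : ℝ) : -S.nu u v ≠ 0 := (S.neg_nu_pos u v).ne'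

theorem lam_eq_mul (u v : ℝ) : S.lam u v = S.kappa u v * S.oneSubMu u v := S.lam_eq u v

theorem oneSubMu_nonneg (u v : ℝ) : 0 ≤ S.oneSubMu u v :=
  nonneg_of_mul_nonneg_right ((S.lam_nonneg u v).trans_eq (S.lam_eq_mul u v)) (S.kappa_pos u v)

theorem continuous_oneSubMu : Continuous fun p : ℝ × ℝ => S.oneSubMu p.1 p.2 := by
  have h := S.r_ne
  unfold oneSubMu
  fun_prop (disch := simp [h])

theorem continuous_chi : Continuous fun p : ℝ × ℝ => S.chi p.1 p.2 := by
  unfold chi; fun_prop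

theorem continuous_retTime : Continuous fun p : ℝ × ℝ => S.retTime p.1 p.2 := by
  unfold retTime; fun_prop

attribute [fun_prop] continuous_oneSubMu continuous_chi continuous_retTime

theorem continuous_energyDensity :
    Continuous fun p : ℝ × ℝ => S.zeta p.1 p.2 ^ 2 / (-S.nu p.1 p.2) := by
  have h := S.nu_ne
  fun_prop (disch := simp [h])

theorem energyDensity_nonneg (u v : ℝ) : 0 ≤ S.zeta u v ^ 2 / (-S.nu u v) :=
  div_nonneg (sq_nonneg _) (S.neg_nu_pos u v).le

theorem continuous_energyDensity_left (v : ℝ) :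
    Continuous fun u => S.zeta u v ^ 2 / (-S.nu u v) :=
  S.continuous_energyDensity.comp (by fun_prop : Continuous fun u : ℝ => (u, v))

theorem ingoingEnergy_nonneg {u₁ u₂ : ℝ} (h : u₁ ≤ u₂) (v : ℝ) : 0 ≤ S.ingoingEnergy u₁ u₂ v :=
  intervalIntegral.integral_nonneg h fun u _ => S.energyDensity_nonneg u v

theorem continuous_ingoingEnergy (u₁ u₂ : ℝ) : Continuous fun v => S.ingoingEnergy u₁ u₂ v := by
  apply intervalIntegral.continuous_parametric_intervalIntegral_of_continuous'
  exact S.continuous_energyDensity.comp continuous_swap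

theorem hasDerivAt_ingoingEnergy (u₁ u v : ℝ) :
    HasDerivAt (fun u => S.ingoingEnergy u₁ u v) (S.zeta u v ^ 2 / (-S.nu u v)) u :=
  ((S.continuous_energyDensity_left v).integral_hasStrictDerivAt u₁ u).hasDerivAt

theorem continuous_ingoingEnergy_left (u₁ v : ℝ) :
    Continuous fun u => S.ingoingEnergy u₁ u v :=
  continuous_iff_continuousAt.2 fun u => (S.hasDerivAt_ingoingEnergy u₁ u v).continuousAt

theorem ingoingEnergy_mono {u₀ u₁ : ℝ} (h₀ : u₀ ≤ u₁) (u₂ v : ℝ) :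
    S.ingoingEnergy u₁ u₂ v ≤ S.ingoingEnergy u₀ u₂ v := by
  have hi := fun a b => (S.continuous_energyDensity_left v).intervalIntegrable
    (μ := volume) a b
  have h1 : S.ingoingEnergy u₀ u₂ v = S.ingoingEnergy u₀ u₁ v + S.ingoingEnergy u₁ u₂ v :=
    (intervalIntegral.integral_add_adjacent_intervals (hi _ _) (hi _ _)).symm
  have h2 := S.ingoingEnergy_nonneg h₀ v
  linarith

theorem ingoingEnergy_mono_right {u₁ u₂ : ℝ} (u₀ : ℝ) (h : u₁ ≤ u₂) (v : ℝ) :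
    S.ingoingEnergy u₀ u₁ v ≤ S.ingoingEnergy u₀ u₂ v := by
  have hi := fun a b => (S.continuous_energyDensity_left v).intervalIntegrable
    (μ := volume) a b
  have h1 : S.ingoingEnergy u₀ u₂ v = S.ingoingEnergy u₀ u₁ v + S.ingoingEnergy u₁ u₂ v :=
    (intervalIntegral.integral_add_adjacent_intervals (hi _ _) (hi _ _)).symm
  have h2 := S.ingoingEnergy_nonneg h v
  linarith

variable {u u₁ u₂ v v₁ v₂ : ℝ}

theorem mem_Ioo_of_mem (h₁ : 1 ≤ u₁) (h₂ : u₂ ≤ S.U) (hu : u ∈ Ioo u₁ u₂) : u ∈ Ioo 1 S.U :=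
  ⟨h₁.trans_lt hu.1, hu.2.trans_le h₂⟩

theorem r_antitone (h₁ : 1 ≤ u₁) (h : u₁ ≤ u₂) (h₂ : u₂ ≤ S.U) (v : ℝ) :
    S.r u₂ v ≤ S.r u₁ v := by
  have := monotoneOn_of_hasDerivAt_nonneg (f := fun u => -S.r u v) (f' := fun u => -S.nu u v) h
    (by fun_prop) (fun x hx => (S.du_r x (S.mem_Ioo_of_mem h₁ h₂ hx) v).neg)
    (fun x _ => (S.neg_nu_pos x v).le)
  linarith

theorem r_strictAnti (h₁ : 1 ≤ u₁) (h : u₁ < u₂) (h₂ : u₂ ≤ S.U) (v : ℝ) :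
    S.r u₂ v < S.r u₁ v := by
  refine strictAntiOn_of_deriv_neg (convex_Icc u₁ u₂) (f := fun u => S.r u v) (by fun_prop) ?_
    (left_mem_Icc.2 h.le) (right_mem_Icc.2 h.le) h
  rw [interior_Icc]
  intro x hx
  rw [(S.du_r x (S.mem_Ioo_of_mem h₁ h₂ hx) v).deriv]
  exact S.nu_neg x v

theorem le_of_r_le (h₂ : 1 ≤ u₂) (hu₁ : u₁ ≤ S.U) (h : S.r u₂ v ≤ S.r u₁ v) :
    u₁ ≤ u₂ := by
  by_contra! hlt
  exact absurd (S.r_strictAnti h₂ hlt hu₁ v) (not_lt.2 h)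

theorem dv_r_of_mem (h₁ : 1 ≤ v₁) (u : ℝ) : ∀ v ∈ Ioo v₁ v₂,
    HasDerivAt (fun v => S.r u v) (S.lam u v) v := fun v hv => S.dv_r u v (h₁.trans_lt hv.1)

theorem r_mono (h₁ : 1 ≤ v₁) (h : v₁ ≤ v₂) (u : ℝ) : S.r u v₁ ≤ S.r u v₂ :=
  monotoneOn_of_hasDerivAt_nonneg (f := fun v => S.r u v) h
    (by fun_prop) (S.dv_r_of_mem h₁ u) (fun x _ => S.lam_nonneg u x)

theorem varpi_antitone (h₁ : 1 ≤ u₁) (h : u₁ ≤ u₂) (h₂ : u₂ ≤ S.U) (v : ℝ) :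
    S.varpi u₂ v ≤ S.varpi u₁ v := by
  have := monotoneOn_of_hasDerivAt_nonneg (f := fun u => -S.varpi u v) h
    (by fun_prop) (fun x hx => (S.du_varpi x (S.mem_Ioo_of_mem h₁ h₂ hx) v).neg)
    (fun x _ => by
      have h1 := S.oneSubMu_nonneg x v
      have h2 := S.nu_neg x v
      have h3 : 0 ≤ 1 / 2 * S.oneSubMu x v * (S.zeta x v / S.nu x v) ^ 2 := by positivity
      have := mul_nonneg h3 (neg_nonneg.2 h2.le)
      rw [oneSubMu] at this
      linarith)
  linarith

theorem varpi_mono (h₁ : 1 ≤ v₁) (h : v₁ ≤ v₂) (u : ℝ) : S.varpi u v₁ ≤ S.varpi u v₂ :=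
  monotoneOn_of_hasDerivAt_nonneg (f := fun v => S.varpi u v) h
    (by fun_prop) (fun x hx => S.dv_varpi u x (h₁.trans_lt hx.1))
    (fun x _ => by have := S.kappa_pos u x; positivity)

theorem kappa_le_one (h₁ : 1 ≤ u) (h : u ≤ S.U) (v : ℝ) : S.kappa u v ≤ 1 := by
  have := monotoneOn_of_hasDerivAt_nonneg (f := fun u => -S.kappa u v) h₁
    (by fun_prop) (fun x hx => (S.du_kappa x (S.mem_Ioo_of_mem le_rfl h hx) v).neg)
    (fun x _ => by
      have h1 := S.kappa_pos x v
      have h2 := S.nu_neg x v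
      have h4 := S.r_pos x v
      have h3 : 0 ≤ 1 / S.r x v * (S.zeta x v / S.nu x v) ^ 2 * S.kappa x v := by positivity
      have := mul_nonneg h3 (neg_nonneg.2 h2.le)
      linarith)
  linarith [S.kappa_one v]

theorem varpi_le (h₁ : 1 ≤ u) (h : u ≤ S.U) (v : ℝ) : S.varpi u v ≤ S.M :=
  (S.varpi_antitone le_rfl h₁ h v).trans (S.varpi_one_le v)

theorem le_varpi (h₁ : 1 ≤ u) (h : u ≤ S.U) (hv : 1 ≤ v) : S.varpi S.U 1 ≤ S.varpi u v :=
  (S.varpi_antitone h₁ h le_rfl 1).trans (S.varpi_mono le_rfl hv u)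

theorem le_r (h₁ : 1 ≤ u) (h : u ≤ S.U) (hv : 1 ≤ v) : S.r S.U 1 ≤ S.r u v :=
  (S.r_antitone h₁ h le_rfl 1).trans (S.r_mono le_rfl hv u)

/-- On an ingoing null ray, a value of `r` between those at the ends is attained. -/
theorem exists_u_r_eq {ρ : ℝ} (h : u₁ ≤ u₂) (hρ₂ : S.r u₂ v ≤ ρ)
    (hρ₁ : ρ ≤ S.r u₁ v) : ∃ u ∈ Icc u₁ u₂, S.r u v = ρ := by
  obtain ⟨u, hu, he⟩ := intermediate_value_Icc' h
    (by fun_prop : ContinuousOn (fun u => S.r u v) (Icc u₁ u₂)) ⟨hρ₂, hρ₁⟩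
  exact ⟨u, hu, he⟩

theorem exists_v_eq {f : ℝ → ℝ} (hf : Continuous f) {y : ℝ} (h : v₁ ≤ v₂) (h₁ : f v₁ ≤ y)
    (h₂ : y ≤ f v₂) : ∃ v ∈ Icc v₁ v₂, f v = y := by
  obtain ⟨v, hv, he⟩ := intermediate_value_Icc h hf.continuousOn ⟨h₁, h₂⟩
  exact ⟨v, hv, he⟩

theorem exists_bound_of_continuous {f : ℝ → ℝ → ℝ} (hf : Continuous fun p : ℝ × ℝ => f p.1 p.2)
    (a b c d : ℝ) : ∃ K > 0, ∀ u ∈ Icc a b, ∀ v ∈ Icc c d, |f u v| ≤ K := by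
  obtain ⟨K, hK⟩ := IsCompact.exists_bound_of_continuousOn
    (isCompact_Icc.prod isCompact_Icc : IsCompact (Icc a b ×ˢ Icc c d)) hf.continuousOn
  refine ⟨max K 1, by positivity, fun u hu v hv => ?_⟩
  exact (hK (u, v) ⟨hu, hv⟩).trans (le_max_left _ _)

/-- The area radius of the event horizon is larger than the charge. -/
theorem abs_e_lt_rPlus : |S.e| < S.rPlus := by
  by_contra! hle
  have hlt : S.rPlus < |S.e| := lt_of_le_of_ne hle S.rPlus_ne
  have he : 0 < |S.e| := by
    have := S.r_U_le 1
    have := S.r_pos S.U 1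
    linarith
  have hU := S.one_lt_U
  obtain ⟨V, hV, hrV⟩ := S.unbounded_r 1 ⟨le_rfl, hU⟩ |S.e|
  -- where `r ≤ |e|`, the derivative `∂_u λ` is non-negative
  have hvarpi : ∀ v ≥ V, ∀ u ∈ Icc 1 S.U, S.r u v ≤ |S.e| →
      S.varpi u v - S.e ^ 2 / S.r u v ≤ 0 := by
    intro v hv u hu hr
    -- At radius `|e|`, `1 - μ ≥ 0` reads `ϖ ≤ |e|`. Further in, `ϖ` is smaller still, while `e² / r
    -- ≥ |e|`.
    obtain ⟨w, hw, hrw⟩ := S.exists_u_r_eq (v := v) (ρ := |S.e|) hu.1 hr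
      (hrV.le.trans (S.r_mono hV hv 1))
    have h0 := S.oneSubMu_nonneg w v
    rw [oneSubMu, hrw, sq_abs, div_self (pow_ne_zero 2 (abs_pos.1 he))] at h0
    have h1 : S.varpi w v ≤ |S.e| := by
      have : 2 * S.varpi w v / |S.e| ≤ 2 := by linarith
      rw [div_le_iff₀ he] at this
      linarith
    have h2 := S.varpi_antitone hw.1 hw.2 hu.2 v
    have h3 : |S.e| ≤ S.e ^ 2 / S.r u v := by
      rw [le_div_iff₀ (S.r_pos u v), ← sq_abs]
      nlinarith
    linarith
  set η := (|S.e| - S.rPlus) / 2 with hη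
  have hηpos : 0 < η := by rw [hη]; linarith
  obtain ⟨u, hu, huη⟩ : ∃ u ∈ Ico 1 S.U, S.r u V ≤ S.r S.U V + η := by
    have hc : ContinuousAt (fun u => S.r u V) S.U :=
      (by fun_prop : Continuous fun u => S.r u V).continuousAt
    have h1 : ∀ᶠ u in 𝓝[<] S.U, S.r u V < S.r S.U V + η :=
      nhdsWithin_le_nhds (hc.eventually_lt continuousAt_const (by linarith))
    have h2 : ∀ᶠ u in 𝓝[<] S.U, u ∈ Ico 1 S.U := Ico_mem_nhdsLT hU
    obtain ⟨u, h3, h4⟩ := (h2.and h1).exists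
    exact ⟨u, h3, h4.le⟩
  obtain ⟨w, hw, hrw⟩ := S.unbounded_r u hu |S.e|
  have hVle := S.r_U_le V
  have hVw : V ≤ w := by
    by_contra! hlt'
    have := S.r_mono hw hlt'.le u
    linarith
  obtain ⟨z, hz, hrz⟩ := exists_v_eq (f := fun v => S.r u v) (by fun_prop) hVw
    (by linarith : S.r u V ≤ |S.e|) hrw.le
  -- As long as `r(u, ·) ≤ |e|`, `λ` at `U` is at least `λ` at `u`, so the gap between the two rays,
  -- initially at most `η`, cannot grow. When `r(u, ·)` reaches `|e|`, the horizon radius would be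
  -- at least `|e| - η > r₊`.
  have hd := monotoneOn_of_hasDerivAt_nonneg (f := fun v => S.r S.U v - S.r u v) hz.1
    (by fun_prop) (fun v hv => (S.dv_r_of_mem hV S.U v hv).sub (S.dv_r_of_mem hV u v hv))
    (fun v hv => by
      have := monotoneOn_of_hasDerivAt_nonneg (f := fun u => S.lam u v) hu.2.le (by fun_prop)
        (fun x hx => S.du_lam x (S.mem_Ioo_of_mem hu.1 le_rfl hx) v) (fun x hx => by
          have hx' := S.mem_Ioo_of_mem hu.1 le_rfl hx
          have h1 : S.r x v ≤ |S.e| := by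
            have h2 := S.r_antitone hu.1 hx.1.le hx.2.le v
            have h3 := S.r_mono (hV.trans hv.1.le) hv.2.le u
            linarith
          have h2 := hvarpi v hv.1.le x (Ioo_subset_Icc_self hx') h1
          have h3 : 2 * S.nu x v * S.kappa x v / S.r x v ^ 2 ≤ 0 := by
            apply div_nonpos_of_nonpos_of_nonneg _ (sq_nonneg _)
            have := mul_pos (S.neg_nu_pos x v) (S.kappa_pos x v)
            nlinarith
          exact mul_nonneg_of_nonpos_of_nonpos h3 h2)
      linarith)
  have := S.r_U_le z
  linarith

end NormalizedSolution

/-! ### The combined Morawetz and red-shift current. -/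

namespace NormalizedSolution

variable (S : NormalizedSolution)

theorem dv_oneSubMu (u : ℝ) {v : ℝ} (hv : 1 < v) : HasDerivAt (fun v => S.oneSubMu u v)
    (-(S.theta u v ^ 2 / (S.kappa u v * S.r u v)) +
      S.lam u v * (2 / S.r u v ^ 2 * (S.varpi u v - S.e ^ 2 / S.r u v))) v := by
  have hr := S.r_ne u v
  have hk := S.kappa_ne u v
  have h := (((S.dv_varpi u v hv).const_mul 2).div (S.dv_r u v hv) hr).const_sub 1 |>.add
    ((hasDerivAt_const v (S.e ^ 2)).div ((S.dv_r u v hv).pow 2) (pow_ne_zero 2 hr))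
  refine HasDerivAt.congr_deriv h ?_
  simp only [Pi.pow_apply, Nat.cast_ofNat, Nat.add_one_sub_one]
  field_simp
  ring

/-- The last term is the red-shift: where `1 - μ = 0`, the factor `2 (ϖ - e² / r) / r²` equals `(1 -
e² / r²) / r`, which is positive for `r > |e|`. -/
theorem dv_energyDensity (u : ℝ) {v : ℝ} (hv : 1 < v) :
    HasDerivAt (fun v => S.zeta u v ^ 2 / (-S.nu u v))
    (2 * S.zeta u v * S.theta u v / S.r u v - S.zeta u v ^ 2 / (-S.nu u v) * (S.kappa u v *
      (2 / S.r u v ^ 2 * (S.varpi u v - S.e ^ 2 / S.r u v)))) v := by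
  have hr := S.r_ne u v
  have hn := S.nu_ne u v
  have h := ((S.dv_zeta u v hv).pow 2).div (S.dv_nu u v hv).neg (S.neg_nu_ne u v)
  refine HasDerivAt.congr_deriv h ?_
  simp only [Pi.pow_apply, Pi.neg_apply, Nat.cast_ofNat, Nat.add_one_sub_one]
  field_simp

/-- The flux through ingoing segments in the combined Morawetz and red-shift estimate. -/
def ingoingCurrent (k u v : ℝ) : ℝ :=
  (1 + k * S.oneSubMu u v) * (S.zeta u v ^ 2 / (-S.nu u v)) / S.r u v ^ 3

/-- The flux through outgoing segments in the combined Morawetz and red-shift estimate. -/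
def outgoingCurrent (k u v : ℝ) : ℝ := k * S.theta u v ^ 2 / (S.kappa u v * S.r u v ^ 3)

/-- An explicit formula, continuous on all of `ℝ²`, whereas the equations identify it with a
`v`-derivative only for `v > 1`. -/
def ingoingCurrentDeriv (k u v : ℝ) : ℝ :=
  (k * (-(S.theta u v ^ 2 / (S.kappa u v * S.r u v)) +
      S.lam u v * (2 / S.r u v ^ 2 * (S.varpi u v - S.e ^ 2 / S.r u v))) *
      (S.zeta u v ^ 2 / (-S.nu u v)) +
    (1 + k * S.oneSubMu u v) *
      (2 * S.zeta u v * S.theta u v / S.r u v - S.zeta u v ^ 2 / (-S.nu u v) * (S.kappa u v *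
      (2 / S.r u v ^ 2 * (S.varpi u v - S.e ^ 2 / S.r u v))))) / S.r u v ^ 3 -
  3 * (1 + k * S.oneSubMu u v) * (S.zeta u v ^ 2 / (-S.nu u v)) * S.lam u v / S.r u v ^ 4

def outgoingCurrentDeriv (k u v : ℝ) : ℝ :=
  k * (-(2 * S.theta u v * (S.zeta u v * S.lam u v)) / (S.kappa u v * S.r u v ^ 4) -
    S.theta u v ^ 2 * S.zeta u v ^ 2 / (S.nu u v * S.kappa u v * S.r u v ^ 4) -
    3 * S.theta u v ^ 2 * S.nu u v / (S.kappa u v * S.r u v ^ 4))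

theorem dv_ingoingCurrent (k u : ℝ) {v : ℝ} (hv : 1 < v) :
    HasDerivAt (fun v => S.ingoingCurrent k u v) (S.ingoingCurrentDeriv k u v) v := by
  have hr := S.r_ne u v
  have hn := S.neg_nu_ne u v
  have hk := S.kappa_ne u v
  have h := ((((S.dv_oneSubMu u hv).const_mul k).const_add 1).mul
    (S.dv_energyDensity u hv)).div ((S.dv_r u v hv).pow 3) (pow_ne_zero 3 hr)
  unfold ingoingCurrent ingoingCurrentDeriv
  refine HasDerivAt.congr_deriv h ?_
  simp only [Pi.mul_apply, Pi.pow_apply, Nat.cast_ofNat, Nat.add_one_sub_one]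
  field_simp

theorem du_outgoingCurrent (k v : ℝ) {u : ℝ} (hu : u ∈ Ioo 1 S.U) :
    HasDerivAt (fun u => S.outgoingCurrent k u v) (S.outgoingCurrentDeriv k u v) u := by
  have hr := S.r_ne u v
  have hn := S.nu_ne u v
  have hk := S.kappa_ne u v
  have h := (((S.du_theta u hu v).pow 2).const_mul k).div
    ((S.du_kappa u hu v).mul ((S.du_r u hu v).pow 3)) (mul_ne_zero hk (pow_ne_zero 3 hr))
  unfold outgoingCurrent outgoingCurrentDeriv
  refine HasDerivAt.congr_deriv h ?_
  simp only [Pi.mul_apply, Pi.pow_apply, Nat.cast_ofNat, Nat.add_one_sub_one]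
  field_simp
  ring

/-- Differentiating the unit part of the ingoing current, the red-shift term and the weight `r⁻³`
together give `ζ² / (-ν)` the coefficient `2 (1 - μ) + 1 - e² / r²`, which is at least `c` both at
the horizon and away from it. The part with factor `k (1 - μ)` pairs with the outgoing current as in
the conservation law for `ϖ`, and the weight makes its bulk terms positive. Only the cross term `θ
ζ` has no sign; `k = 2 / c` is large enough to absorb it. -/
theorem currents_divergence_le {c u v : ℝ} (hc : 0 < c)
    (h : c ≤ 1 - S.e ^ 2 / S.r u v ^ 2) :
    c / 2 * (S.kappa u v / S.r u v ^ 4 * (S.zeta u v ^ 2 / (-S.nu u v))) +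
      S.ingoingCurrentDeriv (2 / c) u v ≤ S.outgoingCurrentDeriv (2 / c) u v := by
  have hr := S.r_ne u v
  have hr0 := S.r_pos u v
  have hn := S.neg_nu_ne u v
  have hn' := S.nu_ne u v
  have hn0 := S.neg_nu_pos u v
  have hk := S.kappa_ne u v
  have hk0 := S.kappa_pos u v
  have hD := S.oneSubMu_nonneg u v
  have key : S.outgoingCurrentDeriv (2 / c) u v - (c / 2 * (S.kappa u v / S.r u v ^ 4 *
      (S.zeta u v ^ 2 / (-S.nu u v))) + S.ingoingCurrentDeriv (2 / c) u v) =
      (2 / c * ((-S.nu u v * S.theta u v) ^ 2 + (S.oneSubMu u v * (S.kappa u v * S.zeta u v)) ^ 2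
        + 2 * (-S.nu u v * S.theta u v - S.oneSubMu u v * (S.kappa u v * S.zeta u v)) ^ 2
        + 2 * (S.theta u v * S.zeta u v) ^ 2)
      + (S.kappa u v * S.zeta u v) ^ 2 * (2 * S.oneSubMu u v + (1 - S.e ^ 2 / S.r u v ^ 2) - c / 2)
      - 2 * (-S.nu u v * S.theta u v) * (S.kappa u v * S.zeta u v)) /
      (-S.nu u v * S.kappa u v * S.r u v ^ 4) := by
    unfold outgoingCurrentDeriv ingoingCurrentDeriv
    rw [S.lam_eq_mul]
    unfold oneSubMu
    field_simp
    ring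
  rw [← sub_nonneg, key]
  apply div_nonneg _ (by positivity)
  set X := -S.nu u v * S.theta u v
  set Y := S.kappa u v * S.zeta u v
  set D := S.oneSubMu u v
  have h1 : 0 ≤ 2 / c * ((D * Y) ^ 2 + 2 * (X - D * Y) ^ 2 +
      2 * (S.theta u v * S.zeta u v) ^ 2) := by
    positivity
  have h2 : 0 ≤ Y ^ 2 * (2 * D + (1 - S.e ^ 2 / S.r u v ^ 2) - c) :=
    mul_nonneg (sq_nonneg _) (by linarith)
  -- This square consumes the cross term, at the cost of half of the coefficient `c` of `Y²`; the
  -- other half is the bulk term kept.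
  have h3 : 0 ≤ (2 / c) * (X - c / 2 * Y) ^ 2 := by positivity
  have h4 : (2 / c) * (X - c / 2 * Y) ^ 2 = 2 / c * X ^ 2 + c / 2 * Y ^ 2 - 2 * X * Y := by
    field_simp
    ring
  nlinarith

theorem continuous_ingoingCurrent (k : ℝ) :
    Continuous fun z : ℝ × ℝ => S.ingoingCurrent k z.1 z.2 := by
  have h := S.r_ne
  have h' := S.nu_ne
  unfold ingoingCurrent
  fun_prop (disch := simp [h, h'])

theorem continuous_outgoingCurrent (k : ℝ) :
    Continuous fun z : ℝ × ℝ => S.outgoingCurrent k z.1 z.2 := by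
  have h := S.r_ne
  have h' := S.kappa_ne
  unfold outgoingCurrent
  fun_prop (disch := simp [h, h'])

theorem continuous_ingoingCurrentDeriv (k : ℝ) :
    Continuous fun z : ℝ × ℝ => S.ingoingCurrentDeriv k z.1 z.2 := by
  have h := S.r_ne
  have h' := S.nu_ne
  have h'' := S.kappa_ne
  unfold ingoingCurrentDeriv
  fun_prop (disch := simp [h, h', h''])

theorem continuous_outgoingCurrentDeriv (k : ℝ) :
    Continuous fun z : ℝ × ℝ => S.outgoingCurrentDeriv k z.1 z.2 := by
  have h := S.r_ne
  have h' := S.nu_ne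
  have h'' := S.kappa_ne
  unfold outgoingCurrentDeriv
  fun_prop (disch := simp [h, h', h''])

theorem continuous_bulkDensity : Continuous fun z : ℝ × ℝ => S.kappa z.1 z.2 / S.r z.1 z.2 ^ 4 *
    (S.zeta z.1 z.2 ^ 2 / (-S.nu z.1 z.2)) := by
  have h := S.r_ne
  have h' := S.nu_ne
  fun_prop (disch := simp [h, h'])

/-- The flux through the outer side `u = u₁` has a favourable sign and is dropped; the one through
the inner side `u = u₂` remains to be estimated. -/
theorem integral_currents_le {c u₁ u₂ v₁ v₂ : ℝ} (hc : 0 < c)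
    (h₁ : 1 ≤ u₁) (hu : u₁ ≤ u₂) (h₂ : u₂ ≤ S.U) (hv₁ : 1 ≤ v₁) (hv : v₁ ≤ v₂)
    (h : ∀ u ∈ Icc u₁ u₂, ∀ v ∈ Icc v₁ v₂, c ≤ 1 - S.e ^ 2 / S.r u v ^ 2) :
    (∫ v in v₁..v₂, ∫ u in u₁..u₂, c / 2 * (S.kappa u v / S.r u v ^ 4 *
      (S.zeta u v ^ 2 / (-S.nu u v)))) + (∫ u in u₁..u₂, S.ingoingCurrent (2 / c) u v₂) ≤
    (∫ u in u₁..u₂, S.ingoingCurrent (2 / c) u v₁) +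
      ∫ v in v₁..v₂, S.outgoingCurrent (2 / c) u₂ v := by
  have := integral_divergence_le hu hv (S.continuous_ingoingCurrent (2 / c))
    (S.continuous_outgoingCurrent (2 / c)) (S.continuous_bulkDensity.const_mul (c / 2))
    (S.continuous_ingoingCurrentDeriv (2 / c)) (S.continuous_outgoingCurrentDeriv (2 / c))
    (fun u _ v hv' => S.dv_ingoingCurrent (2 / c) u (hv₁.trans_lt hv'.1))
    (fun v _ u hu' => S.du_outgoingCurrent (2 / c) v (S.mem_Ioo_of_mem h₁ h₂ hu'))
    (fun u hu' v hv' => S.currents_divergence_le hc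
      (h u (Ioo_subset_Icc_self hu') v (Ioo_subset_Icc_self hv')))
  have h0 : 0 ≤ ∫ v in v₁..v₂, S.outgoingCurrent (2 / c) u₁ v := by
    refine intervalIntegral.integral_nonneg hv fun v _ => ?_
    have := S.kappa_pos u₁ v
    have := S.r_pos u₁ v
    unfold outgoingCurrent
    positivity
  linarith

end NormalizedSolution

/-! ### The energy estimate, boundedness of the energy, and the lower bound for `κ`. -/

namespace NormalizedSolution

variable (S : NormalizedSolution) {u u₁ u₂ v v₁ v₂ : ℝ}

theorem continuous_left {f : ℝ → ℝ → ℝ} (hf : Continuous fun p : ℝ × ℝ => f p.1 p.2) (v : ℝ) :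
    Continuous fun u => f u v := hf.comp (by fun_prop : Continuous fun u : ℝ => (u, v))

theorem continuous_right {f : ℝ → ℝ → ℝ} (hf : Continuous fun p : ℝ × ℝ => f p.1 p.2) (u : ℝ) :
    Continuous fun v => f u v := hf.comp (by fun_prop : Continuous fun v : ℝ => (u, v))

theorem continuous_oneSubMu_mul_energyDensity (v : ℝ) :
    Continuous fun u => S.oneSubMu u v * (S.zeta u v ^ 2 / (-S.nu u v)) :=
  (continuous_left S.continuous_oneSubMu v).mul (S.continuous_energyDensity_left v)

theorem integral_oneSubMu_mul_energyDensity (h₁ : 1 ≤ u₁) (hu : u₁ ≤ u₂) (h₂ : u₂ ≤ S.U) (v : ℝ) :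
    ∫ u in u₁..u₂, S.oneSubMu u v * (S.zeta u v ^ 2 / (-S.nu u v)) =
      2 * (S.varpi u₁ v - S.varpi u₂ v) := by
  have h := intervalIntegral.integral_eq_sub_of_hasDerivAt_of_le
    (f := fun u => -2 * S.varpi u v) hu (by fun_prop)
    (fun u hu => ((S.du_varpi u (S.mem_Ioo_of_mem h₁ h₂ hu) v).const_mul (-2)).congr_deriv
      (g' := S.oneSubMu u v * (S.zeta u v ^ 2 / (-S.nu u v))) (by
        have := S.nu_ne u v
        unfold oneSubMu
        field_simp))
    ((S.continuous_oneSubMu_mul_energyDensity v).intervalIntegrable _ _)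
  rw [h]
  ring

/-- At fixed `v` the radius is least on the horizon, where it exceeds `|e|` from some time on
because `r₊ > |e|`. -/
theorem exists_one_sub_charge_le : ∃ v₀ ≥ 1, ∃ c > 0, ∀ u ∈ Icc 1 S.U, ∀ v ≥ v₀,
    c ≤ 1 - S.e ^ 2 / S.r u v ^ 2 := by
  obtain ⟨v₀, hv₀, h⟩ := S.exists_lt_r_U _ S.abs_e_lt_rPlus
  have hr := S.r_pos S.U v₀
  have h2 : S.e ^ 2 < S.r S.U v₀ ^ 2 := by
    rw [← sq_abs]
    exact pow_lt_pow_left₀ h (abs_nonneg _) two_ne_zero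
  refine ⟨v₀, hv₀, 1 - S.e ^ 2 / S.r S.U v₀ ^ 2, ?_, ?_⟩
  · rw [gt_iff_lt, sub_pos, div_lt_one (by positivity)]
    exact h2
  · intro u hu v hv
    have h3 : S.r S.U v₀ ≤ S.r u v :=
      (S.r_mono hv₀ hv S.U).trans (S.r_antitone hu.1 hu.2 le_rfl v)
    gcongr

theorem half_le_oneSubMu {R : ℝ} (hM : 4 * S.M ≤ R) (h₁ : 1 ≤ u) (h₂ : u ≤ S.U)
    (h : R ≤ S.r u v) : 1 / 2 ≤ S.oneSubMu u v := by
  have h1 := S.varpi_le h₁ h₂ v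
  have h2 := S.r_pos u v
  have h3 : 2 * S.varpi u v / S.r u v ≤ 1 / 2 := by
    rw [div_le_iff₀ h2]
    linarith
  have h4 : 0 ≤ S.e ^ 2 / S.r u v ^ 2 := by positivity
  unfold oneSubMu
  linarith

theorem exists_abs_varpi_le : ∃ K > 0, ∀ u ∈ Icc 1 S.U, ∀ v ≥ 1, |S.varpi u v| ≤ K := by
  refine ⟨|S.M| + |S.varpi S.U 1| + 1, by positivity, fun u hu v hv => ?_⟩
  have h1 := S.varpi_le hu.1 hu.2 v
  have h2 := S.le_varpi hu.1 hu.2 hv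
  rw [abs_le]
  constructor
  · linarith [neg_abs_le (S.varpi S.U 1), abs_nonneg S.M]
  · linarith [le_abs_self S.M, abs_nonneg (S.varpi S.U 1)]

theorem exists_oneSubMu_le : ∃ K > 0, ∀ u ∈ Icc 1 S.U, ∀ v ≥ 1, S.oneSubMu u v ≤ K := by
  obtain ⟨K, hK, h⟩ := S.exists_abs_varpi_le
  have hr := S.r_pos S.U 1
  refine ⟨1 + 2 * K / S.r S.U 1 + S.e ^ 2 / S.r S.U 1 ^ 2, by positivity, fun u hu v hv => ?_⟩
  have h1 := S.le_r hu.1 hu.2 hv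
  have h2 : -(2 * S.varpi u v / S.r u v) ≤ 2 * K / S.r S.U 1 := by
    rw [← neg_div]
    apply div_le_div₀ (by positivity) _ hr h1
    linarith [neg_abs_le (S.varpi u v), h u hu v hv]
  have h3 : S.e ^ 2 / S.r u v ^ 2 ≤ S.e ^ 2 / S.r S.U 1 ^ 2 := by gcongr
  unfold oneSubMu
  linarith

theorem exists_two_mul_abs_le : ∃ K > 0, ∀ u ∈ Icc 1 S.U, ∀ v ≥ 1,
    2 * |S.varpi u v - S.e ^ 2 / S.r u v| ≤ K := by
  obtain ⟨K, hK, h⟩ := S.exists_abs_varpi_le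
  have hr := S.r_pos S.U 1
  refine ⟨2 * (K + S.e ^ 2 / S.r S.U 1), by positivity, fun u hu v hv => ?_⟩
  have h1 := S.le_r hu.1 hu.2 hv
  have h2 := S.r_pos u v
  have h3 : S.e ^ 2 / S.r u v ≤ S.e ^ 2 / S.r S.U 1 := by gcongr
  have h4 : |S.e ^ 2 / S.r u v| = S.e ^ 2 / S.r u v := abs_of_nonneg (by positivity)
  have h5 := abs_sub (S.varpi u v) (S.e ^ 2 / S.r u v)
  have := h u hu v hv
  linarith

/-- The combined energy, Morawetz and red-shift estimate on late characteristic rectangles. -/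
theorem exists_energy_estimate {R : ℝ} (hR : 0 < R) (hM : 4 * S.M ≤ R) :
    ∃ v₀ ≥ 1, ∃ c > 0, ∃ K > 0, ∀ u₁ u₂ v₁ v₂, 1 ≤ u₁ → u₁ ≤ u₂ → u₂ ≤ S.U → v₀ ≤ v₁ → v₁ ≤ v₂ →
    S.ingoingEnergy u₁ u₂ v₂ + c * (∫ v in v₁..v₂, ∫ u in u₁..u₂,
      S.kappa u v / S.r u v ^ 4 * (S.zeta u v ^ 2 / (-S.nu u v))) ≤
      K * (S.ingoingEnergy u₁ u₂ v₁ + (S.varpi u₁ v₂ - S.varpi u₁ v₁)) := by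
  obtain ⟨v₀, hv₀, c, hc, hch⟩ := S.exists_one_sub_charge_le
  obtain ⟨L, hL, hD⟩ := S.exists_oneSubMu_le
  set r₀ := S.r S.U 1 with hr₀
  have hr₀p : 0 < r₀ := S.r_pos S.U 1
  set k := 2 / c with hk
  have hkp : 0 < k := by positivity
  refine ⟨v₀, hv₀, R ^ 3 * (c / 2), by positivity,
    R ^ 3 * ((1 + k * L) / r₀ ^ 3 + 2 * k / r₀ ^ 3 * (L / 2 + 1)) + 4 * (L / 2 + 1),
    by positivity, ?_⟩
  intro u₁ u₂ v₁ v₂ h₁ hu h₂ hv₁ hv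
  have hv₁' : 1 ≤ v₁ := hv₀.trans hv₁
  have hmem : ∀ u ∈ Icc u₁ u₂, u ∈ Icc 1 S.U := fun u hu => ⟨h₁.trans hu.1, hu.2.trans h₂⟩
  have hw := fun v => S.continuous_energyDensity_left v
  have hcur := S.integral_currents_le hc h₁ hu h₂ hv₁' hv
    (fun u hu v hv => hch u (hmem u hu) v (hv₁.trans hv.1))
  simp only [intervalIntegral.integral_const_mul] at hcur
  rw [← hk] at hcur
  set F := S.varpi u₁ v₂ - S.varpi u₁ v₁ with hF
  set I := ∫ v in v₁..v₂, ∫ u in u₁..u₂,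
    S.kappa u v / S.r u v ^ 4 * (S.zeta u v ^ 2 / (-S.nu u v)) with hI
  have hE₁ : 0 ≤ S.ingoingEnergy u₁ u₂ v₁ := S.ingoingEnergy_nonneg hu v₁
  have hF0 : 0 ≤ F := sub_nonneg.2 (S.varpi_mono hv₁' hv u₁)
  have hslice : S.varpi u₁ v₁ - S.varpi u₂ v₁ ≤ L / 2 * S.ingoingEnergy u₁ u₂ v₁ := by
    have h1 := S.integral_oneSubMu_mul_energyDensity h₁ hu h₂ v₁
    have h2 := integral_le_integral_of_le hu (S.continuous_oneSubMu_mul_energyDensity v₁)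
      ((hw v₁).const_mul L) (fun u hu => mul_le_mul_of_nonneg_right
        (hD u (hmem u (Ioo_subset_Icc_self hu)) v₁ hv₁') (S.energyDensity_nonneg u v₁))
    rw [h1, intervalIntegral.integral_const_mul] at h2
    unfold ingoingEnergy
    linarith
  have hin : ∫ u in u₁..u₂, S.ingoingCurrent k u v₁ ≤
      (1 + k * L) / r₀ ^ 3 * S.ingoingEnergy u₁ u₂ v₁ := by
    unfold ingoingEnergy
    rw [← intervalIntegral.integral_const_mul]
    refine integral_le_integral_of_le hu (continuous_left (S.continuous_ingoingCurrent k) v₁)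
      ((hw v₁).const_mul _) fun u hu => ?_
    have hu' := hmem u (Ioo_subset_Icc_self hu)
    have h1 := S.le_r hu'.1 hu'.2 hv₁'
    have h2 := hD u hu' v₁ hv₁'
    have h3 := S.energyDensity_nonneg u v₁
    have h4 : 0 ≤ S.oneSubMu u v₁ := S.oneSubMu_nonneg u v₁
    unfold ingoingCurrent
    rw [mul_div_right_comm]
    gcongr
  have hout : ∫ v in v₁..v₂, S.outgoingCurrent k u₂ v ≤
      2 * k / r₀ ^ 3 * (S.varpi u₂ v₂ - S.varpi u₂ v₁) := by
    have hd : ∀ v ∈ Ioo v₁ v₂, HasDerivAt (fun v => 2 * k / r₀ ^ 3 * S.varpi u₂ v)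
        (k * S.theta u₂ v ^ 2 / (S.kappa u₂ v * r₀ ^ 3)) v := fun v hv =>
      ((S.dv_varpi u₂ v (hv₁'.trans_lt hv.1)).const_mul (2 * k / r₀ ^ 3)).congr_deriv (by
        have := S.kappa_ne u₂ v
        field_simp)
    have hcont : Continuous fun v => k * S.theta u₂ v ^ 2 / (S.kappa u₂ v * r₀ ^ 3) := by
      have := S.kappa_ne u₂
      fun_prop (disch := intro x; have := S.kappa_ne u₂ x; positivity)
    have he := intervalIntegral.integral_eq_sub_of_hasDerivAt_of_le hv (by fun_prop) hd
      (hcont.intervalIntegrable _ _)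
    rw [mul_sub, ← he]
    refine integral_le_integral_of_le hv (continuous_right (S.continuous_outgoingCurrent k) u₂)
      hcont fun v hv => ?_
    have h1 := S.le_r (h₁.trans hu) h₂ (hv₁'.trans hv.1.le)
    have h2 := S.kappa_pos u₂ v
    unfold outgoingCurrent
    gcongr
  -- The current has the weight `r⁻³`, which costs `R³` where `r ≤ R`. Where `r ≥ R`, `1 - μ ≥ 1 /
  -- 2` and the degenerate energy, a difference of `ϖ`, suffices.
  have hEv : S.ingoingEnergy u₁ u₂ v₂ ≤
      R ^ 3 * (∫ u in u₁..u₂, S.ingoingCurrent k u v₂) +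
        4 * (S.varpi u₁ v₂ - S.varpi u₂ v₂) := by
    have h1 := S.integral_oneSubMu_mul_energyDensity h₁ hu h₂ v₂
    have h2 : ∫ u in u₁..u₂, (R ^ 3 * S.ingoingCurrent k u v₂ +
        2 * (S.oneSubMu u v₂ * (S.zeta u v₂ ^ 2 / (-S.nu u v₂)))) =
        R ^ 3 * (∫ u in u₁..u₂, S.ingoingCurrent k u v₂) +
          4 * (S.varpi u₁ v₂ - S.varpi u₂ v₂) := by
      rw [intervalIntegral.integral_add, intervalIntegral.integral_const_mul,
        intervalIntegral.integral_const_mul, h1]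
      · ring
      · exact ((continuous_left (S.continuous_ingoingCurrent k) v₂).const_mul _).intervalIntegrable
          _ _
      · exact ((S.continuous_oneSubMu_mul_energyDensity v₂).const_mul _).intervalIntegrable _ _
    rw [← h2]
    refine integral_le_integral_of_le hu (hw v₂) (((continuous_left
      (S.continuous_ingoingCurrent k) v₂).const_mul _).add
      ((S.continuous_oneSubMu_mul_energyDensity v₂).const_mul _)) fun u hu => ?_
    have hu' := hmem u (Ioo_subset_Icc_self hu)
    have h3 := S.energyDensity_nonneg u v₂
    have h4 := S.oneSubMu_nonneg u v₂
    have h5 := S.r_pos u v₂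
    have h6 : 0 ≤ S.oneSubMu u v₂ * (S.zeta u v₂ ^ 2 / (-S.nu u v₂)) := mul_nonneg h4 h3
    rcases le_total R (S.r u v₂) with hr | hr
    · have h7 := S.half_le_oneSubMu hM hu'.1 hu'.2 hr
      have h8 : 0 ≤ R ^ 3 * S.ingoingCurrent k u v₂ := by unfold ingoingCurrent; positivity
      nlinarith
    · have h7 : S.zeta u v₂ ^ 2 / (-S.nu u v₂) ≤ R ^ 3 * S.ingoingCurrent k u v₂ := by
        unfold ingoingCurrent
        rw [mul_div_assoc', le_div_iff₀ (by positivity), mul_comm]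
        have h9 : S.r u v₂ ^ 3 ≤ R ^ 3 := by gcongr
        have h10 : 1 ≤ 1 + k * S.oneSubMu u v₂ := by
          have : 0 ≤ k * S.oneSubMu u v₂ := by positivity
          linarith
        calc S.r u v₂ ^ 3 * (S.zeta u v₂ ^ 2 / (-S.nu u v₂))
            ≤ R ^ 3 * (1 * (S.zeta u v₂ ^ 2 / (-S.nu u v₂))) := by rw [one_mul]; gcongr
          _ ≤ _ := by gcongr
      linarith
  have hm1 := S.varpi_antitone h₁ hu h₂ v₂
  have hm2 := S.varpi_mono hv₁' hv u₂
  set X := L / 2 * S.ingoingEnergy u₁ u₂ v₁ with hX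
  have hX0 : 0 ≤ X := by positivity
  -- By the balance of `ϖ` around the rectangle, what leaves through the inner side is at most what
  -- enters through the outer side and the initial ray.
  have hout' : ∫ v in v₁..v₂, S.outgoingCurrent k u₂ v ≤ 2 * k / r₀ ^ 3 * (F + X) := by
    refine hout.trans ?_
    gcongr
    linarith
  have hA : R ^ 3 * ((c / 2 * I) + ∫ u in u₁..u₂, S.ingoingCurrent k u v₂) ≤
      R ^ 3 * ((1 + k * L) / r₀ ^ 3 * S.ingoingEnergy u₁ u₂ v₁ + 2 * k / r₀ ^ 3 * (F + X)) :=
    mul_le_mul_of_nonneg_left (by linarith) (by positivity)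
  have hFX : F + X ≤ (L / 2 + 1) * (S.ingoingEnergy u₁ u₂ v₁ + F) := by
    have : 0 ≤ L / 2 * F := by positivity
    linarith
  have hB : (1 + k * L) / r₀ ^ 3 * S.ingoingEnergy u₁ u₂ v₁ + 2 * k / r₀ ^ 3 * (F + X) ≤
      (1 + k * L) / r₀ ^ 3 * (S.ingoingEnergy u₁ u₂ v₁ + F) +
        2 * k / r₀ ^ 3 * ((L / 2 + 1) * (S.ingoingEnergy u₁ u₂ v₁ + F)) := by
    gcongr
    linarith
  have hC := mul_le_mul_of_nonneg_left hB (by positivity : 0 ≤ R ^ 3)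
  calc _ ≤ R ^ 3 * ((c / 2 * I) + ∫ u in u₁..u₂, S.ingoingCurrent k u v₂) +
        4 * ((L / 2 + 1) * (S.ingoingEnergy u₁ u₂ v₁ + F)) := by linarith
    _ ≤ _ := by linarith

/-- For rectangles starting at `u = 1` the outer flux is at most the total variation of `ϖ(1, ·)`,
which is finite. Times before `v₀` are covered by compactness. -/
theorem exists_ingoingEnergy_le : ∃ K > 0, ∀ v ≥ 1, S.ingoingEnergy 1 S.U v ≤ K := by
  obtain ⟨v₀, hv₀, c, hc, K, hK, h⟩ := S.exists_energy_estimate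
    (R := 4 * |S.M| + 1) (by positivity) (by linarith [le_abs_self S.M])
  obtain ⟨B, hB, hBb⟩ := exists_bound_of_continuous (f := fun _ v => S.ingoingEnergy 1 S.U v)
    ((S.continuous_ingoingEnergy 1 S.U).comp continuous_snd) 0 0 1 v₀
  have hB' : ∀ v ∈ Icc 1 v₀, S.ingoingEnergy 1 S.U v ≤ B := fun v hv =>
    (le_abs_self _).trans (hBb 0 ⟨le_rfl, le_rfl⟩ v hv)
  have hU := S.one_lt_U.le
  refine ⟨B + K * (B + (|S.M| + |S.varpi S.U 1|)), by positivity, fun v hv => ?_⟩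
  rcases le_total v v₀ with hvv | hvv
  · have : 0 ≤ K * (B + (|S.M| + |S.varpi S.U 1|)) := by positivity
    linarith [hB' v ⟨hv, hvv⟩]
  · have h1 := h 1 S.U v₀ v le_rfl hU le_rfl le_rfl hvv
    have h2 : 0 ≤ ∫ v in v₀..v, ∫ u in (1 : ℝ)..S.U,
        S.kappa u v / S.r u v ^ 4 * (S.zeta u v ^ 2 / (-S.nu u v)) := by
      refine intervalIntegral.integral_nonneg hvv fun v _ =>
        intervalIntegral.integral_nonneg hU fun u _ => ?_
      have h3 := S.energyDensity_nonneg u v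
      have := S.kappa_pos u v
      have := S.r_pos u v
      positivity
    have h3 : S.ingoingEnergy 1 S.U v₀ + (S.varpi 1 v - S.varpi 1 v₀) ≤
        B + (|S.M| + |S.varpi S.U 1|) := by
      have := hB' v₀ ⟨hv₀, le_rfl⟩
      have := S.varpi_one_le v
      have := S.le_varpi le_rfl hU hv₀
      linarith [le_abs_self S.M, neg_abs_le (S.varpi S.U 1)]
    have h4 := mul_le_mul_of_nonneg_left h3 hK.le
    have h5 := mul_nonneg hc.le h2
    linarith

/-- The logarithmic derivative `∂_u log κ` is `-1 / r` times the energy density, so the bounded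
energy limits the decrease of `κ` from its value `1` on `u = 1`. -/
theorem exists_le_kappa : ∃ c > 0, ∀ u ∈ Icc 1 S.U, ∀ v ≥ 1, c ≤ S.kappa u v := by
  obtain ⟨K, hK, h⟩ := S.exists_ingoingEnergy_le
  set r₀ := S.r S.U 1
  have hr₀ : 0 < r₀ := S.r_pos S.U 1
  refine ⟨Real.exp (-(K / r₀)), Real.exp_pos _, fun u hu v hv => ?_⟩
  rw [← Real.le_log_iff_exp_le (S.kappa_pos u v)]
  have h1 := sub_le_sub_of_hasDerivAt_le (f := fun u => -Real.log (S.kappa u v))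
    (g := fun u => 1 / r₀ * S.ingoingEnergy 1 u v)
    (f' := fun u => 1 / S.r u v * (S.zeta u v ^ 2 / (-S.nu u v)))
    (g' := fun u => 1 / r₀ * (S.zeta u v ^ 2 / (-S.nu u v))) hu.1
    (by
      have := fun x => S.kappa_ne x v
      fun_prop (disch := simp [this]))
    ((S.continuous_ingoingEnergy_left 1 v).const_mul _).continuousOn
    (fun x hx => ((S.du_kappa x (S.mem_Ioo_of_mem le_rfl hu.2 hx) v).log
      (S.kappa_ne x v)).neg.congr_deriv (by
        have := S.kappa_ne x v
        have := S.nu_ne x v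
        have := S.r_ne x v
        field_simp))
    (fun x hx => (S.hasDerivAt_ingoingEnergy 1 x v).const_mul _)
    (fun x hx => by
      have h2 := S.le_r hx.1.le (hx.2.le.trans hu.2) hv
      have h3 := S.energyDensity_nonneg x v
      gcongr)
  have h0 : S.ingoingEnergy 1 1 v = 0 := intervalIntegral.integral_same
  have h2 : S.ingoingEnergy 1 u v ≤ K := (S.ingoingEnergy_mono_right 1 hu.2 v).trans (h v hv)
  have h3 : 1 / r₀ * S.ingoingEnergy 1 u v ≤ K / r₀ := by
    rw [one_div, inv_mul_eq_div]; gcongr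
  simp only [S.kappa_one, Real.log_one, h0] at h1
  linarith

end NormalizedSolution

/-! ### Uniform constants for the geometry. -/

namespace NormalizedSolution

variable (S : NormalizedSolution) {u u₁ u₂ v v₁ v₂ : ℝ}

/-- Uniform bounds on the geometry and on the energy of the scalar field. Here `R` is a radius
beyond which `1 - μ` is bounded below, and `v₀` a time after which `r` is larger than the charge. -/
structure Bounds (R v₀ c K : ℝ) : Prop where
  one_le_R : 1 ≤ R
  one_le_v₀ : 1 ≤ v₀
  r_one_one_le : S.r 1 1 ≤ R
  r_U_le : ∀ v, S.r S.U v ≤ R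
  c_pos : 0 < c
  one_le_K : 1 ≤ K
  le_r : ∀ u ∈ Icc 1 S.U, ∀ v ≥ 1, c ≤ S.r u v
  le_kappa : ∀ u ∈ Icc 1 S.U, ∀ v ≥ 1, c ≤ S.kappa u v
  le_lam : ∀ u ∈ Icc 1 S.U, ∀ v ≥ 1, R ≤ S.r u v → c ≤ S.lam u v
  lam_le : ∀ u ∈ Icc 1 S.U, ∀ v ≥ 1, S.lam u v ≤ K
  two_mul_abs_le : ∀ u ∈ Icc 1 S.U, ∀ v ≥ 1, 2 * |S.varpi u v - S.e ^ 2 / S.r u v| ≤ K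
  le_r_one : ∀ v ≥ 1, c * v ≤ S.r 1 v
  r_one_le : ∀ v ≥ 1, S.r 1 v ≤ K * v
  retTime_le : ∀ u ∈ Icc 1 S.U, ∀ v₁ ≥ 1, ∀ v₂ ≥ v₁, R ≤ S.r u v₁ →
    S.retTime u v₂ ≤ K * S.retTime u v₁
  chi_one_le : ∀ v ≥ 1, |S.chi 1 v| ≤ K * v ^ (-S.ω)
  energy_le : ∀ v ≥ 1, S.ingoingEnergy 1 S.U v ≤ K
  energy_estimate : ∀ u₁ u₂ v₁ v₂, 1 ≤ u₁ → u₁ ≤ u₂ → u₂ ≤ S.U → v₀ ≤ v₁ → v₁ ≤ v₂ →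
    S.ingoingEnergy u₁ u₂ v₂ + (∫ v in v₁..v₂, ∫ u in u₁..u₂,
      1 / S.r u v ^ 4 * (S.zeta u v ^ 2 / (-S.nu u v))) ≤
      K * (S.ingoingEnergy u₁ u₂ v₁ + (S.varpi u₁ v₂ - S.varpi u₁ v₁))

theorem one_le_retTime (h₁ : 1 ≤ u) (h : u ≤ S.U) (v : ℝ) : 1 ≤ S.retTime u v := by
  unfold retTime
  linarith [S.r_antitone le_rfl h₁ h v]

/-- Far out, `∂_u r` is almost constant along outgoing null rays. -/
theorem abs_log_nu_sub_le {R K : ℝ} (hR : 1 ≤ R) (hM : 4 * S.M ≤ R) (hK0 : 0 ≤ K)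
    (hK : ∀ u ∈ Icc 1 S.U, ∀ v ≥ 1, 2 * |S.varpi u v - S.e ^ 2 / S.r u v| ≤ K)
    (hu : u ∈ Icc 1 S.U) (hv₁ : 1 ≤ v₁) (hv : v₁ ≤ v₂) (hr : R ≤ S.r u v₁) :
    |Real.log (-S.nu u v₂) - Real.log (-S.nu u v₁)| ≤ 2 * K := by
  have hneg := S.neg_nu_ne u
  -- The derivative of `log (-ν)` is at most `K κ / r²`, and `λ = κ (1 - μ) ≥ κ / 2` turns this into
  -- `2 K λ / r²`, the derivative of `-2 K / r`.
  have h := abs_sub_le_sub_of_hasDerivAt_le (f := fun v => Real.log (-S.nu u v))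
    (g := fun v => -(2 * K / S.r u v))
    (f' := fun v => S.kappa u v * (2 * (S.varpi u v - S.e ^ 2 / S.r u v)) / S.r u v ^ 2)
    (g' := fun v => 2 * K * S.lam u v / S.r u v ^ 2) hv
    (by fun_prop (disch := exact fun x _ => hneg x))
    (by have := S.r_ne u; fun_prop (disch := exact fun x _ => this x))
    (fun v hv => ((S.dv_nu u v (hv₁.trans_lt hv.1)).neg.log (S.neg_nu_ne u v)).congr_deriv (by
      have := S.nu_ne u v
      have := S.r_ne u v
      simp only [Pi.neg_apply]
      field_simp))
    (fun v hv => ((hasDerivAt_const v (2 * K)).div (S.dv_r u v (hv₁.trans_lt hv.1))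
      (S.r_ne u v)).neg.congr_deriv (by
      have := S.r_ne u v
      field_simp
      ring))
    (fun v hv => by
      have h1 := hK u hu v (hv₁.trans hv.1.le)
      have h2 := S.half_le_oneSubMu hM hu.1 hu.2 (hr.trans (S.r_mono hv₁ hv.1.le u))
      have h3 := S.kappa_pos u v
      rw [abs_div, abs_mul, abs_mul, abs_of_pos h3, abs_two, abs_of_nonneg (sq_nonneg (S.r u v)),
        S.lam_eq_mul]
      gcongr ?_ / _
      calc S.kappa u v * (2 * |S.varpi u v - S.e ^ 2 / S.r u v|) ≤ S.kappa u v * K := by gcongr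
        _ = 2 * K * (S.kappa u v * (1 / 2)) := by ring
        _ ≤ _ := by gcongr)
  have h1 : 2 * K / S.r u v₁ ≤ 2 * K := div_le_self (by positivity) (hR.trans hr)
  have h2 : 0 ≤ 2 * K / S.r u v₂ := by have := S.r_pos u v₂; positivity
  linarith

/-- Retarded time is `1` plus the integral of `-ν` from `u = 1`. All rays `u' ≤ u` also satisfy `r ≥
R` at time `v₁`, so there `-ν` grows at most by `exp (2 K)`. -/
theorem retTime_le_mul {R K : ℝ} (hR : 1 ≤ R) (hM : 4 * S.M ≤ R) (hK0 : 0 ≤ K)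
    (hK : ∀ u ∈ Icc 1 S.U, ∀ v ≥ 1, 2 * |S.varpi u v - S.e ^ 2 / S.r u v| ≤ K)
    (hu : u ∈ Icc 1 S.U) (hv₁ : 1 ≤ v₁) (hv : v₁ ≤ v₂) (hr : R ≤ S.r u v₁) :
    S.retTime u v₂ ≤ Real.exp (2 * K) * S.retTime u v₁ := by
  have hlog : ∀ x ∈ Ioo 1 u,
      |Real.log (-S.nu x v₂) - Real.log (-S.nu x v₁)| ≤ 2 * K := fun x hx =>
    S.abs_log_nu_sub_le hR hM hK0 hK ⟨hx.1.le, hx.2.le.trans hu.2⟩ hv₁ hv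
      (hr.trans (S.r_antitone hx.1.le hx.2.le hu.2 v₁))
  have h1 := sub_le_sub_of_hasDerivAt_le (f := fun x => -S.r x v₂)
    (g := fun x => -(Real.exp (2 * K) * S.r x v₁)) hu.1 (by fun_prop) (by fun_prop)
    (fun x hx => (S.du_r x (S.mem_Ioo_of_mem le_rfl hu.2 hx) v₂).neg)
    (fun x hx => ((S.du_r x (S.mem_Ioo_of_mem le_rfl hu.2 hx) v₁).const_mul _).neg)
    (fun x hx => by
      have h2 := Real.exp_le_exp.2 (sub_le_iff_le_add.1 (abs_le.1 (hlog x hx)).2)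
      rw [Real.exp_add, Real.exp_log (S.neg_nu_pos x v₂), Real.exp_log (S.neg_nu_pos x v₁)] at h2
      linarith)
  have h2 : 1 ≤ Real.exp (2 * K) := Real.one_le_exp (by positivity)
  unfold retTime
  linarith

theorem exists_bounds : ∃ R v₀ c K, S.Bounds R v₀ c K := by
  -- `R ≥ r(1, 1)` makes every outgoing ray that goes beyond `R` cross `r = R`; `R ≥ r₊` puts the
  -- horizon inside; `R ≥ 4 M` gives `1 - μ ≥ 1 / 2` outside.
  obtain ⟨R, hR1, hRr, hRp, hRM⟩ : ∃ R : ℝ, 1 ≤ R ∧ S.r 1 1 ≤ R ∧ S.rPlus ≤ R ∧ 4 * S.M ≤ R := by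
    refine ⟨1 + |S.r 1 1| + |S.rPlus| + 4 * |S.M|, ?_, ?_, ?_, ?_⟩ <;>
    linarith [abs_nonneg (S.r 1 1), abs_nonneg S.rPlus, abs_nonneg S.M, le_abs_self (S.r 1 1),
      le_abs_self S.rPlus, le_abs_self S.M]
  have hU := S.one_lt_U
  have h1U : (1 : ℝ) ∈ Icc 1 S.U := ⟨le_rfl, hU.le⟩
  obtain ⟨v₀, hv₀, b, hb, L, hL, hE⟩ := S.exists_energy_estimate (by linarith) hRM
  obtain ⟨K₁, hK₁, hKD⟩ := S.exists_oneSubMu_le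
  obtain ⟨K₂, hK₂, hKW⟩ := S.exists_two_mul_abs_le
  obtain ⟨K₃, hK₃, hKE⟩ := S.exists_ingoingEnergy_le
  obtain ⟨c₁, hc₁, hck⟩ := S.exists_le_kappa
  obtain ⟨vR, hvR, hrvR⟩ := S.unbounded_r 1 ⟨le_rfl, hU⟩ R
  set r₀ := S.r S.U 1 with hr₀
  have hr₀p : 0 < r₀ := S.r_pos S.U 1
  have hC₀ : 0 ≤ S.C₀ := by
    refine le_trans ?_ (S.decay_theta 1)
    have := S.r_pos 1 1
    positivity
  have hlam_le : ∀ u ∈ Icc 1 S.U, ∀ v ≥ 1, S.lam u v ≤ K₁ := by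
    intro u hu v hv
    rw [S.lam_eq_mul]
    calc S.kappa u v * S.oneSubMu u v ≤ 1 * K₁ :=
          mul_le_mul (S.kappa_le_one hu.1 hu.2 v) (hKD u hu v hv)
            (S.oneSubMu_nonneg u v) zero_le_one
      _ = K₁ := one_mul _
  have hle_lam : ∀ u ∈ Icc 1 S.U, ∀ v ≥ 1, R ≤ S.r u v → c₁ / 2 ≤ S.lam u v := by
    intro u hu v hv hr
    rw [S.lam_eq_mul]
    calc c₁ / 2 = c₁ * (1 / 2) := by ring
      _ ≤ _ := mul_le_mul (hck u hu v hv) (S.half_le_oneSubMu hRM hu.1 hu.2 hr) (by norm_num)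
          (S.kappa_pos u v).le
  -- A slope for `r(1, ·)`: up to `vR` use `r ≥ r₀`, afterwards `λ ≥ c₁ / 2`.
  set c₂ := min (c₁ / 2) (r₀ / vR) with hc₂
  have hvR0 : 0 < vR := by linarith
  have hc₂p : 0 < c₂ := lt_min (by positivity) (by positivity)
  have hc₂r : c₂ * vR ≤ r₀ := by
    rw [← le_div_iff₀ hvR0]
    exact min_le_right _ _
  have hle_r1 : ∀ v ≥ 1, c₂ * v ≤ S.r 1 v := by
    intro v hv
    rcases le_total v vR with h | h
    · have h1 := S.le_r le_rfl hU.le hv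
      have h2 : c₂ * v ≤ c₂ * vR := by gcongr
      linarith
    · have h1 := sub_le_sub_of_hasDerivAt_le (f := fun v => c₂ * v) (g := fun v => S.r 1 v) h
        (by fun_prop) (by fun_prop) (fun x _ => (hasDerivAt_id x).const_mul c₂)
        (S.dv_r_of_mem hvR 1) (fun x hx => by
          rw [mul_one]
          exact (min_le_left _ _).trans (hle_lam 1 h1U x (hvR.trans hx.1.le)
            (hrvR.le.trans (S.r_mono hvR hx.1.le 1))))
      have h2 : r₀ ≤ R := (S.le_r le_rfl hU.le le_rfl).trans hRr
      linarith
  have hr1_le : ∀ v ≥ 1, S.r 1 v ≤ (R + K₁) * v := by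
    intro v hv
    have h1 := sub_le_sub_of_hasDerivAt_le (g := fun v => K₁ * v) (f := fun v => S.r 1 v) hv
      (by fun_prop) (by fun_prop) (S.dv_r_of_mem le_rfl 1)
      (fun x _ => (hasDerivAt_id x).const_mul K₁) (fun x hx => by
        rw [mul_one]
        exact hlam_le 1 h1U x hx.1.le)
    have h2 : R * 1 ≤ R * v := by gcongr
    linarith
  set c := min c₂ (min c₁ r₀) with hc
  have hcp : 0 < c := lt_min hc₂p (lt_min hc₁ hr₀p)
  have hcc₂ : c ≤ c₂ := min_le_left _ _
  have hcc₁ : c ≤ c₁ := (min_le_right _ _).trans (min_le_left _ _)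
  have hcr₀ : c ≤ r₀ := (min_le_right _ _).trans (min_le_right _ _)
  have hchi : ∀ v ≥ 1, |S.chi 1 v| ≤ K₁ * S.C₀ * c₂ ^ (-S.ω) * v ^ (-S.ω) := by
    intro v hv
    have hv0 : 0 < v := by linarith
    have hl := S.lam_pos 1 v hU
    have h1 : S.chi 1 v = S.lam 1 v * (S.φ 1 v + S.theta 1 v / S.lam 1 v) := by
      unfold chi
      field_simp
    have hr := S.r_pos 1 v
    have h2 : |S.φ 1 v + S.theta 1 v / S.lam 1 v| ≤ S.C₀ * S.r 1 v ^ (-S.ω) := by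
      rw [Real.rpow_neg hr.le, ← div_eq_mul_inv, le_div_iff₀ (by positivity), mul_comm]
      exact S.decay_φ v
    have h3 : S.r 1 v ^ (-S.ω) ≤ c₂ ^ (-S.ω) * v ^ (-S.ω) := by
      rw [← Real.mul_rpow hc₂p.le hv0.le]
      exact Real.rpow_le_rpow_of_nonpos (by positivity) (hle_r1 v hv) (by linarith [S.one_lt_ω])
    rw [h1, abs_mul, abs_of_pos hl]
    calc S.lam 1 v * |S.φ 1 v + S.theta 1 v / S.lam 1 v|
        ≤ K₁ * (S.C₀ * (c₂ ^ (-S.ω) * v ^ (-S.ω))) := by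
          refine mul_le_mul (hlam_le 1 h1U v hv) (h2.trans ?_) (abs_nonneg _) hK₁.le
          gcongr
      _ = _ := by ring
  set K₄ := K₁ * S.C₀ * c₂ ^ (-S.ω) with hK₄
  have hK₄0 : 0 ≤ K₄ := by positivity
  -- `κ ≥ c₁` removes `κ` from the spacetime integral; the maximum makes `L'` serve for the final
  -- energy and for this integral alike.
  set L' := L * max 1 (c₁ * b)⁻¹ with hL'
  have hL'0 : 0 ≤ L' := by positivity
  set K := 1 + (R + K₁) + K₂ + K₃ + K₄ + Real.exp (2 * K₂) + 2 * L' with hK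
  have hexp := Real.exp_pos (2 * K₂)
  have hwt : ∀ u ∈ Icc 1 S.U, ∀ v, 0 ≤ S.retTime u v := fun u hu v => by
    linarith [S.one_le_retTime hu.1 hu.2 v]
  refine ⟨R, v₀, c, K, ⟨hR1, hv₀, hRr, fun v => (S.r_U_le v).trans hRp, hcp,
    by rw [hK]; linarith, fun u hu v hv => hcr₀.trans (S.le_r hu.1 hu.2 hv),
    fun u hu v hv => hcc₁.trans (hck u hu v hv),
    fun u hu v hv hr => (hcc₂.trans (min_le_left _ _)).trans (hle_lam u hu v hv hr),
    fun u hu v hv => (hlam_le u hu v hv).trans (by rw [hK]; linarith),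
    fun u hu v hv => (hKW u hu v hv).trans (by rw [hK]; linarith),
    fun v hv => le_trans (by gcongr) (hle_r1 v hv),
    fun v hv => (hr1_le v hv).trans (by gcongr; rw [hK]; linarith),
    fun u hu v₁ hv₁ v₂ hv hr => ?_,
    fun v hv => (hchi v hv).trans (by gcongr; rw [hK]; linarith),
    fun v hv => (hKE v hv).trans (by rw [hK]; linarith), ?_⟩⟩
  · refine (S.retTime_le_mul hR1 hRM hK₂.le hKW hu hv₁ hv hr).trans ?_
    have := hwt u hu v₁
    gcongr
    rw [hK]; linarith
  · intro u₁ u₂ v₁ v₂ h₁ hu h₂ hv₁ hv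
    have hv₁' : 1 ≤ v₁ := hv₀.trans hv₁
    have h := hE u₁ u₂ v₁ v₂ h₁ hu h₂ hv₁ hv
    set X := S.ingoingEnergy u₁ u₂ v₁ + (S.varpi u₁ v₂ - S.varpi u₁ v₁) with hX
    set I := ∫ v in v₁..v₂, ∫ u in u₁..u₂,
      S.kappa u v / S.r u v ^ 4 * (S.zeta u v ^ 2 / (-S.nu u v)) with hI
    have hX0 : 0 ≤ X := add_nonneg (S.ingoingEnergy_nonneg hu v₁)
      (sub_nonneg.2 (S.varpi_mono hv₁' hv u₁))
    have hE0 := S.ingoingEnergy_nonneg hu v₂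
    have hcont : Continuous fun z : ℝ × ℝ => 1 / S.r z.1 z.2 ^ 4 *
        (S.zeta z.1 z.2 ^ 2 / (-S.nu z.1 z.2)) := by
      have h := S.r_ne
      have h' := S.nu_ne
      fun_prop (disch := simp [h, h'])
    have ci : ∀ {f : ℝ → ℝ → ℝ}, (Continuous fun z : ℝ × ℝ => f z.1 z.2) →
        Continuous fun v => ∫ u in u₁..u₂, f u v := by
      intro f hf
      apply intervalIntegral.continuous_parametric_intervalIntegral_of_continuous'
      exact hf.comp continuous_swap
    have hJ : c₁ * (∫ v in v₁..v₂, ∫ u in u₁..u₂,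
        1 / S.r u v ^ 4 * (S.zeta u v ^ 2 / (-S.nu u v))) ≤ I := by
      rw [← intervalIntegral.integral_const_mul]
      refine integral_le_integral_of_le hv ((ci hcont).const_mul _) (ci S.continuous_bulkDensity)
        fun v hv => ?_
      rw [← intervalIntegral.integral_const_mul]
      refine integral_le_integral_of_le hu ((continuous_left (f := fun u v =>
          1 / S.r u v ^ 4 * (S.zeta u v ^ 2 / (-S.nu u v))) hcont v).const_mul _)
        (continuous_left (f := fun u v => S.kappa u v / S.r u v ^ 4 *
          (S.zeta u v ^ 2 / (-S.nu u v))) S.continuous_bulkDensity v) fun u hu => ?_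
      have h1 := hck u ⟨h₁.trans hu.1.le, hu.2.le.trans h₂⟩ v (hv₁'.trans hv.1.le)
      have h2 := S.energyDensity_nonneg u v
      have h3 := S.r_pos u v
      rw [← mul_assoc, mul_one_div]
      gcongr
    set J := ∫ v in v₁..v₂, ∫ u in u₁..u₂, 1 / S.r u v ^ 4 * (S.zeta u v ^ 2 / (-S.nu u v)) with hJd
    have hJ0 : 0 ≤ J := by
      refine intervalIntegral.integral_nonneg hv fun v _ =>
        intervalIntegral.integral_nonneg hu fun u _ => ?_
      have := S.energyDensity_nonneg u v
      have := S.r_pos u v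
      positivity
    have h4 : c₁ * b * J ≤ L * X - S.ingoingEnergy u₁ u₂ v₂ := by
      have := mul_le_mul_of_nonneg_left hJ hb.le
      linarith
    have h5 : S.ingoingEnergy u₁ u₂ v₂ + J ≤ 2 * (L' * X) := by
      have hm1 : L * X ≤ L' * X := by
        gcongr
        exact le_mul_of_one_le_right hL.le (le_max_left _ _)
      have hm2 : J ≤ L' * X := by
        have : J ≤ (c₁ * b)⁻¹ * (L * X) := by
          rw [le_inv_mul_iff₀ (by positivity)]
          linarith
        calc J ≤ (c₁ * b)⁻¹ * (L * X) := this
          _ = L * (c₁ * b)⁻¹ * X := by ring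
          _ ≤ L * max 1 (c₁ * b)⁻¹ * X := by
            gcongr
            exact le_max_right _ _
      have hm3 : S.ingoingEnergy u₁ u₂ v₂ ≤ L * X := by
        have : 0 ≤ c₁ * b * J := by positivity
        linarith
      linarith
    refine h5.trans ?_
    rw [← mul_assoc]
    gcongr
    rw [hK]
    linarith

end NormalizedSolution

/-! ### Comparison of real powers. -/

theorem rpow_neg_le_of_le_mul {x y k p : ℝ} (hy : 0 < y) (hk : 0 < k) (h : y ≤ k * x)
    (hp : 0 ≤ p) : x ^ (-p) ≤ k ^ p * y ^ (-p) := by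
  have hx : 0 < x := pos_of_mul_pos_right (hy.trans_le h) hk.le
  have h1 : (k * x) ^ (-p) ≤ y ^ (-p) := Real.rpow_le_rpow_of_nonpos hy h (by linarith)
  rw [Real.mul_rpow hk.le hx.le, Real.rpow_neg hk.le, inv_mul_le_iff₀ (by positivity)] at h1
  exact h1

theorem rpow_le_of_exponent_le {v p q : ℝ} (hv : 1 ≤ v) (h : p ≤ q) : v ^ p ≤ v ^ q :=
  Real.rpow_le_rpow_of_exponent_le hv h

theorem eventually_rpow_le_mul {p q δ : ℝ} (hpq : p < q) (hδ : 0 < δ) :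
    ∀ᶠ v : ℝ in atTop, v ^ p ≤ δ * v ^ q := by
  have h := tendsto_rpow_neg_atTop (sub_pos.2 hpq)
  filter_upwards [h.eventually_le_const hδ, eventually_gt_atTop 0] with v hv hv0
  have : v ^ p = v ^ (-(q - p)) * v ^ q := by
    rw [← Real.rpow_add hv0]
    congr 1
    ring
  rw [this]
  gcongr

/-! ### The wave equation for `r φ` and the first, non-decaying bounds. -/

namespace NormalizedSolution

variable (S : NormalizedSolution) {u u₁ u₂ v v₁ v₂ : ℝ}

/-- In `∂_u (φ λ + θ)` the terms in `ζ λ` cancel and only `φ ∂_u λ` is left. This source falls off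
by a factor `r⁻²` relative to `φ`. -/
theorem du_chi (hu : u ∈ Ioo 1 S.U) (v : ℝ) : HasDerivAt (fun u => S.chi u v)
    (S.φ u v * (2 * S.nu u v * S.kappa u v / S.r u v ^ 2 *
      (S.varpi u v - S.e ^ 2 / S.r u v))) u := by
  have := S.r_ne u v
  refine (((S.du_φ u hu v).mul (S.du_lam u hu v)).add (S.du_theta u hu v)).congr_deriv ?_
  field_simp
  ring

theorem dv_r_mul_φ (u : ℝ) (hv : 1 < v) :
    HasDerivAt (fun v => S.r u v * S.φ u v) (S.chi u v) v := by
  have := S.r_ne u v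
  refine ((S.dv_r u v hv).mul (S.dv_φ u v hv)).congr_deriv ?_
  unfold chi
  field_simp

theorem du_retTime (hu : u ∈ Ioo 1 S.U) (v : ℝ) :
    HasDerivAt (fun u => S.retTime u v) (-S.nu u v) u :=
  (S.du_r u hu v).const_sub _

theorem du_r_rpow (hu : u ∈ Ioo 1 S.U) (v p : ℝ) : HasDerivAt (fun u => S.r u v ^ (-p))
    (p * (S.r u v ^ (-p - 1) * (-S.nu u v))) u :=
  ((S.du_r u hu v).rpow_const (p := -p) (Or.inl (S.r_ne u v))).congr_deriv (by ring)

theorem dv_r_rpow (u : ℝ) (hv : 1 < v) (p : ℝ) : HasDerivAt (fun v => S.r u v ^ (-p))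
    (-p * (S.r u v ^ (-p - 1) * S.lam u v)) v :=
  ((S.dv_r u v hv).rpow_const (p := -p) (Or.inl (S.r_ne u v))).congr_deriv (by ring)

theorem continuous_r_rpow_left (v p : ℝ) : Continuous fun u => S.r u v ^ p :=
  (continuous_left S.continuous_r v).rpow_const fun u => Or.inl (S.r_ne u v)

theorem continuous_r_rpow_right (u p : ℝ) : Continuous fun v => S.r u v ^ p :=
  (continuous_right S.continuous_r u).rpow_const fun v => Or.inl (S.r_ne u v)

/-- Increments along ingoing null rays are controlled by the energy. -/
theorem abs_sub_le_of_abs_deriv_le {f f' : ℝ → ℝ} {L η : ℝ} (hL : 0 ≤ L) (hη : 0 < η)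
    (h₁ : 1 ≤ u₁) (hu : u₁ ≤ u₂) (h₂ : u₂ ≤ S.U) (hf : Continuous f)
    (hf' : ∀ u ∈ Ioo 1 S.U, HasDerivAt f (f' u) u)
    (h : ∀ u ∈ Ioo u₁ u₂, |f' u| ≤ L * (|S.zeta u v| / S.r u v)) :
    |f u₂ - f u₁| ≤ L * (η * S.ingoingEnergy u₁ u₂ v + η⁻¹ * (S.r u₂ v)⁻¹) := by
  have h3 := abs_sub_le_sub_of_hasDerivAt_le
    (g := fun u => L * (η * S.ingoingEnergy u₁ u v + η⁻¹ * (S.r u v)⁻¹))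
    (g' := fun u => L * (η * (S.zeta u v ^ 2 / (-S.nu u v)) +
      η⁻¹ * (-S.nu u v / S.r u v ^ 2))) hu hf.continuousOn
    (by
      have h4 := S.continuous_ingoingEnergy_left u₁ v
      have h5 := fun x => S.r_ne x v
      fun_prop (disch := simp [h5]))
    (fun u hu => hf' u (S.mem_Ioo_of_mem h₁ h₂ hu))
    (fun u hu => (((S.hasDerivAt_ingoingEnergy u₁ u v).const_mul η).add
      (((S.du_r u (S.mem_Ioo_of_mem h₁ h₂ hu) v).inv (S.r_ne u v)).const_mul η⁻¹)).const_mul L)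
    (fun u hu => (h u hu).trans (by
      gcongr
      have hn := S.neg_nu_pos u v
      have hr := S.r_pos u v
      -- Weighted AM–GM: the first term is the derivative of `η` times the energy, the second the
      -- derivative of `η⁻¹ / r`. The free weight `η` is chosen in each application to balance the
      -- two.
      have h6 : η * (S.zeta u v ^ 2 / (-S.nu u v)) + η⁻¹ * (-S.nu u v / S.r u v ^ 2) -
          |S.zeta u v| / S.r u v = (η * |S.zeta u v| - (-S.nu u v) / S.r u v / 2) ^ 2 /
            (η * (-S.nu u v)) + 3 / 4 * (η⁻¹ * (-S.nu u v / S.r u v ^ 2)) := by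
        rw [← sq_abs (S.zeta u v)]
        have := S.nu_ne u v
        field_simp
        ring
      have h7 : 0 ≤ (η * |S.zeta u v| - (-S.nu u v) / S.r u v / 2) ^ 2 /
            (η * (-S.nu u v)) + 3 / 4 * (η⁻¹ * (-S.nu u v / S.r u v ^ 2)) := by positivity
      linarith))
  have h4 : S.ingoingEnergy u₁ u₁ v = 0 := intervalIntegral.integral_same
  have h5 : 0 ≤ L * (η⁻¹ * (S.r u₁ v)⁻¹) := by have := S.r_pos u₁ v; positivity
  rw [h4] at h3
  linarith

/-- The assertion that `r φ` decays with exponent `a` in retarded time, up to a contribution of the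
tail with exponent `ω`, and that the energy in `r ≤ v ^ σ` decays with exponent `2 a`. -/
structure Decay (R σ a C : ℝ) : Prop where
  pos : 0 < C
  field : ∀ u ∈ Icc 1 S.U, ∀ v ≥ 1, R ≤ S.r u v → |S.r u v * S.φ u v| ≤
    C * (S.retTime u v ^ (-a) + min (S.r u v) (S.retTime u v) * S.retTime u v ^ (-S.ω))
  energy : ∀ u ∈ Icc 1 S.U, ∀ v ≥ 1, S.r u v ≤ v ^ σ →
    S.ingoingEnergy u S.U v ≤ C * v ^ (-(2 * a))

namespace Bounds

variable {S} {R v₀ c K : ℝ} (hB : S.Bounds R v₀ c K)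
include hB

theorem R_pos : 0 < R := one_pos.trans_le hB.one_le_R

theorem K_pos : 0 < K := one_pos.trans_le hB.one_le_K

theorem retTime_le_mul (hv : 1 ≤ v) : S.retTime u v ≤ 2 * K * v := by
  have h1 := hB.r_one_le v hv
  have h2 := hB.one_le_K
  have h3 := S.r_pos u v
  unfold retTime
  nlinarith

theorem mul_le_retTime_add (hv : 1 ≤ v) : c * v ≤ S.retTime u v + S.r u v := by
  have h1 := hB.le_r_one v hv
  unfold retTime
  linarith

theorem abs_du_chi_le (hu : u ∈ Icc 1 S.U) (hv : 1 ≤ v) :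
    |S.φ u v * (2 * S.nu u v * S.kappa u v / S.r u v ^ 2 *
      (S.varpi u v - S.e ^ 2 / S.r u v))| ≤
      K * |S.φ u v| * (S.r u v ^ (-2 : ℝ) * (-S.nu u v)) := by
  have h1 := hB.two_mul_abs_le u hu v hv
  have h2 := S.kappa_pos u v
  have h3 := S.kappa_le_one hu.1 hu.2 v
  have h4 := S.r_pos u v
  have h5 := S.neg_nu_pos u v
  have h6 : S.r u v ^ (-2 : ℝ) = (S.r u v ^ 2)⁻¹ := by
    rw [Real.rpow_neg h4.le, Real.rpow_two]
  rw [h6, abs_mul, abs_mul, abs_div, abs_mul, abs_mul, abs_two, abs_of_neg (S.nu_neg u v),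
    abs_of_pos h2, abs_of_pos (by positivity : 0 < S.r u v ^ 2)]
  calc |S.φ u v| * (2 * -S.nu u v * S.kappa u v / S.r u v ^ 2 *
        |S.varpi u v - S.e ^ 2 / S.r u v|)
      = |S.φ u v| * (-S.nu u v * S.kappa u v / S.r u v ^ 2 *
        (2 * |S.varpi u v - S.e ^ 2 / S.r u v|)) := by ring
    _ ≤ |S.φ u v| * (-S.nu u v * 1 / S.r u v ^ 2 * K) := by gcongr
    _ = _ := by ring

/-- Increments of `∂_v (r φ)` along ingoing null rays. -/
theorem abs_chi_sub_le {g g' : ℝ → ℝ} (h₁ : 1 ≤ u₁) (hu : u₁ ≤ u₂) (h₂ : u₂ ≤ S.U) (hv : 1 ≤ v)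
    (hg : Continuous g) (hg' : ∀ u ∈ Ioo 1 S.U, HasDerivAt g (g' u * (-S.nu u v)) u)
    (h : ∀ u ∈ Ioo u₁ u₂, |S.φ u v| * S.r u v ^ (-2 : ℝ) ≤ g' u) :
    |S.chi u₂ v - S.chi u₁ v| ≤ K * (g u₂ - g u₁) := by
  have h3 := abs_sub_le_sub_of_hasDerivAt_le (f := fun u => S.chi u v) (g := fun u => K * g u)
    hu (by fun_prop) (by fun_prop) (fun u hu => S.du_chi (S.mem_Ioo_of_mem h₁ h₂ hu) v)
    (fun u hu => (hg' u (S.mem_Ioo_of_mem h₁ h₂ hu)).const_mul K) (fun u hu => by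
      refine (hB.abs_du_chi_le ⟨h₁.trans hu.1.le, hu.2.le.trans h₂⟩ hv).trans ?_
      have h4 := h u hu
      have h5 := S.neg_nu_pos u v
      have h6 := hB.K_pos
      calc K * |S.φ u v| * (S.r u v ^ (-2 : ℝ) * -S.nu u v)
          = K * (|S.φ u v| * S.r u v ^ (-2 : ℝ) * -S.nu u v) := by ring
        _ ≤ _ := by gcongr)
  linarith

/-- The source is at most `K A r^(-5/2) (-ν)`, whose primitive in `u` is a multiple of `r^(-3/2)`,
dominated by the inner endpoint. -/
theorem abs_chi_sub_le_rpow {A : ℝ} (h₁ : 1 ≤ u₁) (hu : u₁ ≤ u₂) (h₂ : u₂ ≤ S.U)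
    (hv : 1 ≤ v) (hA : 0 ≤ A)
    (h : ∀ u ∈ Ioo u₁ u₂, |S.φ u v| ≤ A * S.r u v ^ (-(1 / 2) : ℝ)) :
    |S.chi u₂ v - S.chi u₁ v| ≤ K * A * S.r u₂ v ^ (-(3 / 2) : ℝ) := by
  have h3 := hB.abs_chi_sub_le (g := fun u => A * (2 / 3) * S.r u v ^ (-(3 / 2) : ℝ))
    (g' := fun u => A * S.r u v ^ (-(5 / 2) : ℝ)) h₁ hu h₂ hv
    ((S.continuous_r_rpow_left v _).const_mul _)
    (fun u hu => ((S.du_r_rpow hu v (3 / 2)).const_mul (A * (2 / 3))).congr_deriv (by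
      rw [show (-(3 / 2) - 1 : ℝ) = -(5 / 2) by norm_num]
      ring))
    (fun u hu => by
      have h4 := S.r_pos u v
      have h5 : S.r u v ^ (-(5 / 2) : ℝ) = S.r u v ^ (-(1 / 2) : ℝ) * S.r u v ^ (-2 : ℝ) := by
        rw [← Real.rpow_add h4]
        norm_num
      rw [h5, ← mul_assoc]
      gcongr
      exact h u hu)
  have h4 := S.r_pos u₁ v
  have h5 := S.r_pos u₂ v
  have h6 := hB.K_pos
  have h7 : 0 ≤ K * (A * (2 / 3) * S.r u₁ v ^ (-(3 / 2) : ℝ)) := by positivity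
  have h8 : 0 ≤ K * A * S.r u₂ v ^ (-(3 / 2) : ℝ) := by positivity
  linarith

/-- Increments of `r φ` along outgoing null rays, far out. -/
theorem abs_r_mul_φ_sub_le {A p : ℝ} {g g' : ℝ → ℝ} (hu : u ∈ Icc 1 S.U) (hv₁ : 1 ≤ v₁)
    (hv : v₁ ≤ v₂) (hr : R ≤ S.r u v₁) (hA : 0 ≤ A) (hp : 0 < p) (hg : ContinuousOn g (Icc v₁ v₂))
    (hg' : ∀ x ∈ Ioo v₁ v₂, HasDerivAt g (g' x) x)
    (h : ∀ x ∈ Ioo v₁ v₂, |S.chi u x| ≤ g' x + A * S.r u x ^ (-p - 1)) :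
    |S.r u v₂ * S.φ u v₂ - S.r u v₁ * S.φ u v₁| ≤
      g v₂ - g v₁ + A / (c * p) * S.r u v₁ ^ (-p) := by
  have hc := hB.c_pos
  have h3 := abs_sub_le_sub_of_hasDerivAt_le (f := fun v => S.r u v * S.φ u v)
    (g := fun x => g x - A / (c * p) * S.r u x ^ (-p)) hv (by fun_prop)
    (hg.sub ((S.continuous_r_rpow_right u _).const_mul _).continuousOn)
    (fun x hx => S.dv_r_mul_φ u (hv₁.trans_lt hx.1))
    (fun x hx => (hg' x hx).sub ((S.dv_r_rpow u (hv₁.trans_lt hx.1) p).const_mul (A / (c * p))))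
    (fun x hx => by
      refine (h x hx).trans ?_
      have h4 := hB.le_lam u hu x (hv₁.trans hx.1.le) (hr.trans (S.r_mono hv₁ hx.1.le u))
      have h5 := S.r_pos u x
      have h6 : A / (c * p) * (-p * (S.r u x ^ (-p - 1) * S.lam u x)) =
          -(A * S.r u x ^ (-p - 1) * (S.lam u x / c)) := by field_simp
      -- Since `λ ≥ c`, powers of `r` may be integrated in `r` instead of `v`.
      have h7 : A * S.r u x ^ (-p - 1) * 1 ≤ A * S.r u x ^ (-p - 1) * (S.lam u x / c) := by
        gcongr
        rwa [one_le_div hc]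
      linarith)
  have h4 := S.r_pos u v₂
  have h5 : 0 ≤ A / (c * p) * S.r u v₂ ^ (-p) := by positivity
  linarith

/-- The outgoing null ray through a point with `r ≥ R` passes through `r = R`. -/
theorem exists_r_eq (hu : u ∈ Icc 1 S.U) (hv : 1 ≤ v) (hr : R ≤ S.r u v) :
    ∃ w ∈ Icc 1 v, S.r u w = R :=
  exists_v_eq (f := fun v => S.r u v) (by fun_prop) hv
    ((S.r_antitone le_rfl hu.1 hu.2 1).trans hB.r_one_one_le) hr

theorem mul_sub_le_r_sub (hu : u ∈ Icc 1 S.U) (hv₁ : 1 ≤ v₁) (hv : v₁ ≤ v₂)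
    (hr : R ≤ S.r u v₁) : c * (v₂ - v₁) ≤ S.r u v₂ - S.r u v₁ := by
  have := sub_le_sub_of_hasDerivAt_le (f := fun v => c * v) (g := fun v => S.r u v) hv
    (by fun_prop) (by fun_prop) (fun x _ => (hasDerivAt_id x).const_mul c)
    (S.dv_r_of_mem hv₁ u) (fun x hx => by
      rw [mul_one]
      exact hB.le_lam u hu x (hv₁.trans hx.1.le) (hr.trans (S.r_mono hv₁ hx.1.le u)))
  linarith

theorem r_sub_le_mul_sub (hu : u ∈ Icc 1 S.U) (hv₁ : 1 ≤ v₁) (hv : v₁ ≤ v₂) :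
    S.r u v₂ - S.r u v₁ ≤ K * (v₂ - v₁) := by
  have := sub_le_sub_of_hasDerivAt_le (g := fun v => K * v) (f := fun v => S.r u v) hv
    (by fun_prop) (by fun_prop) (S.dv_r_of_mem hv₁ u) (fun x _ => (hasDerivAt_id x).const_mul K)
    (fun x hx => by
      rw [mul_one]
      exact hB.lam_le u hu x (hv₁.trans hx.1.le))
  linarith

/-- Cauchy–Schwarz from `u = 1` with weight `η = r^(-1/2)` balances the bounded energy against `1 /
r`. The data are better: `O(r⁻¹) + O(r^(-ω))`. -/
theorem exists_abs_φ_le : ∃ C > 0, ∀ u ∈ Icc 1 S.U, ∀ v ≥ 1,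
    |S.φ u v| ≤ C * S.r u v ^ (-(1 / 2) : ℝ) := by
  have hc := hB.c_pos
  have hK := hB.K_pos
  have hω := S.one_lt_ω
  have hC₀ : 0 ≤ S.C₀ := by
    refine le_trans ?_ (S.decay_theta 1)
    have := S.r_pos 1 1
    positivity
  refine ⟨S.C₀ * (c ^ (-(1 / 2) : ℝ) + c ^ (-(S.ω - 1 / 2))) + (K + 1), by positivity,
    fun u hu v hv => ?_⟩
  have hr := S.r_pos u v
  have hr1 := S.r_pos 1 v
  have hrr := S.r_antitone le_rfl hu.1 hu.2 v
  have hcr := hB.le_r 1 ⟨le_rfl, S.one_lt_U.le⟩ v hv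
  have hpow : ∀ p : ℝ, 0 ≤ p → S.r 1 v ^ (-(p + 1 / 2)) ≤ c ^ (-p) * S.r u v ^ (-(1 / 2) : ℝ) := by
    intro p hp
    rw [neg_add, Real.rpow_add hr1]
    apply mul_le_mul (Real.rpow_le_rpow_of_nonpos hc hcr (by linarith))
      (Real.rpow_le_rpow_of_nonpos hr hrr (by norm_num)) (by positivity) (by positivity)
  have h1 : |S.φ 1 v + S.theta 1 v / S.lam 1 v| ≤
      S.C₀ * (c ^ (-(S.ω - 1 / 2)) * S.r u v ^ (-(1 / 2) : ℝ)) := by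
    have h := S.decay_φ v
    rw [mul_comm, ← le_div_iff₀ (by positivity), div_eq_mul_inv S.C₀,
      ← Real.rpow_neg hr1.le] at h
    refine h.trans ?_
    gcongr
    have := hpow (S.ω - 1 / 2) (by linarith)
    rwa [sub_add_cancel] at this
  have h2 : |S.theta 1 v / S.lam 1 v| ≤ S.C₀ * (c ^ (-(1 / 2) : ℝ) * S.r u v ^ (-(1 / 2) : ℝ)) := by
    have h := S.decay_theta v
    rw [mul_comm, ← le_div_iff₀ (by positivity), div_eq_mul_inv S.C₀,
      ← Real.rpow_neg_one (S.r 1 v)] at h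
    refine h.trans ?_
    gcongr
    have := hpow (1 / 2) (by norm_num)
    rwa [add_halves] at this
  have h3 : |S.φ 1 v| ≤ |S.φ 1 v + S.theta 1 v / S.lam 1 v| + |S.theta 1 v / S.lam 1 v| := by
    have := abs_sub (S.φ 1 v + S.theta 1 v / S.lam 1 v) (S.theta 1 v / S.lam 1 v)
    rwa [add_sub_cancel_right] at this
  have h4 := S.abs_sub_le_of_abs_deriv_le (f := fun u => S.φ u v) (L := 1)
    (η := S.r u v ^ (-(1 / 2) : ℝ)) (v := v) zero_le_one (by positivity) le_rfl hu.1 hu.2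
    (by fun_prop) (fun u hu => S.du_φ u hu v)
    (fun u hu => by rw [abs_div, abs_of_pos (S.r_pos u v), one_mul])
  have h5 : S.ingoingEnergy 1 u v ≤ K := (S.ingoingEnergy_mono_right 1 hu.2 v).trans
    (hB.energy_le v hv)
  have h6 : (S.r u v ^ (-(1 / 2) : ℝ))⁻¹ * (S.r u v)⁻¹ = S.r u v ^ (-(1 / 2) : ℝ) := by
    rw [← Real.rpow_neg hr.le, ← Real.rpow_neg_one, ← Real.rpow_add hr]
    norm_num
  rw [h6, one_mul] at h4
  have h7 : S.r u v ^ (-(1 / 2) : ℝ) * S.ingoingEnergy 1 u v ≤ S.r u v ^ (-(1 / 2) : ℝ) * K := by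
    gcongr
  have h8 : |S.φ u v| ≤ |S.φ u v - S.φ 1 v| + |S.φ 1 v| := by
    have := abs_add_le (S.φ u v - S.φ 1 v) (S.φ 1 v)
    rwa [sub_add_cancel] at this
  linarith

/-- The start of the bootstrap: `φ = O(r^(-1/2))` gives `∂_v (r φ) = O(v^(-ω) + r^(-3/2))`,
integrable outward from `r = R`, so `r φ` is bounded there. The energy clause is boundedness of the
energy. -/
theorem exists_decay_zero (σ : ℝ) : ∃ C, S.Decay R σ 0 C := by
  have hc := hB.c_pos
  have hK := hB.K_pos
  have hR := hB.R_pos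
  have hω := S.one_lt_ω
  obtain ⟨A, hA, hφ⟩ := hB.exists_abs_φ_le
  have hχ : ∀ u ∈ Icc 1 S.U, ∀ v ≥ 1, |S.chi u v| ≤
      K * v ^ (-S.ω) + K * A * S.r u v ^ (-(1 / 2) - 1 : ℝ) := by
    intro u hu v hv
    have h1 := hB.abs_chi_sub_le_rpow le_rfl hu.1 hu.2 hv hA.le
      (fun x hx => hφ x ⟨hx.1.le, hx.2.le.trans hu.2⟩ v hv)
    have h2 := hB.chi_one_le v hv
    have h3 : |S.chi u v| ≤ |S.chi u v - S.chi 1 v| + |S.chi 1 v| := by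
      have := abs_add_le (S.chi u v - S.chi 1 v) (S.chi 1 v)
      rwa [sub_add_cancel] at this
    rw [show (-(1 / 2) - 1 : ℝ) = -(3 / 2) by norm_num]
    linarith
  set C := R * (A * R ^ (-(1 / 2) : ℝ)) + K / (S.ω - 1) + K * A / (c * (1 / 2)) *
    R ^ (-(1 / 2) : ℝ) with hC
  have hω1 : 0 < S.ω - 1 := by linarith
  have hC0 : 0 ≤ C := by positivity
  refine ⟨C + K, by positivity, fun u hu v hv hr => ?_, fun u hu v hv _ => ?_⟩
  · obtain ⟨w, hw, hrw⟩ := hB.exists_r_eq hu hv hr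
    have h1 := hB.abs_r_mul_φ_sub_le (g := fun x => -(K / (S.ω - 1)) * x ^ (-(S.ω - 1)))
      (g' := fun x => K * x ^ (-S.ω)) (A := K * A) (p := 1 / 2) hu hw.1 hw.2 hrw.ge (by positivity)
      (by norm_num) (by
        refine continuousOn_const.mul (continuousOn_id.rpow_const fun x hx => Or.inl ?_)
        have : 1 ≤ x := hw.1.trans hx.1
        simp only [id]
        linarith)
      (fun x hx => by
        have hx0 : x ≠ 0 := by linarith [hw.1, hx.1]
        refine ((Real.hasDerivAt_rpow_const (p := -(S.ω - 1)) (Or.inl hx0)).const_mul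
          (-(K / (S.ω - 1)))).congr_deriv ?_
        rw [show -(S.ω - 1) - 1 = -S.ω by ring]
        field_simp)
      (fun x hx => hχ u hu x (hw.1.trans hx.1.le))
    have h2 := hφ u hu w hw.1
    rw [hrw] at h1 h2
    have h3 : |R * S.φ u w| ≤ R * (A * R ^ (-(1 / 2) : ℝ)) := by
      rw [abs_mul, abs_of_pos hR]
      gcongr
    have h4 : |S.r u v * S.φ u v| ≤ |S.r u v * S.φ u v - R * S.φ u w| + |R * S.φ u w| := by
      have := abs_add_le (S.r u v * S.φ u v - R * S.φ u w) (R * S.φ u w)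
      rwa [sub_add_cancel] at this
    have h5 : K / (S.ω - 1) * w ^ (-(S.ω - 1)) ≤ K / (S.ω - 1) := by
      apply mul_le_of_le_one_right (by positivity)
      exact Real.rpow_le_one_of_one_le_of_nonpos hw.1 (by linarith)
    have h6 : 0 ≤ K / (S.ω - 1) * v ^ (-(S.ω - 1)) := by positivity
    have h7 := S.one_le_retTime hu.1 hu.2 v
    have h8 : 0 ≤ min (S.r u v) (S.retTime u v) * S.retTime u v ^ (-S.ω) := by
      have := S.r_pos u v
      positivity
    rw [neg_zero, Real.rpow_zero]
    have h9 : C ≤ (C + K) * (1 + min (S.r u v) (S.retTime u v) * S.retTime u v ^ (-S.ω)) := by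
      nlinarith [mul_nonneg (add_nonneg hC0 hK.le) h8]
    refine le_trans ?_ h9
    simp only [neg_mul] at h1
    linarith
  · rw [mul_zero, neg_zero, Real.rpow_zero, mul_one]
    have := (S.ingoingEnergy_mono hu.1 S.U v).trans (hB.energy_le v hv)
    linarith

end Bounds

end NormalizedSolution

/-- For use with `ρ = r` and `t` the retarded time, whose sum `X` is constant on an ingoing ray.
Every term on the right is constant in `X` times a single power of `ρ` or `t`, hence has an explicit
primitive; the powers of `t` are integrable at infinity. The larger of `ρ` and `t` is comparable to
`X`. -/
theorem rpow_mul_add_le {ρ t a ω : ℝ} (hρ : 0 < ρ) (ht : 1 ≤ t) (ha : 0 ≤ a) (hω : 1 < ω)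
    (hω3 : ω ≤ 3) : ρ ^ (-3 : ℝ) * (t ^ (-a) + min ρ t * t ^ (-ω)) ≤
      (2 ^ a + 2 ^ ω + 8) * ((ρ + t) ^ (-a) * ρ ^ (-3 : ℝ) + (ρ + t) ^ (-ω) * ρ ^ (-2 : ℝ) +
        (((ρ + t) ^ (-(3 / 2 + a)) + (ρ + t) ^ (-3 : ℝ)) * t ^ (-(3 / 2) : ℝ) +
          (ρ + t) ^ (-ω) * t ^ (-2 : ℝ))) := by
  have ht0 : 0 < t := by linarith
  set X := ρ + t with hX
  have hX0 : 0 < X := by positivity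
  have h2a : (0 : ℝ) < 2 ^ a := by positivity
  have h2w : (0 : ℝ) < 2 ^ ω := by positivity
  set P := X ^ (-a) * ρ ^ (-3 : ℝ) + X ^ (-ω) * ρ ^ (-2 : ℝ) with hP
  set Q := (X ^ (-(3 / 2 + a)) + X ^ (-3 : ℝ)) * t ^ (-(3 / 2) : ℝ) +
    X ^ (-ω) * t ^ (-2 : ℝ) with hQ
  have hP0 : 0 ≤ P := by positivity
  have hQ0 : 0 ≤ Q := by positivity
  rcases le_total ρ t with h | h
  · have h1 : t ^ (-a) ≤ 2 ^ a * X ^ (-a) :=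
      rpow_neg_le_of_le_mul hX0 two_pos (by linarith) ha
    have h2 : t ^ (-ω) ≤ 2 ^ ω * X ^ (-ω) :=
      rpow_neg_le_of_le_mul hX0 two_pos (by linarith) (by linarith)
    have h3 : ρ ^ (-3 : ℝ) * ρ = ρ ^ (-2 : ℝ) := by
      nth_rewrite 2 [← Real.rpow_one ρ]
      rw [← Real.rpow_add hρ]
      norm_num
    rw [min_eq_left h]
    calc ρ ^ (-3 : ℝ) * (t ^ (-a) + ρ * t ^ (-ω))
        ≤ ρ ^ (-3 : ℝ) * (2 ^ a * X ^ (-a) + ρ * (2 ^ ω * X ^ (-ω))) := by gcongr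
      _ = 2 ^ a * (X ^ (-a) * ρ ^ (-3 : ℝ)) + 2 ^ ω * (X ^ (-ω) * (ρ ^ (-3 : ℝ) * ρ)) := by ring
      _ = 2 ^ a * (X ^ (-a) * ρ ^ (-3 : ℝ)) + 2 ^ ω * (X ^ (-ω) * ρ ^ (-2 : ℝ)) := by rw [h3]
      _ ≤ (2 ^ a + 2 ^ ω + 8) * (X ^ (-a) * ρ ^ (-3 : ℝ)) +
          (2 ^ a + 2 ^ ω + 8) * (X ^ (-ω) * ρ ^ (-2 : ℝ)) := by gcongr <;> linarith
      _ = (2 ^ a + 2 ^ ω + 8) * P := by rw [hP]; ring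
      _ ≤ _ := by gcongr; linarith
  · have h1 : ρ ^ (-3 : ℝ) ≤ 8 * X ^ (-3 : ℝ) := by
      refine (rpow_neg_le_of_le_mul hX0 two_pos (by linarith) (by norm_num)).trans_eq ?_
      norm_num
    have htX : t ≤ X := by linarith
    have hX1 : 1 ≤ X := by linarith
    have h2 : X ^ (-3 : ℝ) * t ^ (-a) ≤
        (X ^ (-(3 / 2 + a)) + X ^ (-3 : ℝ)) * t ^ (-(3 / 2) : ℝ) := by
      -- For `a ≤ 3 / 2` the power `t^(-a)` may fail to be integrable; `t ≤ X` trades the missing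
      -- exponent `3 / 2 - a` for powers of `X`.
      rcases le_total a (3 / 2) with h3 | h3
      · have h4 : t ^ (-a) ≤ X ^ (3 / 2 - a) * t ^ (-(3 / 2) : ℝ) := by
          rw [show -a = (3 / 2 - a) + -(3 / 2) by ring, Real.rpow_add ht0]
          gcongr
        have h5 : X ^ (-3 : ℝ) * X ^ (3 / 2 - a) = X ^ (-(3 / 2 + a)) := by
          rw [← Real.rpow_add hX0]
          congr 1
          ring
        calc X ^ (-3 : ℝ) * t ^ (-a) ≤ X ^ (-3 : ℝ) * (X ^ (3 / 2 - a) * t ^ (-(3 / 2) : ℝ)) := by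
              gcongr
          _ = X ^ (-(3 / 2 + a)) * t ^ (-(3 / 2) : ℝ) := by rw [← mul_assoc, h5]
          _ ≤ _ := by
            gcongr
            have : 0 < X ^ (-3 : ℝ) := by positivity
            linarith
      · have h4 : t ^ (-a) ≤ t ^ (-(3 / 2) : ℝ) := rpow_le_of_exponent_le ht (by linarith)
        gcongr
        have : 0 < X ^ (-(3 / 2 + a)) := by positivity
        linarith
    -- The place where `ω ≤ 3` matters: `t^(3 - ω) ≤ X^(3 - ω)`.
    have h3 : X ^ (-3 : ℝ) * (t * t ^ (-ω)) ≤ X ^ (-ω) * t ^ (-2 : ℝ) := by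
      have h4 : t * t ^ (-ω) ≤ X ^ (3 - ω) * t ^ (-2 : ℝ) := by
        have : t * t ^ (-ω) = t ^ (3 - ω) * t ^ (-2 : ℝ) := by
          nth_rewrite 1 [← Real.rpow_one t]
          rw [← Real.rpow_add ht0, ← Real.rpow_add ht0]
          congr 1
          ring
        rw [this]
        gcongr
      have h5 : X ^ (-3 : ℝ) * X ^ (3 - ω) = X ^ (-ω) := by
        rw [← Real.rpow_add hX0]
        congr 1
        ring
      calc X ^ (-3 : ℝ) * (t * t ^ (-ω)) ≤ X ^ (-3 : ℝ) * (X ^ (3 - ω) * t ^ (-2 : ℝ)) := by gcongr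
        _ = _ := by rw [← mul_assoc, h5]
    rw [min_eq_right h]
    calc ρ ^ (-3 : ℝ) * (t ^ (-a) + t * t ^ (-ω))
        ≤ 8 * X ^ (-3 : ℝ) * (t ^ (-a) + t * t ^ (-ω)) := by gcongr
      _ = 8 * (X ^ (-3 : ℝ) * t ^ (-a) + X ^ (-3 : ℝ) * (t * t ^ (-ω))) := by ring
      _ ≤ 8 * Q := by rw [hQ]; gcongr
      _ ≤ (2 ^ a + 2 ^ ω + 8) * (P + Q) := by
        have : 0 ≤ (2 ^ a + 2 ^ ω) * (P + Q) := by positivity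
        linarith

/-! ### From decay of `r φ` to decay of `∂_v (r φ)`, of `θ` and of outgoing fluxes. -/

namespace NormalizedSolution

variable {S : NormalizedSolution} {u u₁ u₂ v v₁ v₂ : ℝ}

theorem du_retTime_rpow (hu : u ∈ Ioo 1 S.U) (v p : ℝ) :
    HasDerivAt (fun u => S.retTime u v ^ (-p))
      (-p * (S.retTime u v ^ (-p - 1) * (-S.nu u v))) u :=
  ((S.du_retTime hu v).rpow_const (p := -p) (Or.inl (by
    linarith [S.one_le_retTime hu.1.le hu.2.le v]))).congr_deriv (by ring)

namespace Bounds

variable {R v₀ c K σ a C : ℝ} (hB : S.Bounds R v₀ c K)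
include hB

/-- Decay of `r φ` implies decay of `∂_v (r φ)` far out. -/
theorem exists_abs_chi_le (hd : S.Decay R σ a C) (ha : 0 ≤ a) :
    ∃ A > 0, ∀ u ∈ Icc 1 S.U, ∀ v ≥ 1, R ≤ S.r u v →
      |S.chi u v| ≤ A * (v ^ (-S.ω) + v ^ (-a) * S.r u v ^ (-(3 / 2) : ℝ)) := by
  have hc := hB.c_pos
  have hK := hB.K_pos
  have hC := hd.pos
  have hω := S.one_lt_ω
  set B := C * (2 ^ a + 2 ^ S.ω + 8) with hBdef
  have hB0 : 0 < B := by positivity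
  refine ⟨K + K * B * (6 * (c⁻¹ ^ S.ω + c⁻¹ ^ a)), by positivity, fun u hu v hv hr => ?_⟩
  have hv0 : 0 < v := by linarith
  set X := 1 + S.r 1 v with hX
  have hr1 := S.r_pos 1 v
  have hX1 : 1 ≤ X := by linarith
  have hX0 : 0 < X := by linarith
  have hsum : ∀ x, S.r x v + S.retTime x v = X := fun x => by unfold retTime; ring
  set Y := X ^ (-(3 / 2 + a)) + X ^ (-3 : ℝ) with hY
  have hmem : ∀ x ∈ Ioo 1 u, x ∈ Icc 1 S.U := fun x hx => ⟨hx.1.le, hx.2.le.trans hu.2⟩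
  have ht : ∀ x ∈ Icc 1 S.U, 0 < S.retTime x v := fun x hx => by
    linarith [S.one_le_retTime hx.1 hx.2 v]
  -- a primitive of the bound for the derivative; it is continuous after truncation of `retTime`
  have h1 := abs_sub_le_sub_of_hasDerivAt_le (f := fun x => S.chi x v)
    (g := fun x => K * (B * (X ^ (-a) * (1 / 2 * S.r x v ^ (-2 : ℝ)) +
      X ^ (-S.ω) * S.r x v ^ (-1 : ℝ) + (Y * (-2 * S.retTime x v ^ (-(1 / 2) : ℝ)) -
      X ^ (-S.ω) * S.retTime x v ^ (-1 : ℝ)))))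
    (g' := fun x => K * (B * (X ^ (-a) * S.r x v ^ (-3 : ℝ) + X ^ (-S.ω) * S.r x v ^ (-2 : ℝ) +
      (Y * S.retTime x v ^ (-(3 / 2) : ℝ) + X ^ (-S.ω) * S.retTime x v ^ (-2 : ℝ))) *
      (-S.nu x v)))
    hu.1 (by fun_prop)
    (by
      have h2 := fun p => S.continuous_r_rpow_left v p
      have h3 : ∀ p : ℝ, ContinuousOn (fun x => S.retTime x v ^ p) (Icc 1 u) := fun p =>
        (continuous_left S.continuous_retTime v).continuousOn.rpow_const fun x hx =>
          Or.inl (ht x ⟨hx.1, hx.2.trans hu.2⟩).ne'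
      exact continuousOn_const.mul (continuousOn_const.mul (((continuousOn_const.mul
        (continuousOn_const.mul (h2 _).continuousOn)).add
        (continuousOn_const.mul (h2 _).continuousOn)).add
        ((continuousOn_const.mul (continuousOn_const.mul (h3 _))).sub
          (continuousOn_const.mul (h3 _))))))
    (fun x hx => S.du_chi (S.mem_Ioo_of_mem le_rfl hu.2 hx) v)
    (fun x hx => by
      have hx' := S.mem_Ioo_of_mem le_rfl hu.2 hx
      refine ((((((S.du_r_rpow hx' v 2).const_mul (1 / 2)).const_mul (X ^ (-a))).add
        ((S.du_r_rpow hx' v 1).const_mul (X ^ (-S.ω)))).add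
        (((((du_retTime_rpow hx' v (1 / 2)).const_mul (-2)).const_mul Y)).sub
        ((du_retTime_rpow hx' v 1).const_mul (X ^ (-S.ω))))).const_mul B).const_mul K
        |>.congr_deriv ?_
      rw [show (-2 - 1 : ℝ) = -3 by norm_num, show (-1 - 1 : ℝ) = -2 by norm_num,
        show (-(1 / 2) - 1 : ℝ) = -(3 / 2) by norm_num]
      ring)
    (fun x hx => by
      have hx' := hmem x hx
      have hrx := S.r_pos x v
      have hn := S.neg_nu_pos x v
      refine (hB.abs_du_chi_le hx' hv).trans ?_
      have h2 : |S.φ x v| * S.r x v ^ (-2 : ℝ) =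
          S.r x v ^ (-3 : ℝ) * |S.r x v * S.φ x v| := by
        rw [abs_mul, abs_of_pos hrx, show (-2 : ℝ) = -3 + 1 by norm_num, Real.rpow_add hrx,
          Real.rpow_one]
        ring
      have h3 := hd.field x hx' v hv (hr.trans (S.r_antitone hx.1.le hx.2.le hu.2 v))
      have h4 := rpow_mul_add_le hrx (S.one_le_retTime hx'.1 hx'.2 v) ha hω S.ω_le_three
      rw [hsum x] at h4
      have h5 : |S.φ x v| * S.r x v ^ (-2 : ℝ) ≤ B * (X ^ (-a) * S.r x v ^ (-3 : ℝ) +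
          X ^ (-S.ω) * S.r x v ^ (-2 : ℝ) + (Y * S.retTime x v ^ (-(3 / 2) : ℝ) +
          X ^ (-S.ω) * S.retTime x v ^ (-2 : ℝ))) := by
        rw [h2]
        calc _ ≤ S.r x v ^ (-3 : ℝ) * (C * (S.retTime x v ^ (-a) +
              min (S.r x v) (S.retTime x v) * S.retTime x v ^ (-S.ω))) := by gcongr
          _ = C * (S.r x v ^ (-3 : ℝ) * (S.retTime x v ^ (-a) +
              min (S.r x v) (S.retTime x v) * S.retTime x v ^ (-S.ω))) := by ring
          _ ≤ _ := mul_le_mul_of_nonneg_left h4 hC.le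
          _ = _ := by rw [hBdef]; ring
      calc K * |S.φ x v| * (S.r x v ^ (-2 : ℝ) * -S.nu x v)
          = K * ((|S.φ x v| * S.r x v ^ (-2 : ℝ)) * -S.nu x v) := by ring
        _ ≤ _ := by gcongr)
  -- estimate of the increment of the primitive
  set ρ := S.r u v with hρ
  have hρ1 : 1 ≤ ρ := hB.one_le_R.trans hr
  have hρ0 : 0 < ρ := by linarith
  have hρX : ρ ≤ X := by
    have := hsum u
    have := ht u hu
    linarith
  have htime : S.retTime 1 v = 1 := by unfold retTime; ring
  have hcX : v ≤ c⁻¹ * X := by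
    rw [le_inv_mul_iff₀ hc]
    linarith [hB.le_r_one v hv]
  have ha' : X ^ (-a) ≤ c⁻¹ ^ a * v ^ (-a) := rpow_neg_le_of_le_mul hv0 (by positivity) hcX ha
  have hω' : X ^ (-S.ω) ≤ c⁻¹ ^ S.ω * v ^ (-S.ω) :=
    rpow_neg_le_of_le_mul hv0 (by positivity) hcX (by linarith)
  have hρ2 : ρ ^ (-2 : ℝ) ≤ ρ ^ (-(3 / 2) : ℝ) := rpow_le_of_exponent_le hρ1 (by norm_num)
  have hρ3 : ρ ^ (-1 : ℝ) ≤ 1 := Real.rpow_le_one_of_one_le_of_nonpos hρ1 (by norm_num)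
  -- `ρ ≤ X` exchanges `X^(-3/2)` for `ρ^(-3/2)`, and `ω ≤ 3` gives `X⁻³ ≤ X^(-ω)`.
  have hY' : Y ≤ X ^ (-a) * ρ ^ (-(3 / 2) : ℝ) + X ^ (-S.ω) := by
    have h2 : X ^ (-(3 / 2 + a)) ≤ X ^ (-a) * ρ ^ (-(3 / 2) : ℝ) := by
      rw [show -(3 / 2 + a) = -a + -(3 / 2) by ring, Real.rpow_add hX0]
      have := Real.rpow_le_rpow_of_nonpos hρ0 hρX (by norm_num : (-(3 / 2) : ℝ) ≤ 0)
      gcongr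
    have h3 : X ^ (-3 : ℝ) ≤ X ^ (-S.ω) :=
      rpow_le_of_exponent_le hX1 (by linarith [S.ω_le_three])
    linarith
  set Za := X ^ (-a) * ρ ^ (-(3 / 2) : ℝ) with hZa
  have hZa0 : 0 ≤ Za := by positivity
  have hXw : 0 < X ^ (-S.ω) := by positivity
  have hY0 : 0 ≤ Y := by positivity
  -- Since `t = 1` at `u = 1`, the primitives in `t` contribute at most `2 Y + X^(-ω)`; those in `r`
  -- are bounded by their values at the inner end.
  have h2 : |S.chi u v - S.chi 1 v| ≤ K * B * (6 * (X ^ (-S.ω) + Za)) := by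
    refine h1.trans ?_
    rw [← mul_sub, ← mul_sub, ← mul_assoc]
    gcongr
    rw [htime, Real.one_rpow, Real.one_rpow]
    have e1 : X ^ (-a) * (1 / 2 * ρ ^ (-2 : ℝ)) ≤ Za := by
      rw [hZa]
      have : 0 < ρ ^ (-2 : ℝ) := by positivity
      gcongr
      linarith
    have e2 : X ^ (-S.ω) * ρ ^ (-1 : ℝ) ≤ X ^ (-S.ω) := mul_le_of_le_one_right hXw.le hρ3
    have htu := ht u hu
    have e3 : 0 ≤ Y * (2 * S.retTime u v ^ (-(1 / 2) : ℝ)) := by positivity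
    have e4 : 0 ≤ X ^ (-S.ω) * S.retTime u v ^ (-1 : ℝ) := by positivity
    have e5 : 0 ≤ X ^ (-a) * (1 / 2 * S.r 1 v ^ (-2 : ℝ)) := by positivity
    have e6 : 0 ≤ X ^ (-S.ω) * S.r 1 v ^ (-1 : ℝ) := by positivity
    linarith
  have h3 := hB.chi_one_le v hv
  have h4 : |S.chi u v| ≤ |S.chi u v - S.chi 1 v| + |S.chi 1 v| := by
    have := abs_add_le (S.chi u v - S.chi 1 v) (S.chi 1 v)
    rwa [sub_add_cancel] at this
  have h5 : X ^ (-S.ω) + Za ≤ (c⁻¹ ^ S.ω + c⁻¹ ^ a) *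
      (v ^ (-S.ω) + v ^ (-a) * ρ ^ (-(3 / 2) : ℝ)) := by
    have e1 : Za ≤ c⁻¹ ^ a * v ^ (-a) * ρ ^ (-(3 / 2) : ℝ) := by rw [hZa]; gcongr
    have e2 : 0 ≤ c⁻¹ ^ S.ω * (v ^ (-a) * ρ ^ (-(3 / 2) : ℝ)) := by positivity
    have e3 : 0 ≤ c⁻¹ ^ a * v ^ (-S.ω) := by positivity
    linarith
  have h6 : K * B * (6 * (X ^ (-S.ω) + Za)) ≤ K * B * (6 * ((c⁻¹ ^ S.ω + c⁻¹ ^ a) *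
      (v ^ (-S.ω) + v ^ (-a) * ρ ^ (-(3 / 2) : ℝ)))) := by gcongr
  have h7 : 0 ≤ K * (v ^ (-a) * ρ ^ (-(3 / 2) : ℝ)) := by positivity
  linarith

/-- Pointwise decay in the intermediate region `R ≤ r ≤ c v / 2`. -/
theorem exists_abs_le_of_r_le (hd : S.Decay R σ a C) (ha : 0 ≤ a) :
    ∃ A > 0, ∀ u ∈ Icc 1 S.U, ∀ v ≥ 1, R ≤ S.r u v → S.r u v ≤ c / 2 * v →
      |S.φ u v| ≤ A * (v ^ (-a) * (S.r u v)⁻¹ + v ^ (-S.ω)) ∧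
      |S.chi u v| ≤ A * (v ^ (-a) * (S.r u v)⁻¹ + v ^ (-S.ω)) ∧
      |S.theta u v| ≤ A * (v ^ (-a) * (S.r u v)⁻¹ + v ^ (-S.ω)) := by
  have hc := hB.c_pos
  have hK := hB.K_pos
  have hC := hd.pos
  have hω := S.one_lt_ω
  obtain ⟨A, hA, hχ⟩ := hB.exists_abs_chi_le hd ha
  set k := 2 / c with hk
  set B := C * (k ^ a + k ^ S.ω) with hBd
  have hB0 : 0 < B := by positivity
  refine ⟨A + B + K * B, by positivity, fun u hu v hv hr hrv => ?_⟩
  have hv0 : 0 < v := by linarith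
  have hr0 := S.r_pos u v
  have hr1 : 1 ≤ S.r u v := hB.one_le_R.trans hr
  -- `r + t ≥ c v` and `r ≤ c v / 2` leave `t ≥ c v / 2`, so powers of `t` become powers of `v`.
  have ht : v ≤ k * S.retTime u v := by
    have := hB.mul_le_retTime_add (u := u) hv
    rw [hk, div_mul_eq_mul_div, le_div_iff₀ hc]
    linarith
  have ha' := rpow_neg_le_of_le_mul hv0 (by positivity) ht ha
  have hω' := rpow_neg_le_of_le_mul hv0 (by positivity) ht (by linarith : 0 ≤ S.ω)
  have ht0 : 0 < S.retTime u v := by linarith [S.one_le_retTime hu.1 hu.2 v]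
  set Z := v ^ (-a) * (S.r u v)⁻¹ + v ^ (-S.ω) with hZ
  have hZ0 : 0 < Z := by positivity
  have hφ : |S.φ u v| ≤ B * Z := by
    have h1 := hd.field u hu v hv hr
    rw [abs_mul, abs_of_pos hr0, ← le_div_iff₀' hr0] at h1
    refine h1.trans ?_
    rw [div_le_iff₀ hr0]
    calc _ ≤ C * (k ^ a * v ^ (-a) + S.r u v * (k ^ S.ω * v ^ (-S.ω))) := by
          gcongr
          exact min_le_left _ _
      _ ≤ C * ((k ^ a + k ^ S.ω) * (v ^ (-a) + S.r u v * v ^ (-S.ω))) := by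
          gcongr
          have e1 : 0 ≤ k ^ S.ω * v ^ (-a) := by positivity
          have e2 : 0 ≤ k ^ a * (S.r u v * v ^ (-S.ω)) := by positivity
          linarith
      _ = B * Z * S.r u v := by
          rw [hBd, hZ]
          field_simp
  have hχ' : |S.chi u v| ≤ A * Z := by
    refine (hχ u hu v hv hr).trans ?_
    rw [hZ, add_comm, ← Real.rpow_neg_one]
    have := rpow_le_of_exponent_le hr1 (by norm_num : (-(3 / 2) : ℝ) ≤ -1)
    gcongr
  have hθ : |S.theta u v| ≤ |S.chi u v| + |S.φ u v| * S.lam u v := by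
    have h1 : S.theta u v = S.chi u v - S.φ u v * S.lam u v := by unfold chi; ring
    rw [h1, ← abs_of_nonneg (S.lam_nonneg u v), ← abs_mul, abs_of_nonneg (S.lam_nonneg u v)]
    exact abs_sub _ _
  have hl : |S.φ u v| * S.lam u v ≤ B * Z * K :=
    mul_le_mul hφ (hB.lam_le u hu v hv) (S.lam_nonneg u v) (by positivity)
  have e1 : 0 < A * Z := by positivity
  have e2 : 0 < B * Z := by positivity
  have e3 : 0 < B * Z * K := by positivity
  refine ⟨?_, ?_, ?_⟩ <;> linarith

/-- Decay of the flux through outgoing null segments in the intermediate region. -/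
theorem exists_flux_le (hd : S.Decay R σ a C) (ha : 0 ≤ a) :
    ∃ A > 0, ∀ u ∈ Icc 1 S.U, ∀ v₁ ≥ 1, ∀ v₂ ≥ v₁, R ≤ S.r u v₁ → S.r u v₂ ≤ c / 2 * v₁ →
      S.varpi u v₂ - S.varpi u v₁ ≤
        A * (v₁ ^ (-(2 * S.ω)) * (v₂ - v₁) + v₁ ^ (-(2 * a)) * (S.r u v₁)⁻¹) := by
  have hc := hB.c_pos
  have hω := S.one_lt_ω
  obtain ⟨A, hA, h⟩ := hB.exists_abs_le_of_r_le hd ha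
  set B := A ^ 2 / c with hBd
  have hB0 : 0 < B := by positivity
  refine ⟨B + B / c, by positivity, fun u hu v₁ hv₁ v₂ hv hr hrv => ?_⟩
  have hv0 : 0 < v₁ := by linarith
  have h1 := sub_le_sub_of_hasDerivAt_le (f := fun v => S.varpi u v)
    (g := fun v => B * (v₁ ^ (-(2 * S.ω)) * v) - B / c * v₁ ^ (-(2 * a)) * (S.r u v)⁻¹)
    (g' := fun v => B * v₁ ^ (-(2 * S.ω)) + B / c * v₁ ^ (-(2 * a)) *
      (S.lam u v / S.r u v ^ 2)) hv (by fun_prop)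
    (Continuous.continuousOn (by
      have h2 : Continuous fun v => (S.r u v)⁻¹ :=
        (continuous_right S.continuous_r u).inv₀ (S.r_ne u)
      fun_prop))
    (fun x hx => S.dv_varpi u x (hv₁.trans_lt hx.1))
    (fun x hx => ((((hasDerivAt_id x).const_mul (v₁ ^ (-(2 * S.ω)))).const_mul B).sub
      (((S.dv_r u x (hv₁.trans_lt hx.1)).inv (S.r_ne u x)).const_mul _)).congr_deriv (by ring))
    (fun x hx => by
      have hx1 : 1 ≤ x := hv₁.trans hx.1.le
      have hrx : R ≤ S.r u x := hr.trans (S.r_mono hv₁ hx.1.le u)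
      have hrx' : S.r u x ≤ c / 2 * x := by
        refine ((S.r_mono hx1 hx.2.le u).trans hrv).trans ?_
        have := hx.1.le
        gcongr
      have h2 := (h u hu x hx1 hrx hrx').2.2
      have h3 := hB.le_kappa u hu x hx1
      have h4 := hB.le_lam u hu x hx1 hrx
      have hr0 := S.r_pos u x
      have e1 : x ^ (-a) ≤ v₁ ^ (-a) := Real.rpow_le_rpow_of_nonpos hv0 hx.1.le (by linarith)
      have e2 : x ^ (-S.ω) ≤ v₁ ^ (-S.ω) := Real.rpow_le_rpow_of_nonpos hv0 hx.1.le (by linarith)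
      have h5 : |S.theta u x| ≤ A * (v₁ ^ (-a) * (S.r u x)⁻¹ + v₁ ^ (-S.ω)) :=
        h2.trans (by gcongr)
      have h6 : S.theta u x ^ 2 ≤ (A * (v₁ ^ (-a) * (S.r u x)⁻¹ + v₁ ^ (-S.ω))) ^ 2 := by
        rw [← sq_abs]; gcongr
      have h7 : (S.kappa u x)⁻¹ ≤ c⁻¹ := by gcongr
      have e3 : v₁ ^ (-(2 * S.ω)) = (v₁ ^ (-S.ω)) ^ 2 := by
        rw [← Real.rpow_natCast, ← Real.rpow_mul hv0.le]; congr 1; push_cast; ring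
      have e4 : v₁ ^ (-(2 * a)) = (v₁ ^ (-a)) ^ 2 := by
        rw [← Real.rpow_natCast, ← Real.rpow_mul hv0.le]; congr 1; push_cast; ring
      -- With `λ ≥ c`, `r⁻²` is dominated by the exact derivative of `-1 / (c r)`; its integral
      -- leaves the factor `1 / r(u, v₁)`.
      have e5 : (S.r u x ^ 2)⁻¹ ≤ c⁻¹ * (S.lam u x / S.r u x ^ 2) := by
        rw [inv_mul_eq_div, div_div, mul_comm, ← div_div, ← one_div]
        gcongr
        rwa [one_le_div hc]
      rw [e3, e4]
      set p := v₁ ^ (-a)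
      set q := v₁ ^ (-S.ω)
      calc 1 / 2 * (S.kappa u x)⁻¹ * S.theta u x ^ 2
          ≤ 1 / 2 * c⁻¹ * (A * (p * (S.r u x)⁻¹ + q)) ^ 2 := by
            have := S.kappa_pos u x
            gcongr
        _ = B / 2 * (p * (S.r u x)⁻¹ + q) ^ 2 := by rw [hBd]; ring
        _ ≤ B / 2 * (2 * (p ^ 2 * (S.r u x ^ 2)⁻¹) + 2 * q ^ 2) := by
            gcongr
            rw [← inv_pow]
            nlinarith [sq_nonneg (p * (S.r u x)⁻¹ - q)]
        _ ≤ B / 2 * (2 * (p ^ 2 * (c⁻¹ * (S.lam u x / S.r u x ^ 2))) + 2 * q ^ 2) := by gcongr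
        _ = _ := by ring)
  have hr1 := S.r_pos u v₁
  have hr2 := S.r_pos u v₂
  have e1 : 0 ≤ B / c * v₁ ^ (-(2 * a)) * (S.r u v₂)⁻¹ := by positivity
  have e2 : 0 ≤ B / c * (v₁ ^ (-(2 * S.ω)) * (v₂ - v₁)) := by
    have := sub_nonneg.2 hv
    positivity
  have e3 : 0 ≤ B * (v₁ ^ (-(2 * a)) * (S.r u v₁)⁻¹) := by positivity
  linarith

end Bounds

end NormalizedSolution

theorem rpow_mul_rpow_le {v p q r : ℝ} (hv : 1 ≤ v) (h : p + q ≤ r) : v ^ p * v ^ q ≤ v ^ r := by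
  rw [← Real.rpow_add (by linarith)]
  exact rpow_le_of_exponent_le hv h

/-! ### Improved energy decay by averaging in time. -/

namespace NormalizedSolution

namespace Bounds

variable {S : NormalizedSolution} {u u₁ u₂ v v₁ v₂ : ℝ}
variable {R v₀ c K s a b C : ℝ} (hB : S.Bounds R v₀ c K)
include hB

/-- On an ingoing null ray of late advanced time, intermediate values of `r` are attained. -/
theorem exists_u_r_eq_rpow {ρ : ℝ} (hv : 1 ≤ v) (hRρ : R ≤ ρ) (hρ : ρ ≤ c * v) :
    ∃ u ∈ Icc 1 S.U, S.r u v = ρ :=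
  S.exists_u_r_eq S.one_lt_U.le ((hB.r_U_le v).trans hRρ) (hρ.trans (hB.le_r_one v hv))

theorem energy_le_of_rectangle (h₁ : 1 ≤ u) (h₂ : u ≤ S.U) (hv₁ : v₀ ≤ v₁) (hv : v₁ ≤ v₂) :
    S.ingoingEnergy u S.U v₂ ≤
      K * (S.ingoingEnergy u S.U v₁ + (S.varpi u v₂ - S.varpi u v₁)) := by
  have h1 := hB.energy_estimate u S.U v₁ v₂ h₁ h₂ le_rfl hv₁ hv
  have h2 : 0 ≤ ∫ v in v₁..v₂, ∫ u in u..S.U, 1 / S.r u v ^ 4 *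
      (S.zeta u v ^ 2 / (-S.nu u v)) :=
    intervalIntegral.integral_nonneg hv fun x _ =>
      intervalIntegral.integral_nonneg h₂ fun u _ => by
        have := S.energyDensity_nonneg u x
        have := S.r_pos u x
        positivity
  linarith

/-- In a time interval there is an ingoing null ray along which the energy is at most the average
provided by the Morawetz estimate. -/
theorem exists_small_energy (h₁ : 1 ≤ u) (h₂ : u ≤ S.U) (hv₁ : v₀ ≤ v₁) (hvm : v₁ ≤ v)
    (hv : v ≤ v₂) : ∃ w ∈ Icc v v₂, ∀ u' ∈ Icc u S.U, ∀ ρ, S.r u' w ≤ ρ →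
      S.ingoingEnergy u' S.U w * (v₂ - v) ≤
        ρ ^ 4 * (K * (S.ingoingEnergy u S.U v₁ + (S.varpi u v₂ - S.varpi u v₁))) := by
  set f : ℝ → ℝ → ℝ := fun u w => 1 / S.r u w ^ 4 * (S.zeta u w ^ 2 / (-S.nu u w)) with hf
  have hcont : Continuous fun z : ℝ × ℝ => f z.1 z.2 := by
    have h := S.r_ne
    have h' := S.nu_ne
    simp only [hf]
    fun_prop (disch := simp [h, h'])
  have hf0 : ∀ u v, 0 ≤ f u v := fun u v => by
    have := S.energyDensity_nonneg u v
    have := S.r_pos u v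
    positivity
  set G := fun w => ∫ u in u..S.U, f u w with hG
  have hGc : Continuous G := by
    apply intervalIntegral.continuous_parametric_intervalIntegral_of_continuous'
    exact hcont.comp continuous_swap
  have hG0 : ∀ x, 0 ≤ G x := fun x => intervalIntegral.integral_nonneg h₂ fun u _ => hf0 u x
  have hE : ∫ x in v₁..v₂, G x ≤
      K * (S.ingoingEnergy u S.U v₁ + (S.varpi u v₂ - S.varpi u v₁)) := by
    have h1 := hB.energy_estimate u S.U v₁ v₂ h₁ h₂ le_rfl hv₁ (hvm.trans hv)
    have h2 := S.ingoingEnergy_nonneg h₂ v₂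
    simp only [hG, hf]
    linarith
  obtain ⟨w, hw, hGw⟩ := exists_mul_le_integral hv hGc
  refine ⟨w, hw, fun u' hu' ρ hρ => ?_⟩
  have h1 : ∫ x in v..v₂, G x ≤ ∫ x in v₁..v₂, G x := by
    rw [← intervalIntegral.integral_add_adjacent_intervals (a := v₁) (b := v)
      (hGc.intervalIntegrable _ _) (hGc.intervalIntegrable _ _)]
    have : 0 ≤ ∫ x in v₁..v, G x := intervalIntegral.integral_nonneg hvm fun x _ => hG0 x
    linarith
  -- The spacetime integral has weight `r⁻⁴`; removing it on the segment `r ≤ ρ` costs `ρ⁴`.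
  have h2 : S.ingoingEnergy u' S.U w ≤ ρ ^ 4 * G w := by
    have h3 : S.ingoingEnergy u' S.U w ≤ ∫ u in u'..S.U, ρ ^ 4 * f u w := by
      refine integral_le_integral_of_le hu'.2 (S.continuous_energyDensity_left w)
        ((continuous_left hcont w).const_mul _) fun x hx => ?_
      have h4 := S.r_pos x w
      have h5 : S.r x w ≤ ρ := (S.r_antitone (h₁.trans hu'.1) hx.1.le hx.2.le w).trans hρ
      have h6 : S.r x w ^ 4 ≤ ρ ^ 4 := by gcongr
      rw [hf, ← mul_assoc, mul_one_div]
      apply le_mul_of_one_le_left (S.energyDensity_nonneg x w)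
      rwa [one_le_div (by positivity)]
    rw [intervalIntegral.integral_const_mul] at h3
    refine h3.trans ?_
    gcongr
    have hi := fun a b => (continuous_left hcont w).intervalIntegrable (μ := volume) a b
    simp only [hG]
    rw [← intervalIntegral.integral_add_adjacent_intervals (hi u u') (hi u' S.U)]
    have := intervalIntegral.integral_nonneg (μ := volume) hu'.1 fun u _ => hf0 u w
    linarith
  calc S.ingoingEnergy u' S.U w * (v₂ - v) ≤ ρ ^ 4 * G w * (v₂ - v) := by
        have := sub_nonneg.2 hv
        gcongr
    _ = ρ ^ 4 * (G w * (v₂ - v)) := by ring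
    _ ≤ _ := mul_le_mul_of_nonneg_left (hGw.trans (h1.trans hE)) (by positivity)

-- The gain of `s`. On the window `[v - T, v]` with `T = v^(10s)`, the spacetime integral is `≲
-- v^(-2a)`, so on some ray in its second half the energy in `r ≤ v^(2s)` is `≲ (v^(2s))⁴ v^(-2a) /
-- T = v^(-2(a + s))`. The energy estimate transports this to time `v`, with new outer flux `≲
-- v^(-2ω) T + v^(-2a) v^(-2s)`. The requirement `v^(-2ω) T ≤ v^(-2b)` is `b ≤ ω - 5s`.
set_option maxHeartbeats 400000 in
theorem exists_energy_le_of_large (hd : S.Decay R (2 * s) a C) (hs : 0 < s) (hs' : 20 * s ≤ 1)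
    (ha : 0 ≤ a) (ha' : a ≤ S.ω - 5 * s) (hba : b ≤ a + s) (hb' : b ≤ S.ω - 5 * s) :
    ∃ A > 0, ∃ V ≥ 1, ∀ u ∈ Icc 1 S.U, ∀ v ≥ V, S.r u v ≤ v ^ (2 * s) →
      S.ingoingEnergy u S.U v ≤ A * v ^ (-(2 * b)) := by
  have hc := hB.c_pos
  have hK := hB.K_pos
  have hC := hd.pos
  have hω := S.one_lt_ω
  have hv₀ := hB.one_le_v₀
  obtain ⟨A₁, hA₁, hflux⟩ := hB.exists_flux_le hd ha
  obtain ⟨V₁, hV₁⟩ : ∃ V₁ : ℝ, ∀ v ≥ V₁, v ^ (10 * s) ≤ 1 / 2 * v ^ (1 : ℝ) ∧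
      2 * v₀ ≤ v ∧ R ≤ (v / 2) ^ (2 * s) ∧ v ^ (2 * s) ≤ c / 2 * v ^ (10 * s) ∧
      v ^ (2 * s) ≤ c / 8 * v ^ (1 : ℝ) ∧ v ^ (10 * s) ≤ c / 8 / K * v ^ (1 : ℝ) := by
    rw [← eventually_atTop]
    have h2s : 0 < 2 * s := by positivity
    filter_upwards [eventually_rpow_le_mul (by linarith : 10 * s < 1) (by norm_num : (0:ℝ) < 1 / 2),
      eventually_ge_atTop (2 * v₀),
      ((tendsto_rpow_atTop h2s).comp (tendsto_id.atTop_div_const two_pos)).eventually_ge_atTop R,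
      eventually_rpow_le_mul (by linarith : 2 * s < 10 * s) (by positivity : 0 < c / 2),
      eventually_rpow_le_mul (by linarith : 2 * s < 1) (by positivity : 0 < c / 8),
      eventually_rpow_le_mul (by linarith : 10 * s < 1) (by positivity : 0 < c / 8 / K)]
      with v h1 h2 h3 h4 h5 h6
    exact ⟨h1, h2, h3, h4, h5, h6⟩
  set E₁ := A₁ * (2 ^ (2 * S.ω) + 2 ^ (2 * a)) with hE₁
  have hE₁0 : 0 < E₁ := by positivity
  set B₁ := K * (C * 2 ^ (2 * a) + E₁) with hB₁
  have hB₁0 : 0 < B₁ := by positivity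
  refine ⟨K * (2 * B₁ + E₁), by positivity, max V₁ 1, le_max_right _ _, fun u hu v hv hr => ?_⟩
  obtain ⟨hT, hvv₀, hRv, hsT, hsv, hTv⟩ := hV₁ v ((le_max_left _ _).trans hv)
  have hv1 : 1 ≤ v := (le_max_right _ _).trans hv
  have hv0 : 0 < v := by linarith
  rw [Real.rpow_one] at hT hsv hTv
  rw [div_div, div_mul_eq_mul_div, le_div_iff₀ (by positivity)] at hTv
  set T := v ^ (10 * s) with hTdef
  have hT0 : 0 < T := by positivity
  set v₁ := v - T with hv₁
  have hv₁h : v / 2 ≤ v₁ := by linarith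
  have hv₁v₀ : v₀ ≤ v₁ := by linarith
  have hv₁1 : 1 ≤ v₁ := hv₀.trans hv₁v₀
  have hv₁v : v₁ ≤ v := by linarith
  have hv₁0 : 0 < v₁ := by linarith
  -- powers of times in `[v₁, v]` are comparable
  have hpw : ∀ x ≥ v₁, ∀ p : ℝ, 0 ≤ p → x ^ (-p) ≤ 2 ^ p * v ^ (-p) := fun x hx p hp =>
    rpow_neg_le_of_le_mul hv0 two_pos (by linarith) hp
  have hpT : v ^ (-(2 * S.ω)) * T ≤ v ^ (-(2 * a)) ∧ v ^ (-(2 * S.ω)) * T ≤ v ^ (-(2 * b)) :=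
    ⟨rpow_mul_rpow_le hv1 (by linarith), rpow_mul_rpow_le hv1 (by linarith)⟩
  have hRs : R ≤ v₁ ^ (2 * s) := hRv.trans (by gcongr)
  have hss : v₁ ^ (2 * s) ≤ v ^ (2 * s) := by gcongr
  -- The outer side of the first rectangle starts at `r = v₁^(2s)`, where the assumed energy decay
  -- applies.
  obtain ⟨u₀, hu₀, hru₀⟩ := hB.exists_u_r_eq_rpow (ρ := v₁ ^ (2 * s)) hv₁1 hRs (by nlinarith)
  have hflux₀ : S.varpi u₀ v - S.varpi u₀ v₁ ≤ E₁ * v ^ (-(2 * a)) := by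
    have h1 := hB.r_sub_le_mul_sub hu₀ hv₁1 hv₁v
    refine (hflux u₀ hu₀ v₁ hv₁1 v hv₁v (hRs.trans hru₀.ge) (by nlinarith)).trans ?_
    rw [hE₁, mul_assoc]
    gcongr
    have h2 : (S.r u₀ v₁)⁻¹ ≤ 1 :=
      inv_le_one_of_one_le₀ (hB.one_le_R.trans (hRs.trans hru₀.ge))
    have h3 : v - v₁ = T := by rw [hv₁]; ring
    rw [h3]
    calc v₁ ^ (-(2 * S.ω)) * T + v₁ ^ (-(2 * a)) * (S.r u₀ v₁)⁻¹
        ≤ 2 ^ (2 * S.ω) * v ^ (-(2 * S.ω)) * T + 2 ^ (2 * a) * v ^ (-(2 * a)) * 1 := by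
          have := S.r_pos u₀ v₁
          gcongr
          · exact hpw v₁ le_rfl _ (by positivity)
          · exact hpw v₁ le_rfl _ (by positivity)
      _ ≤ 2 ^ (2 * S.ω) * v ^ (-(2 * a)) + 2 ^ (2 * a) * v ^ (-(2 * a)) := by
          rw [mul_one, mul_assoc]
          gcongr
          exact hpT.1
      _ = _ := by ring
  have hen₀ : S.ingoingEnergy u₀ S.U v₁ ≤ C * 2 ^ (2 * a) * v ^ (-(2 * a)) := by
    refine (hd.energy u₀ hu₀ v₁ hv₁1 hru₀.le).trans ?_
    rw [mul_assoc]
    gcongr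
    exact hpw v₁ le_rfl _ (by positivity)
  set Q := K * (S.ingoingEnergy u₀ S.U v₁ + (S.varpi u₀ v - S.varpi u₀ v₁)) with hQ
  have hQB : Q ≤ B₁ * v ^ (-(2 * a)) := by
    calc Q ≤ K * (C * 2 ^ (2 * a) * v ^ (-(2 * a)) + E₁ * v ^ (-(2 * a))) := by
          rw [hQ]; gcongr
      _ = _ := by rw [hB₁]; ring
  -- Only the second half of the window is searched: by then the ray `u₀` has travelled at least `c
  -- T / 2 ≥ v^(2s)` in `r`, so a ray `u' ≥ u₀` with `r(u', w) = v^(2s)` exists.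
  obtain ⟨w, hw, hsmall⟩ := hB.exists_small_energy hu₀.1 hu₀.2 hv₁v₀
    (by linarith : v₁ ≤ v₁ + T / 2) (by linarith : v₁ + T / 2 ≤ v)
  rw [← hQ] at hsmall
  have hw₁ : v₁ ≤ w := by linarith [hw.1]
  have hw1 : 1 ≤ w := hv₁1.trans hw₁
  have hrw : v ^ (2 * s) ≤ S.r u₀ w := by
    have h1 := hB.mul_sub_le_r_sub hu₀ hv₁1 hw₁ (hRs.trans hru₀.ge)
    have h2 : c * (T / 2) ≤ c * (w - v₁) := by
      gcongr
      linarith [hw.1]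
    have h3 := S.r_pos u₀ v₁
    linarith
  have hRs' : R ≤ v ^ (2 * s) := hRs.trans hss
  obtain ⟨u', hu', hru'⟩ := S.exists_u_r_eq hu₀.2 ((hB.r_U_le w).trans hRs') hrw
  have hu'1 : 1 ≤ u' := hu₀.1.trans hu'.1
  have hu'm : u' ∈ Icc 1 S.U := ⟨hu'1, hu'.2⟩
  have hen' : S.ingoingEnergy u' S.U w ≤ 2 * B₁ * v ^ (-(2 * b)) := by
    have h1 := hsmall u' hu' _ hru'.le
    have h2 : v - (v₁ + T / 2) = T / 2 := by rw [hv₁]; ring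
    have h3 : (v ^ (2 * s)) ^ 4 = v ^ (8 * s) := by
      rw [← Real.rpow_natCast, ← Real.rpow_mul hv0.le]; congr 1; push_cast; ring
    rw [h2, h3] at h1
    have h4 : S.ingoingEnergy u' S.U w ≤ 2 * (v ^ (8 * s) * Q) * v ^ (-(10 * s)) := by
      rw [Real.rpow_neg hv0.le (10 * s), ← div_eq_mul_inv, le_div_iff₀ hT0]
      linarith
    -- The exponents add up to `8s - 2a - 10s = -2(a + s) ≤ -2b`.
    have h5 : v ^ (8 * s) * (v ^ (-(2 * a)) * v ^ (-(10 * s))) ≤ v ^ (-(2 * b)) := by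
      rw [← Real.rpow_add hv0]
      exact rpow_mul_rpow_le hv1 (by linarith)
    calc _ ≤ 2 * (v ^ (8 * s) * (B₁ * v ^ (-(2 * a)))) * v ^ (-(10 * s)) := h4.trans (by gcongr)
      _ = 2 * B₁ * (v ^ (8 * s) * (v ^ (-(2 * a)) * v ^ (-(10 * s)))) := by ring
      _ ≤ _ := by gcongr
  have hflux' : S.varpi u' v - S.varpi u' w ≤ E₁ * v ^ (-(2 * b)) := by
    have h1 := hB.r_sub_le_mul_sub hu'm hw1 hw.2
    have hKT : K * (v - w) ≤ K * T := by gcongr; linarith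
    refine (hflux u' hu'm w hw1 v hw.2 (hRs'.trans hru'.ge) (by nlinarith)).trans ?_
    rw [hE₁, mul_assoc, hru', ← Real.rpow_neg hv0.le]
    gcongr
    have h2 : v - w ≤ T := by linarith
    have h3 : 0 ≤ v - w := by linarith [hw.2]
    calc w ^ (-(2 * S.ω)) * (v - w) + w ^ (-(2 * a)) * v ^ (-(2 * s))
        ≤ 2 ^ (2 * S.ω) * v ^ (-(2 * S.ω)) * T +
          2 ^ (2 * a) * v ^ (-(2 * a)) * v ^ (-(2 * s)) := by
          gcongr
          · exact hpw w hw₁ _ (by positivity)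
          · exact hpw w hw₁ _ (by positivity)
      _ ≤ 2 ^ (2 * S.ω) * v ^ (-(2 * b)) + 2 ^ (2 * a) * v ^ (-(2 * b)) := by
          rw [mul_assoc, mul_assoc]
          gcongr
          · exact hpT.2
          · exact rpow_mul_rpow_le hv1 (by linarith)
      _ = _ := by ring
  -- From `w` to `v` the ray `u'` moves outward, so at time `v` it still encloses the region `r ≤
  -- v^(2s)`.
  have hu'u : u' ≤ u := S.le_of_r_le (v := v) hu.1 hu'.2
    (hr.trans (hru'.ge.trans (S.r_mono hw1 hw.2 u')))
  calc S.ingoingEnergy u S.U v ≤ S.ingoingEnergy u' S.U v := S.ingoingEnergy_mono hu'u S.U v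
    _ ≤ K * (S.ingoingEnergy u' S.U w + (S.varpi u' v - S.varpi u' w)) :=
        hB.energy_le_of_rectangle hu'1 hu'.2 (hv₁v₀.trans hw₁) hw.2
    _ ≤ K * (2 * B₁ * v ^ (-(2 * b)) + E₁ * v ^ (-(2 * b))) := by gcongr
    _ = _ := by ring

/-- Improved decay of the energy, by averaging the Morawetz estimate over a long time interval. -/
theorem exists_energy_le (hd : S.Decay R (2 * s) a C) (hs : 0 < s) (hs' : 20 * s ≤ 1)
    (ha : 0 ≤ a) (ha' : a ≤ S.ω - 5 * s) (hb : 0 ≤ b) (hba : b ≤ a + s) (hb' : b ≤ S.ω - 5 * s) :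
    ∃ A > 0, ∀ u ∈ Icc 1 S.U, ∀ v ≥ 1, S.r u v ≤ v ^ (2 * s) →
      S.ingoingEnergy u S.U v ≤ A * v ^ (-(2 * b)) := by
  have hK := hB.K_pos
  obtain ⟨A, hA, V, hV, h⟩ := hB.exists_energy_le_of_large hd hs hs' ha ha' hba hb'
  have hV0 : 0 < V := by linarith
  refine ⟨A + K * V ^ (2 * b), by positivity, fun u hu v hv hr => ?_⟩
  have hv0 : 0 < v := by linarith
  have e1 : 0 ≤ K * V ^ (2 * b) * v ^ (-(2 * b)) := by positivity
  have e2 : 0 ≤ A * v ^ (-(2 * b)) := by positivity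
  rcases le_total V v with hvV | hvV
  · linarith [h u hu v hvV hr]
  · have h1 := (S.ingoingEnergy_mono hu.1 S.U v).trans (hB.energy_le v hv)
    have h2 : 1 ≤ V ^ (2 * b) * v ^ (-(2 * b)) := by
      rw [Real.rpow_neg hv0.le, ← div_eq_mul_inv, one_le_div (by positivity)]
      gcongr
    nlinarith

end Bounds

end NormalizedSolution

/-! ### Improved decay of `r φ` and the iteration. -/

namespace NormalizedSolution

variable {S : NormalizedSolution} {u v : ℝ}

namespace Bounds

variable {R v₀ c K a b s C : ℝ} (hB : S.Bounds R v₀ c K)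
include hB

/-- Improved decay in the region `r ≤ v ^ (2 s)`, from decay of the energy there. -/
theorem exists_abs_le_of_energy_le (hd : S.Decay R (2 * s) a C) (hs : 0 < s) (hs' : 20 * s ≤ 1)
    (ha : 0 ≤ a) (hba : b ≤ a + s) (hb' : b ≤ S.ω - 5 * s) {A : ℝ} (hA : 0 < A)
    (hE : ∀ u ∈ Icc 1 S.U, ∀ v ≥ 1, S.r u v ≤ v ^ (2 * s) →
      S.ingoingEnergy u S.U v ≤ A * v ^ (-(2 * b))) :
    ∃ D > 0, ∃ V ≥ 1, ∀ u ∈ Icc 1 S.U, ∀ v ≥ V, S.r u v ≤ v ^ (2 * s) →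
      |S.φ u v| ≤ D * v ^ (-b) * S.r u v ^ (-(1 / 2) : ℝ) ∧
      |S.chi u v| ≤ D * (v ^ (-b - 2 * s) + v ^ (-b) * S.r u v ^ (-(3 / 2) : ℝ)) := by
  have hc := hB.c_pos
  have hK := hB.K_pos
  obtain ⟨A₁, hA₁, hφ⟩ := hB.exists_abs_le_of_r_le hd ha
  obtain ⟨A₂, hA₂, hχ⟩ := hB.exists_abs_chi_le hd ha
  obtain ⟨V, hV⟩ : ∃ V : ℝ, ∀ v ≥ V, 1 ≤ v ∧ R ≤ v ^ (2 * s) ∧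
      v ^ (2 * s) ≤ c / 2 * v ^ (1 : ℝ) := by
    rw [← eventually_atTop]
    have h2s : 0 < 2 * s := by positivity
    filter_upwards [eventually_ge_atTop 1, (tendsto_rpow_atTop h2s).eventually_ge_atTop R,
      eventually_rpow_le_mul (by linarith : 2 * s < 1) (by positivity : 0 < c / 2)]
      with v h1 h2 h3
    exact ⟨h1, h2, h3⟩
  set D := 2 * A₁ + A + 1 with hD
  have hD0 : 0 < D := by positivity
  refine ⟨D + (2 * A₂ + K * D), by positivity, max V 1, le_max_right _ _, fun u hu v hv hr => ?_⟩
  obtain ⟨hv1, hRv, hvc⟩ := hV v ((le_max_left _ _).trans hv)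
  rw [Real.rpow_one] at hvc
  have hv0 : 0 < v := by linarith
  have hrs : (v ^ (2 * s)) ^ (-(1 / 2) : ℝ) = v ^ (-s) := by
    rw [← Real.rpow_mul hv0.le]; congr 1; ring
  -- The integration inward starts on `r = v^(2s)`, where the old exponent already yields `φ =
  -- O(v^(-a - 2s) + v^(-ω)) = O(v^(-b - s))`.
  obtain ⟨u₁, hu₁, hru₁⟩ := S.exists_u_r_eq (u₁ := 1) (v := v) hu.1 hr (by
    have := hB.le_r_one v hv1
    have : 0 < c * v := by positivity
    linarith)
  have hu₁' : u₁ ∈ Icc 1 S.U := ⟨hu₁.1, hu₁.2.trans hu.2⟩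
  have hφ₁ : |S.φ u₁ v| ≤ 2 * A₁ * v ^ (-(b + s)) := by
    have h := (hφ u₁ hu₁' v hv1 (hRv.trans hru₁.ge) (hru₁.le.trans hvc)).1
    rw [hru₁, ← Real.rpow_neg hv0.le, ← Real.rpow_add hv0] at h
    have e1 : v ^ (-a + -(2 * s)) ≤ v ^ (-(b + s)) := rpow_le_of_exponent_le hv1 (by linarith)
    have e2 : v ^ (-S.ω) ≤ v ^ (-(b + s)) := rpow_le_of_exponent_le hv1 (by linarith)
    calc _ ≤ A₁ * (v ^ (-(b + s)) + v ^ (-(b + s))) := h.trans (by gcongr)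
      _ = _ := by ring
  have hχ₁ : |S.chi u₁ v| ≤ 2 * A₂ * v ^ (-b - 2 * s) := by
    have h := hχ u₁ hu₁' v hv1 (hRv.trans hru₁.ge)
    rw [hru₁, ← Real.rpow_mul hv0.le, ← Real.rpow_add hv0] at h
    have e1 : v ^ (-a + 2 * s * -(3 / 2)) ≤ v ^ (-b - 2 * s) :=
      rpow_le_of_exponent_le hv1 (by linarith)
    have e2 : v ^ (-S.ω) ≤ v ^ (-b - 2 * s) := rpow_le_of_exponent_le hv1 (by linarith)
    calc _ ≤ A₂ * (v ^ (-b - 2 * s) + v ^ (-b - 2 * s)) := h.trans (by gcongr)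
      _ = _ := by ring
  have hφx : ∀ x ∈ Icc u₁ u, |S.φ x v| ≤ D * v ^ (-b) * S.r x v ^ (-(1 / 2) : ℝ) := by
    intro x hx
    have hxU : x ∈ Icc 1 S.U := ⟨hu₁.1.trans hx.1, hx.2.trans hu.2⟩
    have hr0 := S.r_pos x v
    have hrx : S.r x v ≤ v ^ (2 * s) :=
      (S.r_antitone hu₁.1 hx.1 hxU.2 v).trans hru₁.le
    -- The weight `η = v^b r^(-1/2)` balances the energy `v^(-2b)` against `1 / r`.
    have h1 := S.abs_sub_le_of_abs_deriv_le (f := fun u => S.φ u v) (L := 1)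
      (η := v ^ b * S.r x v ^ (-(1 / 2) : ℝ)) (v := v) zero_le_one (by positivity) hu₁.1 hx.1 hxU.2
      (by fun_prop) (fun u hu => S.du_φ u hu v)
      (fun u hu => by rw [abs_div, abs_of_pos (S.r_pos u v), one_mul])
    have h2 : S.ingoingEnergy u₁ x v ≤ A * v ^ (-(2 * b)) :=
      (S.ingoingEnergy_mono_right u₁ hxU.2 v).trans (hE u₁ hu₁' v hv1 hru₁.le)
    have h3 : v ^ b * S.r x v ^ (-(1 / 2) : ℝ) * S.ingoingEnergy u₁ x v ≤
        A * (v ^ (-b) * S.r x v ^ (-(1 / 2) : ℝ)) := by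
      calc _ ≤ v ^ b * S.r x v ^ (-(1 / 2) : ℝ) * (A * v ^ (-(2 * b))) := by gcongr
        _ = A * ((v ^ b * v ^ (-(2 * b))) * S.r x v ^ (-(1 / 2) : ℝ)) := by ring
        _ = _ := by rw [← Real.rpow_add hv0]; ring_nf
    have h4 : (v ^ b * S.r x v ^ (-(1 / 2) : ℝ))⁻¹ * (S.r x v)⁻¹ =
        v ^ (-b) * S.r x v ^ (-(1 / 2) : ℝ) := by
      rw [mul_inv, ← Real.rpow_neg hv0.le, ← Real.rpow_neg hr0.le, mul_assoc,
        ← Real.rpow_neg_one (S.r x v), ← Real.rpow_add hr0]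
      norm_num
    have h5 : v ^ (-(b + s)) ≤ v ^ (-b) * S.r x v ^ (-(1 / 2) : ℝ) := by
      have := Real.rpow_le_rpow_of_nonpos hr0 hrx (by norm_num : (-(1 / 2) : ℝ) ≤ 0)
      rw [hrs] at this
      rw [neg_add, Real.rpow_add hv0]
      gcongr
    have h6 : |S.φ x v| ≤ |S.φ x v - S.φ u₁ v| + |S.φ u₁ v| := by
      have := abs_add_le (S.φ x v - S.φ u₁ v) (S.φ u₁ v)
      rwa [sub_add_cancel] at this
    have h7 := mul_le_mul_of_nonneg_left h5 (by positivity : 0 ≤ 2 * A₁)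
    rw [h4, one_mul] at h1
    rw [hD]
    linarith
  have h1 := hB.abs_chi_sub_le_rpow hu₁.1 hu₁.2 hu.2 hv1 (by positivity : 0 ≤ D * v ^ (-b))
    (fun x hx => hφx x ⟨hx.1.le, hx.2.le⟩)
  have h2 : |S.chi u v| ≤ |S.chi u v - S.chi u₁ v| + |S.chi u₁ v| := by
    have := abs_add_le (S.chi u v - S.chi u₁ v) (S.chi u₁ v)
    rwa [sub_add_cancel] at this
  have hr0 := S.r_pos u v
  have e1 : 0 ≤ (2 * A₂ + K * D) * (v ^ (-b) * S.r u v ^ (-(1 / 2) : ℝ)) := by positivity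
  have e2 : 0 ≤ (D + 2 * A₂) * (v ^ (-b) * S.r u v ^ (-(3 / 2) : ℝ)) := by positivity
  have e3 : 0 ≤ (D + K * D) * v ^ (-b - 2 * s) := by positivity
  refine ⟨?_, ?_⟩
  · have := hφx u ⟨hu₁.2, le_rfl⟩
    linarith
  · linarith

/-- Improved decay of `r φ` in the region `r ≤ (v / 2) ^ (2 s)`. -/
theorem exists_abs_r_mul_φ_le (hd : S.Decay R (2 * s) a C) (hs : 0 < s) (hs' : 20 * s ≤ 1)
    (ha : 0 ≤ a) (hb : 0 ≤ b) (hba : b ≤ a + s) (hb' : b ≤ S.ω - 5 * s) {A : ℝ} (hA : 0 < A)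
    (hE : ∀ u ∈ Icc 1 S.U, ∀ v ≥ 1, S.r u v ≤ v ^ (2 * s) →
      S.ingoingEnergy u S.U v ≤ A * v ^ (-(2 * b))) :
    ∃ D > 0, ∃ V ≥ 1, ∀ u ∈ Icc 1 S.U, ∀ v ≥ V, R ≤ S.r u v → S.r u v ≤ (v / 2) ^ (2 * s) →
      |S.r u v * S.φ u v| ≤ D * v ^ (-b) := by
  have hc := hB.c_pos
  have hR := hB.R_pos
  obtain ⟨D, hD, V, hV1, hV⟩ := hB.exists_abs_le_of_energy_le hd hs hs' ha hba hb' hA hE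
  obtain ⟨V', hV'⟩ : ∃ V' : ℝ, ∀ v ≥ V', v ^ (2 * s) ≤ c * v ^ (1 : ℝ) :=
    eventually_atTop.1 (eventually_rpow_le_mul (by linarith : 2 * s < 1) hc)
  have hV'' : 1 ≤ 2 * max V V' := by linarith [le_max_left V V']
  refine ⟨(D / c + 2 * D / c + R * D) * 2 ^ b, by positivity, 2 * max V V', hV'',
    fun u hu v hv hr hrv => ?_⟩
  have hvV : V ≤ v / 2 := by linarith [le_max_left V V']
  have hvV' : V' ≤ v / 2 := by linarith [le_max_right V V']
  have hv0 : 0 < v := by linarith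
  set y := v / 2 with hy
  have hy0 : 0 < y := by positivity
  have hvc := hV' y hvV'
  rw [Real.rpow_one] at hvc
  obtain ⟨w, hw, hrw⟩ := hB.exists_r_eq hu (by linarith : 1 ≤ v) hr
  have h1 := hB.mul_sub_le_r_sub hu hw.1 hw.2 hrw.ge
  -- As `λ ≥ c`, the ray needs at most time `(v / 2)^(2s) / c ≤ v / 2` to get from `R` to the given
  -- point, so all times involved are at least `v / 2`.
  have hwv : v - w ≤ y ^ (2 * s) / c := by
    rw [le_div_iff₀' hc]
    linarith
  have hwy : y ≤ w := by
    have : y ^ (2 * s) / c ≤ y := by rwa [div_le_iff₀' hc]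
    linarith
  have hmem : ∀ x ∈ Icc w v, S.r u x ≤ x ^ (2 * s) := by
    intro x hx
    have hyx : y ≤ x := hwy.trans hx.1
    exact ((S.r_mono (hw.1.trans hx.1) hx.2 u).trans hrv).trans (by gcongr)
  have hpow : ∀ x, y ≤ x → ∀ p : ℝ, p ≤ 0 → x ^ p ≤ y ^ p := fun x hx p hp =>
    Real.rpow_le_rpow_of_nonpos hy0 hx hp
  have h2 := hB.abs_r_mul_φ_sub_le (g := fun x => D * y ^ (-b - 2 * s) * x)
    (g' := fun _ => D * y ^ (-b - 2 * s)) (A := D * y ^ (-b)) (p := 1 / 2) hu hw.1 hw.2 hrw.ge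
    (by positivity) (by norm_num) (by fun_prop)
    (fun x _ => ((hasDerivAt_id x).const_mul _).congr_deriv (by ring))
    (fun x hx => by
      have hyx : y ≤ x := hwy.trans hx.1.le
      have h3 := (hV u hu x (hvV.trans hyx) (hmem x ⟨hx.1.le, hx.2.le⟩)).2
      have h4 := hpow x hyx (-b - 2 * s) (by linarith)
      have h5 := hpow x hyx (-b) (by linarith)
      have h6 := S.r_pos u x
      rw [show (-(1 / 2) - 1 : ℝ) = -(3 / 2) by norm_num]
      calc _ ≤ D * (x ^ (-b - 2 * s) + x ^ (-b) * S.r u x ^ (-(3 / 2) : ℝ)) := h3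
        _ ≤ D * (y ^ (-b - 2 * s) + y ^ (-b) * S.r u x ^ (-(3 / 2) : ℝ)) := by gcongr
        _ = _ := by ring)
  rw [hrw] at h2
  have hR' : R ^ (-(1 / 2) : ℝ) ≤ 1 :=
    Real.rpow_le_one_of_one_le_of_nonpos hB.one_le_R (by norm_num)
  have h3 : |R * S.φ u w| ≤ R * D * y ^ (-b) := by
    have h4 := (hV u hu w (hvV.trans hwy) (hmem w ⟨le_rfl, hw.2⟩)).1
    rw [hrw] at h4
    have h5 := hpow w hwy (-b) (by linarith)
    rw [abs_mul, abs_of_pos hR, mul_assoc]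
    gcongr
    calc _ ≤ D * y ^ (-b) * 1 := h4.trans (by gcongr)
      _ = _ := mul_one _
  have h4 : D * y ^ (-b - 2 * s) * v - D * y ^ (-b - 2 * s) * w ≤ D / c * y ^ (-b) := by
    calc _ = D * y ^ (-b - 2 * s) * (v - w) := by ring
      _ ≤ D * y ^ (-b - 2 * s) * (y ^ (2 * s) / c) := by gcongr
      _ = D / c * (y ^ (-b - 2 * s) * y ^ (2 * s)) := by ring
      _ = _ := by rw [← Real.rpow_add hy0, sub_add_cancel]
  have h5 : D * y ^ (-b) / (c * (1 / 2)) * R ^ (-(1 / 2) : ℝ) ≤ 2 * D / c * y ^ (-b) := by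
    calc _ ≤ D * y ^ (-b) / (c * (1 / 2)) * 1 := by gcongr
      _ = _ := by field_simp
  have h6 : |S.r u v * S.φ u v| ≤ |S.r u v * S.φ u v - R * S.φ u w| + |R * S.φ u w| := by
    have := abs_add_le (S.r u v * S.φ u v - R * S.φ u w) (R * S.φ u w)
    rwa [sub_add_cancel] at this
  have h7 : y ^ (-b) = 2 ^ b * v ^ (-b) := by
    rw [hy, Real.div_rpow hv0.le two_pos.le, Real.rpow_neg two_pos.le, div_inv_eq_mul, mul_comm]
  calc _ ≤ (D / c + 2 * D / c + R * D) * y ^ (-b) := by linarith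
    _ = _ := by rw [h7]; ring

/-- Growth of `r φ` along outgoing null rays. -/
theorem exists_abs_r_mul_φ_sub_le (hd : S.Decay R (2 * s) a C) (ha : 0 ≤ a) :
    ∃ A > 0, ∀ u ∈ Icc 1 S.U, ∀ y ≥ 1, ∀ v ≥ y, R ≤ S.r u y →
      |S.r u v * S.φ u v - S.r u y * S.φ u y| ≤ A * (y ^ (-a) * S.r u y ^ (-(1 / 2) : ℝ) +
        min (S.r u v) (S.retTime u v) * S.retTime u v ^ (-S.ω)) := by
  have hc := hB.c_pos
  have hK := hB.K_pos
  have hω : 0 < S.ω - 1 := by linarith [S.one_lt_ω]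
  obtain ⟨A, hA, hχ⟩ := hB.exists_abs_chi_le hd ha
  set k := K * (2 * K) with hk
  have hk0 : 0 < k := by positivity
  refine ⟨2 * A / c + A / (S.ω - 1) * k ^ (S.ω - 1) + A / c * k ^ S.ω, by positivity,
    fun u hu y hy v hv hr => ?_⟩
  have hy0 : 0 < y := by linarith
  have ht : 0 < S.retTime u v := by linarith [S.one_le_retTime hu.1 hu.2 v]
  -- Retarded time is almost constant along an outgoing ray, so negative powers of `y` turn into
  -- powers of `t`.
  have hty : S.retTime u v ≤ k * y := by
    rw [hk, mul_assoc]
    exact (hB.retTime_le u hu y hy v hv hr).trans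
      (mul_le_mul_of_nonneg_left (hB.retTime_le_mul hy) hK.le)
  have hr0 := S.r_pos u v
  have hry := S.r_pos u y
  have hbound : ∀ x ∈ Ioo y v, |S.chi u x| ≤
      A * x ^ (-S.ω) + A * y ^ (-a) * S.r u x ^ (-(1 / 2) - 1 : ℝ) := by
    intro x hx
    have h1 := hχ u hu x (hy.trans hx.1.le) (hr.trans (S.r_mono hy hx.1.le u))
    have h2 : x ^ (-a) ≤ y ^ (-a) := Real.rpow_le_rpow_of_nonpos hy0 hx.1.le (by linarith)
    have h3 := S.r_pos u x
    rw [show (-(1 / 2) - 1 : ℝ) = -(3 / 2) by norm_num]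
    calc _ ≤ A * (x ^ (-S.ω) + y ^ (-a) * S.r u x ^ (-(3 / 2) : ℝ)) := h1.trans (by gcongr)
      _ = _ := by ring
  set Z := y ^ (-a) * S.r u y ^ (-(1 / 2) : ℝ) with hZ
  have hZ0 : 0 < Z := by positivity
  have hZ' : A * y ^ (-a) / (c * (1 / 2)) * S.r u y ^ (-(1 / 2) : ℝ) = 2 * A / c * Z := by
    rw [hZ]; field_simp
  -- The term `x^(-ω)` is integrated in two ways: here as a tail, which gives `t^(1 - ω)`, and in
  -- `h2` frozen at `y` times the length `v - y ≤ r / c`, which gives `r t^(-ω)`. Together they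
  -- produce `min(r, t) t^(-ω)`.
  have h1 := hB.abs_r_mul_φ_sub_le (g := fun x => -(A / (S.ω - 1)) * x ^ (-(S.ω - 1)))
    (g' := fun x => A * x ^ (-S.ω)) (A := A * y ^ (-a)) (p := 1 / 2) hu hy hv hr (by positivity)
    (by norm_num) (by
      refine continuousOn_const.mul (continuousOn_id.rpow_const fun x hx => Or.inl ?_)
      have := hx.1
      simp only [id]
      linarith)
    (fun x hx => by
      have hx0 : x ≠ 0 := by linarith [hx.1]
      refine ((Real.hasDerivAt_rpow_const (p := -(S.ω - 1)) (Or.inl hx0)).const_mul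
        (-(A / (S.ω - 1)))).congr_deriv ?_
      rw [show -(S.ω - 1) - 1 = -S.ω by ring]
      field_simp)
    hbound
  have h2 := hB.abs_r_mul_φ_sub_le (g := fun x => A * y ^ (-S.ω) * x)
    (g' := fun x => A * y ^ (-S.ω)) (A := A * y ^ (-a)) (p := 1 / 2) hu hy hv hr (by positivity)
    (by norm_num) (by fun_prop)
    (fun x _ => ((hasDerivAt_id x).const_mul _).congr_deriv (by ring))
    (fun x hx => (hbound x hx).trans (by
      have := Real.rpow_le_rpow_of_nonpos hy0 hx.1.le (by linarith : -S.ω ≤ 0)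
      gcongr))
  rw [hZ'] at h1 h2
  have h3 : -(A / (S.ω - 1)) * v ^ (-(S.ω - 1)) - -(A / (S.ω - 1)) * y ^ (-(S.ω - 1)) ≤
      A / (S.ω - 1) * k ^ (S.ω - 1) * (S.retTime u v * S.retTime u v ^ (-S.ω)) := by
    have h4 := rpow_neg_le_of_le_mul ht hk0 hty hω.le
    have h5 : S.retTime u v ^ (-(S.ω - 1)) = S.retTime u v * S.retTime u v ^ (-S.ω) := by
      rw [show -(S.ω - 1) = 1 + -S.ω by ring, Real.rpow_add ht, Real.rpow_one]
    have h6 : 0 ≤ A / (S.ω - 1) * v ^ (-(S.ω - 1)) := by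
      have : 0 < v := by linarith
      positivity
    rw [h5] at h4
    calc _ ≤ A / (S.ω - 1) * y ^ (-(S.ω - 1)) := by linarith
      _ ≤ A / (S.ω - 1) * (k ^ (S.ω - 1) * (S.retTime u v * S.retTime u v ^ (-S.ω))) := by gcongr
      _ = _ := by ring
  have h4 : A * y ^ (-S.ω) * v - A * y ^ (-S.ω) * y ≤
      A / c * k ^ S.ω * (S.r u v * S.retTime u v ^ (-S.ω)) := by
    have h5 := rpow_neg_le_of_le_mul ht hk0 hty (by linarith : 0 ≤ S.ω)
    have h6 : v - y ≤ S.r u v / c := by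
      rw [le_div_iff₀' hc]
      linarith [hB.mul_sub_le_r_sub hu hy hv hr]
    calc _ = A * y ^ (-S.ω) * (v - y) := by ring
      _ ≤ A * (k ^ S.ω * S.retTime u v ^ (-S.ω)) * (S.r u v / c) := by
          have := sub_nonneg.2 hv
          gcongr
      _ = _ := by ring
  set T := S.retTime u v ^ (-S.ω) with hT
  have hT0 : 0 < T := by positivity
  have e1 : 0 < A / (S.ω - 1) * k ^ (S.ω - 1) := by positivity
  have e2 : 0 < A / c * k ^ S.ω := by positivity
  have e3 : 0 < 2 * A / c := by positivity
  have m1 : 0 < S.r u v * T := by positivity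
  have m2 : 0 < S.retTime u v * T := by positivity
  rcases le_total (S.r u v) (S.retTime u v) with h | h
  · rw [min_eq_left h]
    nlinarith [mul_pos e1 hZ0, mul_pos e2 hZ0, mul_pos e3 m1, mul_pos e1 m1]
  · rw [min_eq_right h]
    nlinarith [mul_pos e1 hZ0, mul_pos e2 hZ0, mul_pos e3 m2, mul_pos e2 m2]

/-- One round of the bootstrap. The energy bound improves first; it improves `r φ` up to the curve
`r = (v / 2)^(2s)`, and from there outward the growth of `r φ` is only `y^(-a) r^(-1/2) ~ y^(-a -
s)` plus the admissible tail. -/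
theorem exists_decay (hd : S.Decay R (2 * s) a C) (hs : 0 < s) (hs' : 20 * s ≤ 1)
    (ha : 0 ≤ a) (ha' : a ≤ S.ω - 5 * s) (hb : 0 ≤ b) (hba : b ≤ a + s) (hb' : b ≤ S.ω - 5 * s) :
    ∃ C', S.Decay R (2 * s) b C' := by
  have hK := hB.K_pos
  have hK1 := hB.one_le_K
  have hC := hd.pos
  obtain ⟨A, hA, hE⟩ := hB.exists_energy_le hd hs hs' ha ha' hb hba hb'
  obtain ⟨D, hD, V, hV1, hV⟩ := hB.exists_abs_r_mul_φ_le hd hs hs' ha hb hba hb' hA hE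
  obtain ⟨B, hB0, hgrow⟩ := hB.exists_abs_r_mul_φ_sub_le hd ha
  have h2s : 0 < 2 * s := by positivity
  obtain ⟨V', hV'⟩ : ∃ V' : ℝ, ∀ v ≥ V', R ≤ (v / 2) ^ (2 * s) :=
    eventually_atTop.1 (((tendsto_rpow_atTop h2s).comp
      (tendsto_id.atTop_div_const two_pos)).eventually_ge_atTop R)
  set W := max V V' with hW
  have hW1 : 1 ≤ W := hV1.trans (le_max_left _ _)
  set k := K * (2 * K) with hk
  have hk0 : 0 < k := by positivity
  set C₁ := C * (k * W) ^ b with hC₁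
  set C₂ := D * (2 * K) ^ b with hC₂
  set C₃ := (D + B * 2 ^ s) * k ^ b with hC₃
  have hC₁0 : 0 < C₁ := by positivity
  have hC₂0 : 0 < C₂ := by positivity
  have hC₃0 : 0 < C₃ := by positivity
  refine ⟨A + (C + B) + C₁ + C₂ + C₃, by positivity, fun u hu v hv hr => ?_,
    fun u hu v hv hr => (hE u hu v hv hr).trans ?_⟩
  swap
  · have : 0 < v := by linarith
    gcongr
    linarith
  have hv0 : 0 < v := by linarith
  have ht1 := S.one_le_retTime hu.1 hu.2 v
  set t := S.retTime u v with ht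
  have ht0 : 0 < t := by linarith
  have hr0 := S.r_pos u v
  set m := min (S.r u v) t * t ^ (-S.ω) with hm
  have hm0 : 0 < m := by positivity
  have htb : 0 < t ^ (-b) := by positivity
  have key : ∀ X Y, 0 ≤ X → 0 ≤ Y → X ≤ C₁ + C₂ + C₃ → Y ≤ C + B →
      X * t ^ (-b) + Y * m ≤ (A + (C + B) + C₁ + C₂ + C₃) * (t ^ (-b) + m) := by
    intro X Y hX hY hX' hY'
    have e1 : X * t ^ (-b) ≤ (A + (C + B) + C₁ + C₂ + C₃) * t ^ (-b) := by
      gcongr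
      linarith
    have e2 : Y * m ≤ (A + (C + B) + C₁ + C₂ + C₃) * m := by
      gcongr
      linarith
    linarith
  obtain ⟨w, hw, hrw⟩ := hB.exists_r_eq hu hv hr
  -- A ray that crosses `r = R` before time `W` has bounded retarded time, so `t^(-b)` is bounded
  -- below on it and the old estimate is enough.
  rcases le_or_gt w W with hwW | hwW
  · have h1 : t ≤ k * W * 1 := by
      calc t ≤ K * S.retTime u w := hB.retTime_le u hu w hw.1 v hw.2 hrw.ge
        _ ≤ K * (2 * K * w) := mul_le_mul_of_nonneg_left (hB.retTime_le_mul hw.1) hK.le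
        _ = k * w := by rw [hk]; ring
        _ ≤ k * W * 1 := by rw [mul_one]; gcongr
    have h2 : 1 ≤ (k * W) ^ b * t ^ (-b) := by
      rw [Real.rpow_neg ht0.le, ← div_eq_mul_inv, one_le_div (by positivity)]
      rw [mul_one] at h1
      gcongr
    have h3 : t ^ (-a) ≤ 1 := Real.rpow_le_one_of_one_le_of_nonpos ht1 (by linarith)
    refine (hd.field u hu v hv hr).trans (le_trans ?_ (key C₁ C hC₁0.le hC.le (by linarith)
      (by linarith)))
    have h4 := mul_le_mul_of_nonneg_left (h3.trans h2) hC.le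
    rw [← ht, ← hm, mul_add, hC₁, mul_assoc]
    linarith
  have hvW : W ≤ v := hwW.le.trans hw.2
  rcases le_or_gt (S.r u v) ((v / 2) ^ (2 * s)) with hrv | hrv
  · have h1 := hV u hu v ((le_max_left _ _).trans hvW) hr hrv
    have h2 := rpow_neg_le_of_le_mul ht0 (by positivity) (hB.retTime_le_mul hv : t ≤ 2 * K * v) hb
    refine le_trans ?_ (key C₂ 0 hC₂0.le le_rfl (by linarith) (by positivity))
    rw [zero_mul, add_zero, hC₂, mul_assoc]
    exact h1.trans (by gcongr)
  -- Beyond the curve, go back along the outgoing ray to the time `y` at which it crosses the curve.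
  · obtain ⟨y, hy, hfy⟩ := exists_v_eq (f := fun x => S.r u x - (x / 2) ^ (2 * s)) (y := 0)
      ((continuous_right S.continuous_r u).sub ((continuous_id.div_const 2).rpow_const
        fun x => Or.inr h2s.le)) hw.2 (by
          have := hV' w ((le_max_right _ _).trans hwW.le)
          linarith) (by linarith)
    have hry : S.r u y = (y / 2) ^ (2 * s) := by linarith
    have hyW : W ≤ y := hwW.le.trans hy.1
    have hy1 : 1 ≤ y := hw.1.trans hy.1
    have hy0 : 0 < y := by linarith
    have hRy : R ≤ S.r u y := hrw.ge.trans (S.r_mono hw.1 hy.1 u)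
    have h1 := hV u hu y ((le_max_left _ _).trans hyW) hRy hry.le
    have h2 := hgrow u hu y hy1 v hy.2 hRy
    rw [← ht, ← hm, hry, ← Real.rpow_mul (by positivity)] at h2
    have h3 : (y / 2) ^ (2 * s * -(1 / 2)) = 2 ^ s * y ^ (-s) := by
      rw [show 2 * s * -(1 / 2) = -s by ring, Real.div_rpow hy0.le two_pos.le,
        Real.rpow_neg two_pos.le, div_inv_eq_mul, mul_comm]
    have h4 : y ^ (-a) * (2 ^ s * y ^ (-s)) ≤ 2 ^ s * y ^ (-b) := by
      calc _ = 2 ^ s * (y ^ (-a) * y ^ (-s)) := by ring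
        _ = 2 ^ s * y ^ (-a + -s) := by rw [Real.rpow_add hy0]
        _ ≤ _ := by
          gcongr 2 ^ s * ?_
          exact rpow_le_of_exponent_le hy1 (by linarith)
    rw [h3] at h2
    rw [hry] at h1
    have h5 : t ≤ k * y := by
      rw [hk, mul_assoc]
      exact (hB.retTime_le u hu y hy1 v hy.2 hRy).trans
        (mul_le_mul_of_nonneg_left (hB.retTime_le_mul hy1) hK.le)
    have h6 := rpow_neg_le_of_le_mul ht0 hk0 h5 hb
    have h7 : |S.r u v * S.φ u v| ≤
        |S.r u v * S.φ u v - (y / 2) ^ (2 * s) * S.φ u y| + |(y / 2) ^ (2 * s) * S.φ u y| := by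
      have := abs_add_le (S.r u v * S.φ u v - S.r u y * S.φ u y) (S.r u y * S.φ u y)
      rwa [sub_add_cancel, hry] at this
    refine le_trans ?_ (key C₃ B hC₃0.le hB0.le (by linarith) (by linarith))
    calc |S.r u v * S.φ u v| ≤ B * (y ^ (-a) * (2 ^ s * y ^ (-s)) + m) + D * y ^ (-b) := by
          linarith
      _ ≤ B * (2 ^ s * y ^ (-b) + m) + D * y ^ (-b) := by gcongr
      _ = (D + B * 2 ^ s) * y ^ (-b) + B * m := by ring
      _ ≤ (D + B * 2 ^ s) * (k ^ b * t ^ (-b)) + B * m := by gcongr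
      _ = _ := by rw [hC₃]; ring

/-- Each round gains `s` until the ceiling `ω - 5s`, so `n` rounds suffice once `n s` exceeds it. -/
theorem exists_decay_sub (hs : 0 < s) (hs' : 20 * s ≤ 1) :
    ∃ C, S.Decay R (2 * s) (S.ω - 5 * s) C := by
  have hω := S.one_lt_ω
  have h : ∀ n : ℕ, ∃ C, S.Decay R (2 * s) (min (n * s) (S.ω - 5 * s)) C := by
    intro n
    induction n with
    | zero =>
      rw [Nat.cast_zero, zero_mul, min_eq_left (by linarith)]
      exact hB.exists_decay_zero _
    | succ n ih =>
      obtain ⟨C, hC⟩ := ih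
      refine hB.exists_decay hC hs hs' (le_min (by positivity) (by linarith)) (min_le_right _ _)
        (le_min (by positivity) (by linarith)) ?_ (min_le_right _ _)
      rw [← min_add_add_right]
      push_cast
      apply min_le_min <;> linarith
  obtain ⟨n, hn⟩ := exists_nat_ge ((S.ω - 5 * s) / s)
  have := h n
  rwa [min_eq_right ((div_le_iff₀ hs).1 hn)] at this

end Bounds

end NormalizedSolution

/-! ### The decay estimates up to the horizon. -/

namespace NormalizedSolution

/-- Decay of the scalar field and of its derivatives in the region `r ≤ δ v`. -/
theorem exists_abs_le (S : NormalizedSolution) {ε : ℝ} (hε : 0 < ε) :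
    ∃ C > 0, ∃ δ > 0, ∀ u ∈ Icc 1 S.U, ∀ v ≥ 1, S.r u v ≤ δ * v →
      |S.φ u v| ≤ C * (v ^ (-(S.ω - ε)) * (S.r u v)⁻¹ + v ^ (-S.ω)) ∧
      |S.theta u v| ≤ C * (v ^ (-(S.ω - ε)) * (S.r u v)⁻¹ + v ^ (-S.ω)) ∧
      |S.φ u v * S.lam u v + S.theta u v| ≤
        C * (v ^ (-(S.ω - ε)) * (S.r u v)⁻¹ + v ^ (-S.ω)) := by
  obtain ⟨R, v₀, c, K, hB⟩ := S.exists_bounds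
  have hc := hB.c_pos
  have hK := hB.K_pos
  have hR := hB.R_pos
  have hω := S.one_lt_ω
  -- The final exponent is `ω - 5s`, so `5 s ≤ ε` is the admissible loss; `20 s ≤ 1` keeps `v^(10s)`
  -- well below `v`.
  set s := min (ε / 5) (1 / 20) with hs
  have hs0 : 0 < s := lt_min (by positivity) (by norm_num)
  have hsε : 5 * s ≤ ε := by linarith [min_le_left (ε / 5) (1 / 20)]
  have hs1 : 20 * s ≤ 1 := by linarith [min_le_right (ε / 5) (1 / 20)]
  obtain ⟨C, hd⟩ := hB.exists_decay_sub hs0 hs1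
  have hC := hd.pos
  set a := S.ω - 5 * s with ha
  obtain ⟨A, hA, hfar⟩ := hB.exists_abs_le_of_r_le hd (by linarith)
  obtain ⟨V, hV⟩ : ∃ V : ℝ, ∀ v ≥ V, R ≤ v ^ (2 * s) ∧ R ≤ c / 2 * v := by
    rw [← eventually_atTop]
    have h2s : 0 < 2 * s := by positivity
    filter_upwards [(tendsto_rpow_atTop h2s).eventually_ge_atTop R,
      eventually_ge_atTop (R / (c / 2))] with v h1 h2
    exact ⟨h1, (div_le_iff₀' (by positivity)).1 h2⟩
  obtain ⟨B₁, hB₁, hφ⟩ := exists_bound_of_continuous S.continuous_φ 1 S.U 1 V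
  obtain ⟨B₂, hB₂, hθ⟩ := exists_bound_of_continuous S.continuous_theta 1 S.U 1 V
  set D := A + (K + 1) * (C * R + 1) + (B₁ + B₂) * (max V 1) ^ S.ω with hD
  have hD0 : 0 < D := by positivity
  have main : ∀ u ∈ Icc 1 S.U, ∀ v ≥ 1, S.r u v ≤ c / 2 * v →
      |S.φ u v| ≤ D * (v ^ (-a) * (S.r u v)⁻¹ + v ^ (-S.ω)) ∧
      |S.theta u v| ≤ D * (v ^ (-a) * (S.r u v)⁻¹ + v ^ (-S.ω)) := by
    intro u hu v hv hrv
    have hv0 : 0 < v := by linarith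
    have hr0 := S.r_pos u v
    set Z := v ^ (-a) * (S.r u v)⁻¹ + v ^ (-S.ω) with hZ
    have hZ0 : 0 < Z := by positivity
    have e1 : 0 < A * Z := by positivity
    have e2 : 0 < K * ((C * R + 1) * Z) := by positivity
    have e3 : 0 < (C * R + 1) * Z := by positivity
    have e4 : 0 < B₁ * ((max V 1) ^ S.ω * Z) := by positivity
    have e5 : 0 < B₂ * ((max V 1) ^ S.ω * Z) := by positivity
    have hDZ : D * Z = A * Z + K * ((C * R + 1) * Z) + (C * R + 1) * Z +
        B₁ * ((max V 1) ^ S.ω * Z) + B₂ * ((max V 1) ^ S.ω * Z) := by rw [hD]; ring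
    rcases le_total R (S.r u v) with hr | hr
    · obtain ⟨h1, -, h3⟩ := hfar u hu v hv hr hrv
      constructor <;> linarith
    rcases le_total V v with hvV | hvV
    · obtain ⟨hRv, hRc⟩ := hV v hvV
      obtain ⟨u₁, hu₁, hru₁⟩ := hB.exists_u_r_eq_rpow hv le_rfl (hRc.trans (by
        gcongr
        linarith))
      have hu₁u : u₁ ≤ u := S.le_of_r_le hu.1 hu₁.2 (hr.trans hru₁.ge)
      obtain ⟨h1, -, h3⟩ := hfar u₁ hu₁ v hv hru₁.ge (hru₁.le.trans hRc)
      rw [hru₁] at h1 h3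
      have h4 : A * (v ^ (-a) * R⁻¹ + v ^ (-S.ω)) ≤ A * Z := by rw [hZ]; gcongr
      -- Integration inward from `r = R` with weight `η = v^a`. The energy contributes `v^(-a)`
      -- without `1 / r`, but `1 ≤ R / r` here.
      have h5 : v ^ a * S.ingoingEnergy u₁ u v + (v ^ a)⁻¹ * (S.r u v)⁻¹ ≤ (C * R + 1) * Z := by
        have h6 : S.ingoingEnergy u₁ u v ≤ C * v ^ (-(2 * a)) :=
          (S.ingoingEnergy_mono_right u₁ hu.2 v).trans
            (hd.energy u₁ hu₁ v hv (hru₁.le.trans hRv))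
        have h7 : (1 : ℝ) ≤ R * (S.r u v)⁻¹ := by
          rwa [← div_eq_mul_inv, one_le_div hr0]
        calc _ ≤ v ^ a * (C * v ^ (-(2 * a))) + (v ^ a)⁻¹ * (S.r u v)⁻¹ := by gcongr
          _ = C * (v ^ (-a) * 1) + v ^ (-a) * (S.r u v)⁻¹ := by
            rw [mul_left_comm, ← Real.rpow_add hv0, ← Real.rpow_neg hv0.le]
            ring_nf
          _ ≤ C * (v ^ (-a) * (R * (S.r u v)⁻¹)) + v ^ (-a) * (S.r u v)⁻¹ := by gcongr
          _ = (C * R + 1) * (v ^ (-a) * (S.r u v)⁻¹) := by ring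
          _ ≤ _ := by
            gcongr
            rw [hZ]
            have : 0 < v ^ (-S.ω) := by positivity
            linarith
      have h6 := S.abs_sub_le_of_abs_deriv_le (f := fun u => S.φ u v) (L := 1)
        (η := v ^ a) (v := v) zero_le_one (by positivity) hu₁.1 hu₁u hu.2
        (by fun_prop) (fun u hu => S.du_φ u hu v)
        (fun u hu => by rw [abs_div, abs_of_pos (S.r_pos u v), one_mul])
      have h7 := S.abs_sub_le_of_abs_deriv_le (f := fun u => S.theta u v) (L := K)
        (η := v ^ a) (v := v) hK.le (by positivity) hu₁.1 hu₁u hu.2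
        (by fun_prop) (fun u hu => S.du_theta u hu v)
        (fun x hx => by
          have h8 := hB.lam_le x ⟨hu₁.1.trans hx.1.le, hx.2.le.trans hu.2⟩ v hv
          have h9 := S.r_pos x v
          rw [abs_div, abs_of_pos h9, abs_neg, abs_mul, abs_of_nonneg (S.lam_nonneg x v),
            mul_comm |S.zeta x v|, mul_div_assoc]
          gcongr)
      have h8 : |S.φ u v| ≤ |S.φ u v - S.φ u₁ v| + |S.φ u₁ v| := by
        have := abs_add_le (S.φ u v - S.φ u₁ v) (S.φ u₁ v)
        rwa [sub_add_cancel] at this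
      have h9 : |S.theta u v| ≤ |S.theta u v - S.theta u₁ v| + |S.theta u₁ v| := by
        have := abs_add_le (S.theta u v - S.theta u₁ v) (S.theta u₁ v)
        rwa [sub_add_cancel] at this
      have h10 := mul_le_mul_of_nonneg_left h5 hK.le
      constructor <;> linarith
    -- For bounded `v` the fields are bounded by compactness, the horizon included, and `v^(-ω)` is
    -- bounded below.
    · have h1 := hφ u hu v ⟨hv, hvV⟩
      have h2 := hθ u hu v ⟨hv, hvV⟩
      have h3 : 1 ≤ (max V 1) ^ S.ω * Z := by
        have h4 : 1 ≤ (max V 1) ^ S.ω * v ^ (-S.ω) := by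
          have := hvV.trans (le_max_left V 1)
          rw [Real.rpow_neg hv0.le, ← div_eq_mul_inv, one_le_div (by positivity)]
          gcongr
        refine h4.trans ?_
        gcongr
        rw [hZ]
        have : 0 < v ^ (-a) * (S.r u v)⁻¹ := by positivity
        linarith
      have h5 := le_mul_of_one_le_right hB₁.le h3
      have h6 := le_mul_of_one_le_right hB₂.le h3
      constructor <;> linarith
  refine ⟨(K + 1) * D, by positivity, c / 2, by positivity, fun u hu v hv hrv => ?_⟩
  obtain ⟨h1, h2⟩ := main u hu v hv hrv
  have hv0 : 0 < v := by linarith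
  have hr0 := S.r_pos u v
  have h3 : D * (v ^ (-a) * (S.r u v)⁻¹ + v ^ (-S.ω)) ≤
      D * (v ^ (-(S.ω - ε)) * (S.r u v)⁻¹ + v ^ (-S.ω)) := by
    have := rpow_le_of_exponent_le hv (by linarith : -a ≤ -(S.ω - ε))
    gcongr
  set Y := D * (v ^ (-(S.ω - ε)) * (S.r u v)⁻¹ + v ^ (-S.ω)) with hY
  have hY0 : 0 < Y := by positivity
  have hKY : 0 < K * Y := by positivity
  rw [mul_assoc, ← hY]
  refine ⟨by linarith, by linarith, ?_⟩
  calc _ ≤ |S.φ u v| * S.lam u v + |S.theta u v| := by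
        have := abs_add_le (S.φ u v * S.lam u v) (S.theta u v)
        rwa [abs_mul, abs_of_nonneg (S.lam_nonneg u v)] at this
    _ ≤ Y * K + Y := add_le_add (mul_le_mul (h1.trans h3) (hB.lam_le u hu v hv)
        (S.lam_nonneg u v) hY0.le) (h2.trans h3)
    _ = _ := by ring

end NormalizedSolution

/-! ### Regularity and equations in the given chart. -/

namespace Assumptions

variable {S : Data} {ω : ℝ} (hS : Assumptions S ω) {p : ℝ × ℝ} {u v : ℝ}
include hS

theorem one_mem_uRange : (1 : ℝ) ∈ S.uRange := ⟨le_rfl, hS.one_lt_U₀.le⟩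

theorem one_mem_vRange : (1 : ℝ) ∈ S.vRange := ⟨le_rfl, hS.one_lt_V₀⟩

omit hS in
theorem ordConnected_vRange : S.vRange.OrdConnected :=
  ⟨fun _ hx _ hy _ hz => ⟨hx.1.trans hz.1, (EReal.coe_le_coe_iff.2 hz.2).trans_lt hy.2⟩⟩

omit hS in
theorem isOpen_coe_lt (V : EReal) : IsOpen {v : ℝ | (v : EReal) < V} :=
  isOpen_lt continuous_coe_real_ereal continuous_const

omit hS in
theorem vRange_mem_nhds (hv : v ∈ S.vRange) (h : 1 < v) : S.vRange ∈ 𝓝 v :=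
  mem_of_superset (inter_mem (Ioi_mem_nhds h) ((isOpen_coe_lt S.V₀).mem_nhds hv.2))
    fun _ hx => ⟨le_of_lt hx.1, hx.2⟩

omit hS in
theorem exists_gt_mem_vRange (hv : v ∈ S.vRange) : ∃ v' ∈ S.vRange, v < v' := by
  obtain ⟨q, hq, hq'⟩ := EReal.lt_iff_exists_real_btwn.1 hv.2
  exact ⟨q, ⟨hv.1.trans (EReal.coe_lt_coe_iff.1 hq).le, hq'⟩, EReal.coe_lt_coe_iff.1 hq⟩

theorem interior_vRange_nonempty : (interior S.vRange).Nonempty := by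
  obtain ⟨v, hv, h⟩ := exists_gt_mem_vRange hS.one_mem_vRange
  exact ⟨v, mem_interior_iff_mem_nhds.2 (vRange_mem_nhds hv h)⟩

theorem uniqueDiffOn_vRange : UniqueDiffOn ℝ S.vRange :=
  uniqueDiffOn_convex ordConnected_vRange.convex hS.interior_vRange_nonempty

theorem uniqueDiffOn_uRange : UniqueDiffOn ℝ S.uRange := uniqueDiffOn_Icc hS.one_lt_U₀

theorem uniqueDiffOn_dom : UniqueDiffOn ℝ S.dom :=
  hS.uniqueDiffOn_uRange.prod hS.uniqueDiffOn_vRange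

theorem mem_closure_interior (hp : p ∈ S.dom) : p ∈ closure (interior S.dom) := by
  have hc : Convex ℝ S.dom := (convex_Icc 1 S.U₀).prod ordConnected_vRange.convex
  rw [hc.closure_interior_eq_closure_of_nonempty_interior]
  · exact subset_closure hp
  · rw [Data.dom, interior_prod_eq, Data.uRange, interior_Icc]
    exact (nonempty_Ioo.2 hS.one_lt_U₀).prod hS.interior_vRange_nonempty

omit hS in
theorem hasDerivWithinAt_left {E : Type*} [NormedAddCommGroup E] [NormedSpace ℝ E]
    {F : ℝ × ℝ → E} (hF : DifferentiableWithinAt ℝ F S.dom p) (hp : p ∈ S.dom) :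
    HasDerivWithinAt (fun u => F (u, p.2)) (fderivWithin ℝ F S.dom p (1, 0)) S.uRange p.1 :=
  hF.hasFDerivWithinAt.comp_hasDerivWithinAt (f := fun u => (u, p.2)) p.1
    ((hasDerivWithinAt_id _ _).prodMk (hasDerivWithinAt_const _ _ _)) fun _ hx => ⟨hx, hp.2⟩

omit hS in
theorem hasDerivWithinAt_right {E : Type*} [NormedAddCommGroup E] [NormedSpace ℝ E]
    {F : ℝ × ℝ → E} (hF : DifferentiableWithinAt ℝ F S.dom p) (hp : p ∈ S.dom) :
    HasDerivWithinAt (fun v => F (p.1, v)) (fderivWithin ℝ F S.dom p (0, 1)) S.vRange p.2 :=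
  hF.hasFDerivWithinAt.comp_hasDerivWithinAt (f := fun v => (p.1, v)) p.2
    ((hasDerivWithinAt_const _ _ _).prodMk (hasDerivWithinAt_id _ _)) fun _ hx => ⟨hp.1, hx⟩

theorem du_eq {F : ℝ × ℝ → ℝ} (hF : DifferentiableWithinAt ℝ F S.dom p) (hp : p ∈ S.dom) :
    S.du F p = fderivWithin ℝ F S.dom p (1, 0) :=
  (hasDerivWithinAt_left hF hp).derivWithin (hS.uniqueDiffOn_uRange _ hp.1)

theorem dv_eq {F : ℝ × ℝ → ℝ} (hF : DifferentiableWithinAt ℝ F S.dom p) (hp : p ∈ S.dom) :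
    S.dv F p = fderivWithin ℝ F S.dom p (0, 1) :=
  (hasDerivWithinAt_right hF hp).derivWithin (hS.uniqueDiffOn_vRange _ hp.2)

theorem differentiableOn_r : DifferentiableOn ℝ S.r S.dom :=
  hS.contDiffOn_r.differentiableOn (by norm_num)

theorem differentiableOn_φ : DifferentiableOn ℝ S.φ S.dom :=
  hS.contDiffOn_φ.differentiableOn (by norm_num)

theorem contDiffOn_fderivWithin_r : ContDiffOn ℝ 1 (fderivWithin ℝ S.r S.dom) S.dom :=
  hS.contDiffOn_r.fderivWithin hS.uniqueDiffOn_dom (by norm_num)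

theorem nu_eq (hp : p ∈ S.dom) : S.nu p = fderivWithin ℝ S.r S.dom p (1, 0) :=
  hS.du_eq (hS.differentiableOn_r p hp) hp

theorem lam_eq_fderivWithin (hp : p ∈ S.dom) : S.lam p = fderivWithin ℝ S.r S.dom p (0, 1) :=
  hS.dv_eq (hS.differentiableOn_r p hp) hp

theorem du_r (hp : p ∈ S.dom) :
    HasDerivWithinAt (fun u => S.r (u, p.2)) (S.nu p) S.uRange p.1 := by
  rw [hS.nu_eq hp]
  exact hasDerivWithinAt_left (hS.differentiableOn_r p hp) hp

theorem dv_r (hp : p ∈ S.dom) :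
    HasDerivWithinAt (fun v => S.r (p.1, v)) (S.lam p) S.vRange p.2 := by
  rw [hS.lam_eq_fderivWithin hp]
  exact hasDerivWithinAt_right (hS.differentiableOn_r p hp) hp

theorem du_φ (hp : p ∈ S.dom) :
    HasDerivWithinAt (fun u => S.φ (u, p.2)) (S.zeta p / S.r p) S.uRange p.1 := by
  rw [Data.zeta, mul_div_cancel_left₀ _ (hS.r_pos p hp).ne',
    hS.du_eq (hS.differentiableOn_φ p hp) hp]
  exact hasDerivWithinAt_left (hS.differentiableOn_φ p hp) hp

theorem dv_φ (hp : p ∈ S.dom) :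
    HasDerivWithinAt (fun v => S.φ (p.1, v)) (S.theta p / S.r p) S.vRange p.2 := by
  rw [Data.theta, mul_div_cancel_left₀ _ (hS.r_pos p hp).ne',
    hS.dv_eq (hS.differentiableOn_φ p hp) hp]
  exact hasDerivWithinAt_right (hS.differentiableOn_φ p hp) hp

theorem continuousOn_r : ContinuousOn S.r S.dom := hS.contDiffOn_r.continuousOn

theorem continuousOn_φ : ContinuousOn S.φ S.dom := hS.contDiffOn_φ.continuousOn

theorem continuousOn_nu : ContinuousOn S.nu S.dom :=
  (hS.contDiffOn_fderivWithin_r.continuousOn.clm_apply continuousOn_const).congr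
    fun _ hp => hS.nu_eq hp

theorem continuousOn_lam : ContinuousOn S.lam S.dom :=
  (hS.contDiffOn_fderivWithin_r.continuousOn.clm_apply continuousOn_const).congr
    fun _ hp => hS.lam_eq_fderivWithin hp

theorem continuousOn_zeta : ContinuousOn S.zeta S.dom :=
  hS.continuousOn_r.mul (((hS.contDiffOn_φ.continuousOn_fderivWithin hS.uniqueDiffOn_dom
    (by norm_num)).clm_apply continuousOn_const).congr
      fun p hp => hS.du_eq (hS.differentiableOn_φ p hp) hp)

theorem continuousOn_theta : ContinuousOn S.theta S.dom :=
  hS.continuousOn_r.mul (((hS.contDiffOn_φ.continuousOn_fderivWithin hS.uniqueDiffOn_dom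
    (by norm_num)).clm_apply continuousOn_const).congr
      fun p hp => hS.dv_eq (hS.differentiableOn_φ p hp) hp)

theorem continuousOn_kappa : ContinuousOn S.kappa S.dom :=
  (continuousOn_const.mul (hS.contDiffOn_Ω.continuousOn.pow 2)).mul
    (hS.continuousOn_nu.inv₀ fun p hp => (hS.nu_neg p hp).ne)

theorem kappa_pos (hp : p ∈ S.dom) : 0 < S.kappa p := by
  have h1 := hS.Ω_pos p hp
  have h2 := inv_lt_zero.2 (hS.nu_neg p hp)
  unfold Data.kappa
  have : 0 < S.Ω p ^ 2 * -(S.nu p)⁻¹ := mul_pos (by positivity) (neg_pos.2 h2)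
  linarith

theorem gradRSq_eq (hp : p ∈ S.dom) : S.gradRSq p = -4 / S.Ω p ^ 2 * S.nu p * S.lam p := by
  have h1 := (hS.Ω_pos p hp).ne'
  have hinv : (S.metric p)⁻¹ = !![0, -(2 / S.Ω p ^ 2); -(2 / S.Ω p ^ 2), 0] := by
    apply Matrix.inv_eq_right_inv
    ext i j
    fin_cases i <;> fin_cases j <;> simp [Data.metric, Matrix.mul_apply, Fin.sum_univ_two] <;>
      field_simp
  rw [Data.gradRSq, Data.gradR, hinv]
  simp only [Data.metric, Matrix.mulVec, dotProduct,
    Fin.sum_univ_two, Matrix.of_apply, Matrix.cons_val', Matrix.cons_val_zero,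
    Matrix.cons_val_one, Matrix.cons_val_fin_one]
  field_simp
  ring

theorem mu_eq (hp : p ∈ S.dom) :
    S.mu p = 2 * S.varpi p / S.r p - S.e ^ 2 / S.r p ^ 2 := by
  have := (hS.r_pos p hp).ne'
  unfold Data.mu Data.varpi
  field_simp
  ring

/-- Both `1 - μ` and `-4 ν λ / Ω²` are `g(∇r, ∇r)`, and `κ = -Ω² / (4 ν)`. -/
theorem lam_eq (hp : p ∈ S.dom) :
    S.lam p = S.kappa p * (1 - 2 * S.varpi p / S.r p + S.e ^ 2 / S.r p ^ 2) := by
  have h1 := (hS.r_pos p hp).ne'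
  have h2 := (hS.Ω_pos p hp).ne'
  have h3 := (hS.nu_neg p hp).ne
  have h4 : 1 - 2 * S.varpi p / S.r p + S.e ^ 2 / S.r p ^ 2 = S.gradRSq p := by
    have := hS.mu_eq hp
    have h5 : S.mu p = 1 - S.gradRSq p := by
      unfold Data.mu Data.mass
      field_simp
    linarith
  rw [h4, hS.gradRSq_eq hp, Data.kappa]
  field_simp

theorem continuousOn_varpi : ContinuousOn S.varpi S.dom := by
  have h1 : ContinuousOn S.gradRSq S.dom := (((continuousOn_const.div
    (hS.contDiffOn_Ω.continuousOn.pow 2) fun p hp => pow_ne_zero 2 (hS.Ω_pos p hp).ne').mul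
    hS.continuousOn_nu).mul hS.continuousOn_lam).congr fun p hp => hS.gradRSq_eq hp
  exact ((hS.continuousOn_r.div_const 2).mul (continuousOn_const.sub h1)).add
    (continuousOn_const.div (continuousOn_const.mul hS.continuousOn_r)
      fun p hp => mul_ne_zero two_ne_zero (hS.r_pos p hp).ne')

theorem du_varpi' (hp : p ∈ S.dom) : HasDerivWithinAt (fun u => S.varpi (u, p.2))
    (1 / 2 * (1 - 2 * S.varpi p / S.r p + S.e ^ 2 / S.r p ^ 2) * (S.zeta p / S.nu p) ^ 2 * S.nu p)
    S.uRange p.1 := by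
  have h := hS.du_varpi p hp
  rwa [hS.mu_eq hp, ← sub_add] at h

/-- Differentiate `λ = κ (1 - μ)`: the terms in `ζ²` from `∂_u κ` and `∂_u ϖ` cancel. -/
theorem du_lam (hp : p ∈ S.dom) : HasDerivWithinAt (fun u => S.lam (u, p.2))
    (2 * S.nu p * S.kappa p / S.r p ^ 2 * (S.varpi p - S.e ^ 2 / S.r p)) S.uRange p.1 := by
  have h1 := (hS.r_pos p hp).ne'
  have h3 := (hS.nu_neg p hp).ne
  refine (((hS.du_kappa p hp).mul ((((hS.du_varpi' hp).const_mul 2).div (hS.du_r hp)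
    h1).const_sub 1 |>.add ((hasDerivWithinAt_const _ _ (S.e ^ 2)).div ((hS.du_r hp).pow 2)
      (pow_ne_zero 2 h1)))).congr_deriv ?_).congr_of_mem (fun x hx => hS.lam_eq ⟨hx, hp.2⟩) hp.1
  simp only [Prod.mk.eta, Pi.pow_apply, Pi.add_apply, Pi.div_apply]
  field_simp
  ring

/-- Not among the assumed equations: it is `∂_u λ` by symmetry of the second derivative of the `C²`
function `r`, valid up to the edges as `𝒟` lies in the closure of its interior. -/
theorem dv_nu (hp : p ∈ S.dom) : HasDerivWithinAt (fun v => S.nu (p.1, v))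
    (2 * S.nu p * S.kappa p / S.r p ^ 2 * (S.varpi p - S.e ^ 2 / S.r p)) S.vRange p.2 := by
  have hd := (hS.contDiffOn_fderivWithin_r.differentiableOn (by norm_num)) p hp
  have h1 : HasDerivWithinAt (fun u => S.lam (u, p.2))
      (fderivWithin ℝ (fderivWithin ℝ S.r S.dom) S.dom p (1, 0) (0, 1)) S.uRange p.1 :=
    ((hasDerivWithinAt_left hd hp).clm_apply (hasDerivWithinAt_const _ _ ((0 : ℝ), (1 : ℝ)))
      |>.congr_deriv (by simp)).congr_of_mem
      (fun x hx => hS.lam_eq_fderivWithin ⟨hx, hp.2⟩) hp.1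
  have h2 : HasDerivWithinAt (fun v => S.nu (p.1, v))
      (fderivWithin ℝ (fderivWithin ℝ S.r S.dom) S.dom p (0, 1) (1, 0)) S.vRange p.2 :=
    ((hasDerivWithinAt_right hd hp).clm_apply (hasDerivWithinAt_const _ _ ((1 : ℝ), (0 : ℝ)))
      |>.congr_deriv (by simp)).congr_of_mem (fun x hx => hS.nu_eq ⟨hp.1, hx⟩) hp.2
  have h3 : IsSymmSndFDerivWithinAt ℝ S.r S.dom p :=
    (hS.contDiffOn_r p hp).isSymmSndFDerivWithinAt
      (by rw [minSmoothness_of_isRCLikeNormedField]) hS.uniqueDiffOn_dom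
      (hS.mem_closure_interior hp) hp
  rw [(hS.uniqueDiffOn_uRange _ hp.1).eq_deriv _ (hS.du_lam hp) h1, h3 (1, 0) (0, 1)]
  exact h2

end Assumptions

/-! ### The change of advanced time. -/

namespace Data

/-- The coordinate `v` as a function of the normalized advanced time, constant before time `1`. -/
def ofAdvTime (S : Data) (w : ℝ) : ℝ :=
  Function.invFunOn S.advTime S.vRange (max 1 w)

/-- The point of `𝒟` with given retarded coordinate and normalized advanced time, both truncated
to their ranges. -/
def point (S : Data) (u w : ℝ) : ℝ × ℝ := (max 1 (min u S.U₀), S.ofAdvTime w)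

end Data

namespace Assumptions

variable {S : Data} {ω : ℝ} (hS : Assumptions S ω) {u v v₁ v₂ w : ℝ}
include hS

theorem continuousOn_one {f : ℝ × ℝ → ℝ} (hf : ContinuousOn f S.dom) :
    ContinuousOn (fun v => f (1, v)) S.vRange :=
  hf.comp (Continuous.continuousOn (by fun_prop)) fun _ hv => ⟨hS.one_mem_uRange, hv⟩

theorem kappa_one_pos (hv : v ∈ S.vRange) : 0 < S.kappa (1, v) :=
  hS.kappa_pos ⟨hS.one_mem_uRange, hv⟩

omit hS in
theorem Icc_subset_vRange (hv₁ : v₁ ∈ S.vRange) (hv₂ : v₂ ∈ S.vRange) : Icc v₁ v₂ ⊆ S.vRange :=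
  ordConnected_vRange.out hv₁ hv₂

theorem hasDerivAt_advTime (hv : v ∈ S.vRange) (h : 1 < v) :
    HasDerivAt S.advTime (S.kappa (1, v)) v := by
  have hc := hS.continuousOn_one hS.continuousOn_kappa
  have hn := mem_interior_iff_mem_nhds.2 (vRange_mem_nhds hv h)
  refine (intervalIntegral.integral_hasDerivAt_right ?_ ?_ ?_).const_add 1
  · exact (hc.mono (Icc_subset_vRange hS.one_mem_vRange hv)).intervalIntegrable_of_Icc hv.1
  · exact (hc.mono interior_subset).stronglyMeasurableAtFilter isOpen_interior v hn
  · exact hc.continuousAt (vRange_mem_nhds hv h)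

theorem continuousOn_advTime : ContinuousOn S.advTime S.vRange := by
  intro v hv
  obtain ⟨b, hb, hvb⟩ := exists_gt_mem_vRange hv
  have h1b : 1 ≤ b := hb.1
  have hc := (hS.continuousOn_one hS.continuousOn_kappa).mono
    (Icc_subset_vRange hS.one_mem_vRange hb)
  have h1 : ContinuousOn S.advTime (Icc 1 b) := by
    rw [← uIcc_of_le h1b] at hc ⊢
    exact continuousOn_const.add (intervalIntegral.continuousOn_primitive_interval
      (hc.integrableOn_compact isCompact_uIcc))
  refine (h1 v ⟨hv.1, hvb.le⟩).mono_of_mem_nhdsWithin ?_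
  filter_upwards [self_mem_nhdsWithin, mem_nhdsWithin_of_mem_nhds (Iio_mem_nhds hvb)] with x hx hxb
  exact ⟨hx.1, le_of_lt hxb⟩

theorem strictMonoOn_advTime : StrictMonoOn S.advTime S.vRange := by
  refine strictMonoOn_of_deriv_pos ordConnected_vRange.convex hS.continuousOn_advTime fun x hx => ?_
  have hxm := interior_subset hx
  have h1 : 1 < x := by
    have : S.vRange ⊆ Ici 1 := fun _ h => h.1
    have := interior_mono this hx
    rwa [interior_Ici] at this
  rw [(hS.hasDerivAt_advTime hxm h1).deriv]
  exact hS.kappa_one_pos hxm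

omit hS in
theorem advTime_one : S.advTime 1 = 1 := by simp [Data.advTime]

omit hS in
theorem hasDerivAt_of_mem {f : ℝ → ℝ} {f' : ℝ} (hv₁ : v₁ ∈ S.vRange) (hv₂ : v₂ ∈ S.vRange)
    (hv : v ∈ Ioo v₁ v₂) (h : HasDerivWithinAt f f' S.vRange v) : HasDerivAt f f' v :=
  h.hasDerivAt (vRange_mem_nhds (Icc_subset_vRange hv₁ hv₂ ⟨hv.1.le, hv.2.le⟩)
    (hv₁.1.trans_lt hv.1))

theorem r_one_le_r (hv : v ∈ S.vRange) : S.r (1, 1) ≤ S.r (1, v) := by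
  have hsub := Icc_subset_vRange hS.one_mem_vRange hv
  have hm : ∀ x ∈ Ioo 1 v, (1, x) ∈ S.dom := fun x hx =>
    ⟨hS.one_mem_uRange, hsub ⟨hx.1.le, hx.2.le⟩⟩
  exact monotoneOn_of_hasDerivAt_nonneg hv.1 ((hS.continuousOn_one hS.continuousOn_r).mono hsub)
    (fun x hx => hasDerivAt_of_mem hS.one_mem_vRange hv hx (hS.dv_r (hm x hx)))
    (fun x hx => hS.lam_nonneg _ (hm x hx))

theorem varpi_one_le_varpi (hv : v ∈ S.vRange) : S.varpi (1, 1) ≤ S.varpi (1, v) := by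
  have hsub := Icc_subset_vRange hS.one_mem_vRange hv
  have hm : ∀ x ∈ Ioo 1 v, (1, x) ∈ S.dom := fun x hx =>
    ⟨hS.one_mem_uRange, hsub ⟨hx.1.le, hx.2.le⟩⟩
  exact monotoneOn_of_hasDerivAt_nonneg hv.1
    ((hS.continuousOn_one hS.continuousOn_varpi).mono hsub)
    (fun x hx => hasDerivAt_of_mem hS.one_mem_vRange hv hx (hS.dv_varpi _ (hm x hx)))
    (fun x hx => by have := hS.kappa_pos (hm x hx); positivity)

/-- On `u = 1` the quotient `λ / κ = 1 - μ` is bounded above, since `ϖ` and `r` do not decrease. It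
makes `r(1, ·)` grow at most linearly in normalized advanced time, which therefore runs to infinity
with `r`. -/
theorem exists_lam_le : ∃ L > 0, ∀ v ∈ S.vRange, S.lam (1, v) ≤ L * S.kappa (1, v) := by
  have h1 := hS.r_pos (1, 1) ⟨hS.one_mem_uRange, hS.one_mem_vRange⟩
  refine ⟨1 + 2 * |S.varpi (1, 1)| / S.r (1, 1) + S.e ^ 2 / S.r (1, 1) ^ 2, by positivity,
    fun v hv => ?_⟩
  have h2 := hS.r_one_le_r hv
  have h3 := hS.kappa_one_pos hv
  have h4 := hS.varpi_one_le_varpi hv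
  have h5 := h1.trans_le h2
  rw [hS.lam_eq ⟨hS.one_mem_uRange, hv⟩, mul_comm]
  gcongr
  have h6 : -(2 * S.varpi (1, v) / S.r (1, v)) ≤ 2 * |S.varpi (1, 1)| / S.r (1, 1) := by
    rw [← neg_div]
    calc -(2 * S.varpi (1, v)) / S.r (1, v) ≤ 2 * |S.varpi (1, 1)| / S.r (1, v) := by
          gcongr
          linarith [neg_abs_le (S.varpi (1, 1))]
      _ ≤ _ := by gcongr
  have h7 : S.e ^ 2 / S.r (1, v) ^ 2 ≤ S.e ^ 2 / S.r (1, 1) ^ 2 := by gcongr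
  linarith

theorem exists_lt_advTime (B : ℝ) : ∃ v ∈ S.vRange, B < S.advTime v := by
  obtain ⟨L, hL, hlam⟩ := hS.exists_lam_le
  have hub := hS.not_bddAbove_r 1 ⟨le_rfl, hS.one_lt_U₀⟩
  simp only [bddAbove_def, mem_image, forall_exists_index, and_imp, forall_apply_eq_imp_iff₂,
    not_exists, not_forall, not_le] at hub
  obtain ⟨v, hv, hBv⟩ := hub (S.r (1, 1) + L * (B - 1))
  refine ⟨v, hv, ?_⟩
  have hsub := Icc_subset_vRange hS.one_mem_vRange hv
  have hm : ∀ x ∈ Ioo 1 v, x ∈ S.vRange := fun x hx => hsub ⟨hx.1.le, hx.2.le⟩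
  have h := sub_le_sub_of_hasDerivAt_le (f := fun v => S.r (1, v))
    (g := fun v => L * S.advTime v) hv.1 ((hS.continuousOn_one hS.continuousOn_r).mono hsub)
    (continuousOn_const.mul (hS.continuousOn_advTime.mono hsub))
    (fun x hx => hasDerivAt_of_mem hS.one_mem_vRange hv hx
      (hS.dv_r (p := (1, x)) ⟨hS.one_mem_uRange, hm x hx⟩))
    (fun x hx => (hS.hasDerivAt_advTime (hm x hx) hx.1).const_mul L)
    (fun x hx => hlam x (hm x hx))
  rw [advTime_one] at h
  by_contra! hle
  have := mul_le_mul_of_nonneg_left hle hL.le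
  linarith

theorem one_le_advTime (hv : v ∈ S.vRange) : 1 ≤ S.advTime v := by
  have := hS.strictMonoOn_advTime.monotoneOn hS.one_mem_vRange hv hv.1
  rwa [advTime_one] at this

theorem surjOn_advTime : SurjOn S.advTime S.vRange (Ici 1) := by
  intro w hw
  obtain ⟨v, hv, hwv⟩ := hS.exists_lt_advTime w
  obtain ⟨x, hx, he⟩ := intermediate_value_Icc hv.1
    (hS.continuousOn_advTime.mono (Icc_subset_vRange hS.one_mem_vRange hv))
    ⟨advTime_one.trans_le hw, hwv.le⟩
  exact ⟨x, Icc_subset_vRange hS.one_mem_vRange hv hx, he⟩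

theorem ofAdvTime_mem (w : ℝ) : S.ofAdvTime w ∈ S.vRange :=
  Function.invFunOn_mem (hS.surjOn_advTime (le_max_left 1 w))

theorem advTime_ofAdvTime_eq_max (w : ℝ) : S.advTime (S.ofAdvTime w) = max 1 w :=
  Function.invFunOn_eq (hS.surjOn_advTime (le_max_left 1 w))

theorem ofAdvTime_advTime (hv : v ∈ S.vRange) : S.ofAdvTime (S.advTime v) = v := by
  apply hS.strictMonoOn_advTime.injOn (hS.ofAdvTime_mem _) hv
  rw [hS.advTime_ofAdvTime_eq_max, max_eq_right (hS.one_le_advTime hv)]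

/-- A monotone surjection onto an interval is continuous. -/
theorem continuous_ofAdvTime : Continuous S.ofAdvTime := by
  have : S.vRange.OrdConnected := ordConnected_vRange
  have h : Continuous fun w => (⟨S.ofAdvTime w, hS.ofAdvTime_mem w⟩ : S.vRange) := by
    refine Monotone.continuous_of_surjective (fun w₁ w₂ hw => ?_)
      fun v => ⟨S.advTime v, Subtype.ext (hS.ofAdvTime_advTime v.2)⟩
    rw [Subtype.mk_le_mk, ← hS.strictMonoOn_advTime.le_iff_le (hS.ofAdvTime_mem _)
      (hS.ofAdvTime_mem _), hS.advTime_ofAdvTime_eq_max, hS.advTime_ofAdvTime_eq_max]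
    exact max_le_max le_rfl hw
  exact continuous_subtype_val.comp h

theorem one_lt_ofAdvTime (hw : 1 < w) : 1 < S.ofAdvTime w := by
  rw [← hS.strictMonoOn_advTime.lt_iff_lt hS.one_mem_vRange (hS.ofAdvTime_mem _), advTime_one,
    hS.advTime_ofAdvTime_eq_max]
  exact hw.trans_le (le_max_right _ _)

theorem hasDerivAt_ofAdvTime (hw : 1 < w) :
    HasDerivAt S.ofAdvTime (S.kappa (1, S.ofAdvTime w))⁻¹ w := by
  refine HasDerivAt.of_local_left_inverse hS.continuous_ofAdvTime.continuousAt
    (hS.hasDerivAt_advTime (hS.ofAdvTime_mem w) (hS.one_lt_ofAdvTime hw))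
    (hS.kappa_one_pos (hS.ofAdvTime_mem w)).ne' ?_
  filter_upwards [Ioi_mem_nhds hw] with y hy
  rw [hS.advTime_ofAdvTime_eq_max, max_eq_right (le_of_lt hy)]

theorem point_mem (u w : ℝ) : S.point u w ∈ S.dom :=
  ⟨⟨le_max_left _ _, max_le hS.one_lt_U₀.le (min_le_right _ _)⟩, hS.ofAdvTime_mem w⟩

omit hS in
theorem point_of_mem (hu : u ∈ S.uRange) (w : ℝ) : S.point u w = (u, S.ofAdvTime w) := by
  rw [Data.point, min_eq_left hu.2, max_eq_right hu.1]

theorem point_advTime {v : ℝ} (h : (u, v) ∈ S.dom) : S.point u (S.advTime v) = (u, v) := by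
  rw [point_of_mem h.1, hS.ofAdvTime_advTime h.2]

theorem continuous_point : Continuous fun p : ℝ × ℝ => S.point p.1 p.2 := by
  have := hS.continuous_ofAdvTime
  unfold Data.point
  fun_prop

theorem continuous_comp_point {f : ℝ × ℝ → ℝ} (hf : ContinuousOn f S.dom) :
    Continuous fun p : ℝ × ℝ => f (S.point p.1 p.2) :=
  hf.comp_continuous hS.continuous_point fun p => hS.point_mem p.1 p.2

theorem continuous_kappa_one :
    Continuous fun p : ℝ × ℝ => S.kappa (1, S.ofAdvTime p.2) :=
  (hS.continuousOn_one hS.continuousOn_kappa).comp_continuous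
    (hS.continuous_ofAdvTime.comp continuous_snd) fun p => hS.ofAdvTime_mem p.2

theorem kappa_one_ne (w : ℝ) : S.kappa (1, S.ofAdvTime w) ≠ 0 :=
  (hS.kappa_one_pos (hS.ofAdvTime_mem w)).ne'

theorem continuous_comp_point_div {f : ℝ × ℝ → ℝ} (hf : ContinuousOn f S.dom) :
    Continuous fun p : ℝ × ℝ => f (S.point p.1 p.2) / S.kappa (1, S.ofAdvTime p.2) :=
  (hS.continuous_comp_point hf).div hS.continuous_kappa_one fun p => hS.kappa_one_ne p.2

omit hS in
theorem hasDerivAt_point_left {f : ℝ × ℝ → ℝ} {f' : ℝ} (hu : u ∈ Ioo 1 S.U₀)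
    (h : HasDerivWithinAt (fun u => f (u, (S.point u w).2)) f' S.uRange (S.point u w).1) :
    HasDerivAt (fun u => f (S.point u w)) f' u := by
  rw [point_of_mem ⟨hu.1.le, hu.2.le⟩] at h
  refine (h.hasDerivAt (Icc_mem_nhds hu.1 hu.2)).congr_of_eventuallyEq ?_
  filter_upwards [Icc_mem_nhds hu.1 hu.2] with x hx
  rw [point_of_mem hx]

theorem hasDerivAt_point_right {f : ℝ × ℝ → ℝ} {f' : ℝ} (hw : 1 < w)
    (h : HasDerivWithinAt (fun v => f ((S.point u w).1, v)) f' S.vRange (S.point u w).2) :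
    HasDerivAt (fun w => f (S.point u w)) (f' / S.kappa (1, S.ofAdvTime w)) w := by
  have h1 : HasDerivAt (fun v => f (max 1 (min u S.U₀), v)) f' (S.ofAdvTime w) :=
    h.hasDerivAt (vRange_mem_nhds (hS.ofAdvTime_mem w) (hS.one_lt_ofAdvTime hw))
  rw [div_eq_mul_inv]
  exact h1.comp w (hS.hasDerivAt_ofAdvTime hw)

theorem exists_initial_decay : ∃ C : ℝ, ∀ w,
    S.r (S.point 1 w) * |S.theta (S.point 1 w) / S.lam (S.point 1 w)| ≤ C ∧
    S.r (S.point 1 w) ^ ω * |S.φ (S.point 1 w) + S.theta (S.point 1 w) / S.lam (S.point 1 w)|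
      ≤ C := by
  obtain ⟨C, hC⟩ := hS.initial_decay
  refine ⟨C, fun w => ?_⟩
  rw [point_of_mem hS.one_mem_uRange]
  exact hC _ (hS.ofAdvTime_mem w)

/-- The bound is assumed for the Hawking mass; the difference `e² / (2 r)` is largest at `v = 1`. -/
theorem exists_varpi_one_le : ∃ M : ℝ, ∀ w, S.varpi (S.point 1 w) ≤ M := by
  refine ⟨sSup ((fun v => S.mass (1, v)) '' S.vRange) + S.e ^ 2 / (2 * S.r (1, 1)), fun w => ?_⟩
  have h1 := hS.r_pos (1, 1) ⟨hS.one_mem_uRange, hS.one_mem_vRange⟩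
  have h2 := hS.r_one_le_r (hS.ofAdvTime_mem w)
  have h3 := le_csSup hS.bddAbove_mass (mem_image_of_mem _ (hS.ofAdvTime_mem w))
  rw [point_of_mem hS.one_mem_uRange, Data.varpi]
  gcongr

/-- The solution in terms of the retarded coordinate and the normalized advanced time. -/
def normalizedSolution : NormalizedSolution where
  U := S.U₀
  e := S.e
  M := hS.exists_varpi_one_le.choose
  C₀ := hS.exists_initial_decay.choose
  ω := ω
  rPlus := S.rPlus
  r u w := S.r (S.point u w)
  nu u w := S.nu (S.point u w)
  lam u w := S.lam (S.point u w) / S.kappa (1, S.ofAdvTime w)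
  kappa u w := S.kappa (S.point u w) / S.kappa (1, S.ofAdvTime w)
  varpi u w := S.varpi (S.point u w)
  φ u w := S.φ (S.point u w)
  theta u w := S.theta (S.point u w) / S.kappa (1, S.ofAdvTime w)
  zeta u w := S.zeta (S.point u w)
  one_lt_U := hS.one_lt_U₀
  one_lt_ω := hS.one_lt_ω
  ω_le_three := hS.ω_le_three
  continuous_r := hS.continuous_comp_point hS.continuousOn_r
  continuous_nu := hS.continuous_comp_point hS.continuousOn_nu
  continuous_lam := hS.continuous_comp_point_div hS.continuousOn_lam
  continuous_kappa := hS.continuous_comp_point_div hS.continuousOn_kappa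
  continuous_varpi := hS.continuous_comp_point hS.continuousOn_varpi
  continuous_φ := hS.continuous_comp_point hS.continuousOn_φ
  continuous_theta := hS.continuous_comp_point_div hS.continuousOn_theta
  continuous_zeta := hS.continuous_comp_point hS.continuousOn_zeta
  r_pos u w := hS.r_pos _ (hS.point_mem u w)
  nu_neg u w := hS.nu_neg _ (hS.point_mem u w)
  kappa_pos u w := div_pos (hS.kappa_pos (hS.point_mem u w))
    (hS.kappa_one_pos (hS.ofAdvTime_mem w))
  lam_nonneg u w := div_nonneg (hS.lam_nonneg _ (hS.point_mem u w))
    (hS.kappa_one_pos (hS.ofAdvTime_mem w)).le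
  lam_pos u w hu := div_pos (hS.lam_pos _ (hS.point_mem u w)
    (max_lt hS.one_lt_U₀ (min_lt_iff.2 (Or.inl hu)))) (hS.kappa_one_pos (hS.ofAdvTime_mem w))
  lam_eq u w := by
    rw [hS.lam_eq (hS.point_mem u w)]
    ring
  kappa_one w := by
    rw [point_of_mem hS.one_mem_uRange]
    exact div_self (hS.kappa_one_ne w)
  varpi_one_le := hS.exists_varpi_one_le.choose_spec
  decay_theta w := by
    -- The quotient `θ / λ` does not depend on the parametrization of advanced time.
    rw [div_div_div_cancel_right₀ (hS.kappa_one_ne w)]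
    exact (hS.exists_initial_decay.choose_spec w).1
  decay_φ w := by
    rw [div_div_div_cancel_right₀ (hS.kappa_one_ne w)]
    exact (hS.exists_initial_decay.choose_spec w).2
  du_r u hu w := hasDerivAt_point_left hu (hS.du_r (hS.point_mem u w))
  dv_r u w hw := hS.hasDerivAt_point_right hw (hS.dv_r (hS.point_mem u w))
  du_φ u hu w := hasDerivAt_point_left hu (hS.du_φ (hS.point_mem u w))
  dv_φ u w hw := (hS.hasDerivAt_point_right hw (hS.dv_φ (hS.point_mem u w))).congr_deriv
    (div_right_comm _ _ _)
  dv_nu u w hw := (hS.hasDerivAt_point_right hw (hS.dv_nu (hS.point_mem u w))).congr_deriv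
    (by ring)
  du_lam u hu w := ((hasDerivAt_point_left hu (hS.du_lam (hS.point_mem u w))).div_const
    _).congr_deriv (by ring)
  du_varpi u hu w := hasDerivAt_point_left hu (hS.du_varpi' (hS.point_mem u w))
  dv_varpi u w hw := (hS.hasDerivAt_point_right hw (hS.dv_varpi _ (hS.point_mem u w))).congr_deriv
    (by
      have := hS.kappa_one_ne w
      have := (hS.kappa_pos (hS.point_mem u w)).ne'
      field_simp)
  du_kappa u hu w := ((hasDerivAt_point_left hu (hS.du_kappa _ (hS.point_mem u w))).div_const
    _).congr_deriv (by ring)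
  du_theta u hu w := ((hasDerivAt_point_left hu (hS.du_theta _ (hS.point_mem u w))).div_const
    _).congr_deriv (by ring)
  dv_zeta u w hw := (hS.hasDerivAt_point_right hw (hS.dv_zeta _ (hS.point_mem u w))).congr_deriv
    (by ring)
  unbounded_r u hu B := by
    have h := hS.not_bddAbove_r u hu
    simp only [bddAbove_def, mem_image, forall_exists_index, and_imp, forall_apply_eq_imp_iff₂,
      not_exists, not_forall, not_le] at h
    obtain ⟨v, hv, hB⟩ := h B
    refine ⟨S.advTime v, hS.one_le_advTime hv, ?_⟩
    rwa [hS.point_advTime ⟨⟨hu.1, hu.2.le⟩, hv⟩]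
  r_U_le w := by
    rw [point_of_mem ⟨hS.one_lt_U₀.le, le_rfl⟩]
    exact le_csSup hS.bddAbove_r (mem_image_of_mem _ (hS.ofAdvTime_mem w))
  exists_lt_r_U x hx := by
    obtain ⟨_, ⟨v, hv, rfl⟩, h⟩ := exists_lt_of_lt_csSup
      ((nonempty_of_mem hS.one_mem_vRange).image _) hx
    refine ⟨S.advTime v, hS.one_le_advTime hv, ?_⟩
    rwa [hS.point_advTime ⟨⟨hS.one_lt_U₀.le, le_rfl⟩, hv⟩]
  rPlus_ne := hS.rPlus_ne

end Assumptions

end SphericalCollapse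

end

/-! ### Return to the original coordinates. -/

theorem theorem9p3 (S : SphericalCollapse.Data) (ω : ℝ)
    (hS : SphericalCollapse.Assumptions S ω) (ε : ℝ) (hε : 0 < ε) :
    ∃ C > 0, ∃ δ > 0, ∀ u v : ℝ, (u, v) ∈ S.dom → S.r (u, v) ≤ δ * S.advTime v →
      |S.φ (u, v)| ≤
        C * (S.advTime v ^ (-(ω - ε)) * (S.r (u, v))⁻¹ + S.advTime v ^ (-ω)) ∧
      |S.thetaStar (u, v)| ≤
        C * (S.advTime v ^ (-(ω - ε)) * (S.r (u, v))⁻¹ + S.advTime v ^ (-ω)) ∧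
      |S.φ (u, v) * S.lamStar (u, v) + S.thetaStar (u, v)| ≤
        C * (S.advTime v ^ (-(ω - ε)) * (S.r (u, v))⁻¹ + S.advTime v ^ (-ω)) := by
  obtain ⟨C, hC, δ, hδ, h⟩ := hS.normalizedSolution.exists_abs_le hε
  refine ⟨C, hC, δ, hδ, fun u v huv hr => ?_⟩
  have h1 := h u huv.1 (S.advTime v) (hS.one_le_advTime huv.2)
  simp only [SphericalCollapse.Assumptions.normalizedSolution, hS.point_advTime huv,
    hS.ofAdvTime_advTime huv.2] at h1
  exact h1 hr
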